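/- Let $(G,H)$ be a $b$-Lie group: $G$ is a (finite-dimensional, Hausdorff) Lie group and $H\subset G$ is a closed subgroup of codimension one, that is, a closed embedded Lie subgroup which is a hypersurface of $G$. Let $H$ act on $G$ by left translations $L_h$, let $G/H$ be the space of orbits $Hg$ and $\pi:G\to G/H$ the projection. For a manifold $M$ with a closed embedded hypersurface $Z$, the $b$-tangent bundle ${}^bTM$ is the vector bundle associated to the module of $b$-vector fields (smooth vector fields tangent to $Z$ along $Z$), and the $b$-cotangent bundle ${}^bT^*M$ is its dual. A map $\varphi$ between two such manifolds acts on $b$-tangent vectors if there is a unique smooth bundle map $\varphi_*$ of $b$-tangent bundles over $\varphi$ that is compatible with the usual differential of $\varphi$ under the natural maps ${}^bT\to T$. The space $G/H$ has a smooth structure, as a one-dimensional manifold, for which $\pi$ is a submersion. Equip $G/H$ with any such structure and regard it as a $b$-manifold with critical hypersurface the point $[e]=\pi(e)$. Then $\pi$ is a principal $H$-bundle, and $\pi$ and the maps $L_h$ ($h\in H$) act on $b$-tangent vectors. Let $\mathcal H\subset{}^bTG$ be the vertical bundle: its fibre $\mathcal H_g$ consists of the values at $g$ of the fundamental vector fields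 $\zeta^\xi_g=\frac{d}{dt}\big|_{t=0}e^{t\xi}g$, $\xi\in\mathfrak h$, viewed as $b$-vector fields. Let $\mathcal H^\circ\subset{}^bT^*G$ be its annihilator, and $\tau_G^*:{}^bT^*G\to G$, $\tau_{G/H}^*:{}^bT^*(G/H)\to G/H$ the projections. Then: 1. $\mathcal H^\circ$ is an embedded submanifold of ${}^bT^*G$, of dimension $\dim G+1$, which is invariant under the $b$-cotangent lifted action $(h,\alpha_g)\mapsto (L_{h^{-1}})^*\alpha_g$ of $H$. 2. For every $\alpha_g\in\mathcal H^\circ_g$ there is a unique $\bar\pi\alpha_g\in{}^bT^*_{\pi(g)}(G/H)$ such that $(\bar\pi\alpha_g)(\pi_*v_g)=\alpha_g v_g$ for all $v_g\in{}^bT_gG$. 3. With the action of $H$ in 1, $\bar\pi:\mathcal H^\circ\to{}^bT^*(G/H)$ is a smooth principal $H$-bundle; in particular $\bar\pi$ is an open quotient map whose fibres are the $H$-orbits, so that ${}^bT^*(G/H)$ is the quotient space of $\mathcal H^\circ$. 4. The square $$\begin{array}{ccc}\mathcal H^\circ&\xrightarrow{\ \tau_G^*|_{\mathcal H^\circ}\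 }&G\\ {\scriptstyle\bar\pi}\downarrow&&\downarrow{\scriptstyle\pi}\\ {}^bT^*(G/H)&\xrightarrow{\ \tau_{G/H}^*\ }&G/H\end{array}$$ is a pull-back square of smooth manifolds, and $\tau_G^*|_{\mathcal H^\circ}$ is $H$-equivariant, so that the square is a map of principal $H$-bundles. -/

import Mathlib

open Bundle
open scoped Manifold ContDiff Topology Bundle
open Set MeasureTheory

set_option linter.unusedSectionVars false

namespace BGeometry

/-- A smooth function vanishing on a hyperplane is smoothly divisible by its linear equation. -/
theorem hadamard_division {E : Type*} [NormedAddCommGroup E] [NormedSpace ℝ E]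
    {s : E → ℝ} (hs : ContDiff ℝ ∞ s) (l : E →L[ℝ] ℝ) {w : E} (hw : l w = 1)
    (h0 : ∀ x, l x = 0 → s x = 0) :
    ∃ g : E → ℝ, ContDiff ℝ ∞ g ∧ ∀ x, s x = l x * g x := by
  let ρ : ContDiffBump (0 : ℝ) := ⟨2, 3, by norm_num, by norm_num⟩
  let D : E → ℝ → ℝ := fun x t => fderiv ℝ s (x - ((1 + t) * l x) • w) w
  let k : E → ℝ → ℝ := fun x t => ρ t * D x t
  have hD : ContDiff ℝ ∞ (fun q : E × ℝ => D q.1 q.2) := by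
    have h1 : ContDiff ℝ ∞ (fderiv ℝ s) := hs.fderiv_right (by simp)
    have h2 : ContDiff ℝ ∞ (fun q : E × ℝ => q.1 - ((1 + q.2) * l q.1) • w) := by fun_prop
    exact (h1.comp h2).clm_apply contDiff_const
  have hk : ContDiff ℝ ∞ (fun q : E × ℝ => k q.1 q.2) :=
    (ρ.contDiff.comp contDiff_snd).mul hD
  let f : ℝ → ℝ := indicator (Ioc (0 : ℝ) 1) 1
  have hf : LocallyIntegrable f volume := by
    refine (IntegrableOn.integrable_indicator ?_ measurableSet_Ioc).locallyIntegrable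
    exact integrableOn_const (by simp)
  refine ⟨fun x => (convolution f (k x) (ContinuousLinearMap.mul ℝ ℝ) volume) 0, ?_, ?_⟩
  · have := contDiffOn_convolution_right_with_param_comp (𝕜 := ℝ) (n := ⊤) (μ := volume)
      (ContinuousLinearMap.mul ℝ ℝ) (s := (univ : Set E)) (v := fun _ => (0 : ℝ))
      contDiffOn_const (f := f) (g := k) (k := Metric.closedBall 0 3) isOpen_univ
      (isCompact_closedBall _ _) ?_ hf hk.contDiffOn
    · exact contDiffOn_univ.1 this
    · intro p x _ hx
      have : ρ x = 0 := ρ.zero_of_le_dist (by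
        simp only [Metric.mem_closedBall, not_le] at hx; exact hx.le)
      simp [k, this]
  · intro x
    have hder : ∀ t : ℝ, HasDerivAt (fun t : ℝ => s (x - ((1 - t) * l x) • w))
        (l x * D x (-t)) t := by
      intro t
      have h1 : HasDerivAt (fun t : ℝ => x - ((1 - t) * l x) • w) (l x • w) t := by
        have : HasDerivAt (fun t : ℝ => (1 - t) * l x) (-1 * l x) t :=
          ((hasDerivAt_id t).const_sub 1).mul_const _
        have := (this.smul_const w).const_sub x
        simpa using! this
      have h2 : HasFDerivAt s (fderiv ℝ s (x - ((1 - t) * l x) • w)) (x - ((1 - t) * l x) • w) :=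
        (hs.differentiable (by simp) _).hasFDerivAt
      have := h2.comp_hasDerivAt t h1
      simpa [D, ← sub_eq_add_neg] using! this
    have hc : Continuous (fun t : ℝ => l x * D x (-t)) := by
      have := hD.continuous
      fun_prop
    have key := intervalIntegral.integral_eq_sub_of_hasDerivAt (a := 0) (b := 1)
      (fun t _ => hder t) (hc.intervalIntegrable _ _)
    have hz : s (x - ((1 - 0) * l x) • w) = 0 := h0 _ (by simp [hw])
    have h1 : s (x - ((1 - 1) * l x) • w) = s x := by simp
    rw [hz, h1, sub_zero, intervalIntegral.integral_const_mul] at key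
    rw [← key]
    congr 1
    beta_reduce
    rw [intervalIntegral.integral_of_le zero_le_one, convolution_def, ← integral_indicator measurableSet_Ioc]
    congr 1
    ext t
    by_cases ht : t ∈ Ioc (0 : ℝ) 1
    · have : ρ (-t) = 1 := ρ.one_of_mem_closedBall (by
        simp only [Metric.mem_closedBall, dist_zero_right, norm_neg, Real.norm_eq_abs]
        rw [abs_of_pos ht.1]; show t ≤ 2; linarith [ht.2])
      simp [ht, f, k, this]
    · simp [ht, f]
section
variable (E : Type*) [NormedAddCommGroup E] [NormedSpace ℝ E]
  {M : Type*} [TopologicalSpace M] [ChartedSpace E M]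

/-- `Z` is a (closed, embedded, codimension one) hypersurface of the manifold `M` modelled on `E`:
around each of its points there is a smooth chart of `M` in which `Z` is a linear hyperplane, so
that the linear form of the chart is a local defining function of `Z`. -/
class IsHypersurface (Z : Set M) : Prop where
  isClosed : IsClosed Z
  exists_slice : ∀ p ∈ Z, ∃ e ∈ IsManifold.maximalAtlas 𝓘(ℝ, E) ∞ M, p ∈ e.source ∧
    ∃ l : E →L[ℝ] ℝ, l ≠ 0 ∧ ∀ q ∈ e.source, q ∈ Z ↔ l (e q) = 0

variable [IsManifold 𝓘(ℝ, E) ∞ M]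

/-- Smooth vector fields on `M`. -/
abbrev VField (M : Type*) [TopologicalSpace M] [ChartedSpace E M] [IsManifold 𝓘(ℝ, E) ∞ M] :=
  Cₛ^∞⟮𝓘(ℝ, E); E, (TangentSpace 𝓘(ℝ, E) : M → Type _)⟯

/-- The `b`-vector fields of `(M, Z)`: the smooth vector fields tangent to `Z` at every point of `Z`,
that is, killing at the points of `Z` every smooth function vanishing on `Z`. -/
noncomputable def bVectorField (Z : Set M) : Submodule ℝ (VField E M) where
  carrier := {X | ∀ f : M → ℝ, ContMDiff 𝓘(ℝ, E) 𝓘(ℝ, ℝ) ∞ f → (∀ z ∈ Z, f z = 0) →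
    ∀ z ∈ Z, (mfderiv 𝓘(ℝ, E) 𝓘(ℝ, ℝ) f z (X z) : ℝ) = 0}
  add_mem' := by
    intro X Y hX hY f hf hz z hzZ
    have h1 := hX f hf hz z hzZ
    have h2 := hY f hf hz z hzZ
    simp only [ContMDiffSection.coe_add, Pi.add_apply, map_add]
    exact (congrArg₂ (· + ·) h1 h2).trans (add_zero _)
  zero_mem' := by
    intro f hf hz z hzZ
    simp
  smul_mem' := by
    intro c X hX f hf hz z hzZ
    have h1 := hX f hf hz z hzZ
    simp only [ContMDiffSection.coe_smul, Pi.smul_apply, map_smul]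
    exact (congrArg (c • ·) h1).trans (smul_zero c)

/-- The submodule of the module of `b`-vector fields generated by the products of a `b`-vector
field with a smooth function vanishing at `p`. -/
noncomputable def bVanishing (Z : Set M) (p : M) : Submodule ℝ (bVectorField E Z) :=
  Submodule.span ℝ {Y | ∃ f : M → ℝ, ContMDiff 𝓘(ℝ, E) 𝓘(ℝ, ℝ) ∞ f ∧ f p = 0 ∧
    ∃ X : bVectorField E Z, ∀ q, Y.1 q = f q • X.1 q}

/-- The fibre at `p` of the vector bundle associated to the module of `b`-vector fields: the quotient
of this module by the products with functions vanishing at `p`. -/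
def BTangentSpace (Z : Set M) (p : M) : Type _ := bVectorField E Z ⧸ bVanishing E Z p

section chartfields
variable {E}
theorem contMDiffOn_chartField {e : OpenPartialHomeomorph M E}
    (he : e ∈ IsManifold.maximalAtlas 𝓘(ℝ, E) ∞ M) {c : M → E}
    (hc : ContMDiffOn 𝓘(ℝ, E) 𝓘(ℝ, E) ∞ c e.source) :
    ContMDiffOn 𝓘(ℝ, E) (𝓘(ℝ, E).prod 𝓘(ℝ, E)) ∞
      (fun q => (⟨q, mfderiv 𝓘(ℝ, E) 𝓘(ℝ, E) e.symm (e q) (c q)⟩ :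
        TotalSpace E (TangentSpace 𝓘(ℝ, E) : M → Type _))) e.source := by
  have h1 := (contMDiffOn_symm_of_mem_maximalAtlas he).contMDiffOn_tangentMapWithin
    (m := ∞) (by simp) e.open_target.uniqueMDiffOn
  have h2 : ContMDiffOn 𝓘(ℝ, E) (𝓘(ℝ, E).prod 𝓘(ℝ, E)) ∞
      (fun q => (⟨e q, c q⟩ : TangentBundle 𝓘(ℝ, E) E)) e.source := by
    intro q hq
    rw [Bundle.contMDiffWithinAt_totalSpace]
    refine ⟨contMDiffOn_of_mem_maximalAtlas he q hq, ?_⟩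
    simpa using! hc q hq
  refine (h1.comp h2 ?_).congr ?_
  · intro q hq
    exact e.map_source hq
  · intro q hq
    have hx : e q ∈ e.target := e.map_source hq
    simp only [Function.comp, tangentMapWithin]
    rw [mfderivWithin_of_isOpen e.open_target hx]
    exact congrArg (fun y => (⟨y, mfderiv 𝓘(ℝ, E) 𝓘(ℝ, E) e.symm (e q) (c q)⟩ :
      TotalSpace E (TangentSpace 𝓘(ℝ, E) : M → Type _))) (e.left_inv hq).symm

theorem contMDiffOn_chartCoord {e : OpenPartialHomeomorph M E}
    (he : e ∈ IsManifold.maximalAtlas 𝓘(ℝ, E) ∞ M) (Y : VField E M) :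
    ContMDiffOn 𝓘(ℝ, E) 𝓘(ℝ, E) ∞
      (fun q => (mfderiv 𝓘(ℝ, E) 𝓘(ℝ, E) e q (Y q) : E)) e.source := by
  have h1 := (contMDiffOn_of_mem_maximalAtlas he).contMDiffOn_tangentMapWithin
    (m := ∞) (by simp) e.open_source.uniqueMDiffOn
  have h2 := h1.comp (Y.contMDiff.contMDiffOn (s := e.source)) (fun q hq => hq)
  intro q hq
  have h3 := h2 q hq
  rw [Bundle.contMDiffWithinAt_totalSpace] at h3
  have h4 := h3.2
  refine (ContMDiffWithinAt.congr h4 (fun y hy => ?_) ?_)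
  · simp [tangentMapWithin, mfderivWithin_of_isOpen e.open_source hy]
    rfl
  · simp [tangentMapWithin, mfderivWithin_of_isOpen e.open_source hq]
    rfl

theorem mdifferentiable_of_mem_maximalAtlas {e : OpenPartialHomeomorph M E}
    (he : e ∈ IsManifold.maximalAtlas 𝓘(ℝ, E) ∞ M) :
    e.MDifferentiable 𝓘(ℝ, E) 𝓘(ℝ, E) :=
  ⟨(contMDiffOn_of_mem_maximalAtlas he).mdifferentiableOn (by simp),
    (contMDiffOn_symm_of_mem_maximalAtlas he).mdifferentiableOn (by simp)⟩

theorem chart_symm_mfderiv {e : OpenPartialHomeomorph M E}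
    (he : e ∈ IsManifold.maximalAtlas 𝓘(ℝ, E) ∞ M) {q : M} (hq : q ∈ e.source)
    (v : TangentSpace 𝓘(ℝ, E) q) :
    (mfderiv 𝓘(ℝ, E) 𝓘(ℝ, E) e.symm (e q) (mfderiv 𝓘(ℝ, E) 𝓘(ℝ, E) e q v) : E) = v :=
  congrArg (fun L => L v) ((mdifferentiable_of_mem_maximalAtlas he).symm_comp_deriv hq)

theorem chart_mfderiv_symm {e : OpenPartialHomeomorph M E}
    (he : e ∈ IsManifold.maximalAtlas 𝓘(ℝ, E) ∞ M) {q : M} (hq : q ∈ e.source) (v : E) :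
    (mfderiv 𝓘(ℝ, E) 𝓘(ℝ, E) e q (mfderiv 𝓘(ℝ, E) 𝓘(ℝ, E) e.symm (e q) v) : E) = v := by
  have := (mdifferentiable_of_mem_maximalAtlas he).comp_symm_deriv (e.map_source hq)
  rw [e.left_inv hq] at this
  exact congrArg (fun L => L v) this
theorem slice_kernel {Z : Set M} {e : OpenPartialHomeomorph M E}
    (he : e ∈ IsManifold.maximalAtlas 𝓘(ℝ, E) ∞ M) {l : E →L[ℝ] ℝ}
    (hl : ∀ q ∈ e.source, q ∈ Z ↔ l (e q) = 0) {z : M} (hz : z ∈ e.source) (hzZ : z ∈ Z)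
    {k : E} (hk : l k = 0) {f : M → ℝ} (hf : ContMDiff 𝓘(ℝ, E) 𝓘(ℝ, ℝ) ∞ f)
    (hfZ : ∀ z ∈ Z, f z = 0) :
    (mfderiv 𝓘(ℝ, E) 𝓘(ℝ, ℝ) f z (mfderiv 𝓘(ℝ, E) 𝓘(ℝ, E) e.symm (e z) k) : ℝ) = 0 := by
  have hx : e z ∈ e.target := e.map_source hz
  have h1 : HasMFDerivAt 𝓘(ℝ, E) 𝓘(ℝ, E) e.symm (e z) (mfderiv 𝓘(ℝ, E) 𝓘(ℝ, E) e.symm (e z)) :=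
    ((mdifferentiable_of_mem_maximalAtlas he).mdifferentiableAt_symm hx).hasMFDerivAt
  have h2 : HasMFDerivAt 𝓘(ℝ, E) 𝓘(ℝ, ℝ) f (e.symm (e z)) (mfderiv 𝓘(ℝ, E) 𝓘(ℝ, ℝ) f z) := by
    rw [e.left_inv hz]
    exact (hf.mdifferentiable (by simp) z).hasMFDerivAt
  have h3 := (h2.comp (e z) h1).hasFDerivAt
  have h4 : HasDerivAt (fun t : ℝ => e z + t • k) k 0 := by
    simpa using! ((hasDerivAt_id (0 : ℝ)).smul_const k).const_add (e z)
  have h3' : HasFDerivAt (f ∘ e.symm) (ContinuousLinearMap.comp (M₂ := E)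
      (mfderiv 𝓘(ℝ, E) 𝓘(ℝ, ℝ) f z : E →L[ℝ] ℝ)
      (mfderiv 𝓘(ℝ, E) 𝓘(ℝ, E) e.symm (e z) : E →L[ℝ] E)) (e z + (0 : ℝ) • k) := by
    simpa using! h3
  have h5 := h3'.comp_hasDerivAt (0 : ℝ) h4
  have h6 : ((f ∘ e.symm) ∘ fun t : ℝ => e z + t • k) =ᶠ[𝓝 0] fun _ => 0 := by
    have hc : ContinuousAt (fun t : ℝ => e z + t • k) 0 := by fun_prop
    have : ∀ᶠ t in 𝓝 (0 : ℝ), e z + t • k ∈ e.target :=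
      hc.eventually_mem (by simpa using e.open_target.mem_nhds hx)
    filter_upwards [this] with t ht
    refine hfZ _ ((hl _ (e.map_target ht)).2 ?_)
    rw [e.right_inv ht]
    simp [hk, (hl z hz).1 hzZ]
  have h7 := h5.congr_of_eventuallyEq h6.symm
  exact h7.unique (hasDerivAt_const (0 : ℝ) (0 : ℝ))

theorem slice_tangent [FiniteDimensional ℝ E] [T2Space M] {Z : Set M}
    {e : OpenPartialHomeomorph M E}
    (he : e ∈ IsManifold.maximalAtlas 𝓘(ℝ, E) ∞ M) {l : E →L[ℝ] ℝ}
    (hl : ∀ q ∈ e.source, q ∈ Z ↔ l (e q) = 0) {z : M} (hz : z ∈ e.source) (hzZ : z ∈ Z)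
    (Y : bVectorField E Z) : l (mfderiv 𝓘(ℝ, E) 𝓘(ℝ, E) e z (Y.1 z)) = 0 := by
  obtain ⟨χ, -, hχ⟩ := (SmoothBumpFunction.nhds_basis_tsupport (I := 𝓘(ℝ, E)) z).mem_iff.1
    (e.open_source.mem_nhds hz)
  have hsm : ContMDiff 𝓘(ℝ, E) 𝓘(ℝ, ℝ) ∞ (fun q => χ q * l (e q)) := by
    refine contMDiff_of_tsupport fun x hx => ?_
    have hxs : x ∈ e.source := hχ (closure_mono (Function.support_mul_subset_left _ _) hx)
    exact χ.contMDiffAt.mul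
      (l.contDiff.contMDiff.contMDiffAt.comp x (contMDiffAt_of_mem_maximalAtlas he hxs))
  have h0 := Y.2 _ hsm (fun q hq => by
    by_cases hqs : q ∈ e.source
    · simp [(hl q hqs).1 hq]
    · have : χ q = 0 := by
        by_contra h
        exact hqs (hχ (subset_tsupport _ h))
      simp [this]) z hzZ
  have heq : (fun q => χ q * l (e q)) =ᶠ[𝓝 z] (l ∘ e) := by
    filter_upwards [χ.eventuallyEq_one] with q hq
    simp [hq]
  rw [heq.mfderiv_eq] at h0
  have h1 : HasMFDerivAt 𝓘(ℝ, E) 𝓘(ℝ, E) e z (mfderiv 𝓘(ℝ, E) 𝓘(ℝ, E) e z) :=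
    ((mdifferentiable_of_mem_maximalAtlas he).mdifferentiableAt hz).hasMFDerivAt
  have h2 : HasMFDerivAt 𝓘(ℝ, E) 𝓘(ℝ, ℝ) l (e z) l := l.hasMFDerivAt
  rw [(h2.comp z h1).mfderiv] at h0
  exact h0

variable (E) in
theorem exists_slice_data (Z : Set M) [hZ : IsHypersurface E Z] (p : M) :
    ∃ e ∈ IsManifold.maximalAtlas 𝓘(ℝ, E) ∞ M, p ∈ e.source ∧ ∃ (l : E →L[ℝ] ℝ) (w : E),
      (l w = 1 ∧ ∀ q ∈ e.source, q ∈ Z ↔ l (e q) = 0) ∨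
      (l = 0 ∧ w = 0 ∧ ∀ q ∈ e.source, q ∉ Z) := by
  by_cases hp : p ∈ Z
  · obtain ⟨e, he, hpe, l, hl, hq⟩ := hZ.exists_slice p hp
    obtain ⟨v, hv⟩ : ∃ v, l v ≠ 0 := by
      by_contra! h
      exact hl (ContinuousLinearMap.ext h)
    exact ⟨e, he, hpe, l, (l v)⁻¹ • v, Or.inl ⟨by simp [hv], hq⟩⟩
  · refine ⟨(chartAt E p).restr Zᶜ, ?_, ?_, 0, 0, Or.inr ⟨rfl, rfl, ?_⟩⟩
    · exact restr_mem_maximalAtlas (contDiffGroupoid ∞ 𝓘(ℝ, E))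
        (IsManifold.chart_mem_maximalAtlas p) hZ.isClosed.isOpen_compl
    · rw [OpenPartialHomeomorph.restr_source' _ _ hZ.isClosed.isOpen_compl]
      exact ⟨mem_chart_source E p, hp⟩
    · intro q hq
      rw [OpenPartialHomeomorph.restr_source' _ _ hZ.isClosed.isOpen_compl] at hq
      exact hq.2

/-- A family `X` of `b`-vector fields, depending linearly on a vector of the model space, whose
restriction to the open set `U` is a frame: over `U` each `b`-vector field is a combination of `X`
with smooth coefficients, and the coefficients are unique. -/
structure IsBFrame (Z : Set M) (U : Set M) (X : E →ₗ[ℝ] bVectorField E Z) : Prop where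
  isOpen : IsOpen U
  exists_coeff : ∀ Y : bVectorField E Z, ∃ a : M → E,
    ContMDiffOn 𝓘(ℝ, E) 𝓘(ℝ, E) ∞ a U ∧ ∀ q ∈ U, Y.1 q = (X (a q)).1 q
  coeff_unique : ∀ a : M → E, ContinuousOn a U → (∀ q ∈ U, (X (a q)).1 q = 0) → ∀ q ∈ U, a q = 0

theorem slice_coeff {e : OpenPartialHomeomorph M E} [FiniteDimensional ℝ E]
    (he : e ∈ IsManifold.maximalAtlas 𝓘(ℝ, E) ∞ M) {l : E →L[ℝ] ℝ} {w : E} (hlw : l w = 1)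
    {p : M} (hp : p ∈ e.source) :
    ∃ N ∈ 𝓝 p, ∀ y : M → E, ContMDiffOn 𝓘(ℝ, E) 𝓘(ℝ, E) ∞ y e.source →
      (∀ q ∈ e.source, l (e q) = 0 → l (y q) = 0) →
      ∃ g : E → ℝ, ContDiff ℝ ∞ g ∧ ∀ q ∈ N, l (y q) = l (e q) * g (e q) := by
  have hx : e p ∈ e.target := e.map_source hp
  obtain ⟨r, hr, hrt⟩ := Metric.nhds_basis_closedBall.mem_iff.1 (e.open_target.mem_nhds hx)
  let ρ : ContDiffBump (e p) := ⟨r / 2, r, by linarith, by linarith⟩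
  have hts : tsupport ρ ⊆ e.target := by rw [ρ.tsupport_eq]; exact hrt
  have hc : ContinuousAt e p := e.continuousAt hp
  refine ⟨_, Filter.inter_mem (hc.eventually ρ.eventuallyEq_one) (e.open_source.mem_nhds hp), ?_⟩
  intro y hy hly
  have hs : ContDiff ℝ ∞ (fun x => ρ x * l (y (e.symm x))) := by
    rw [← contMDiff_iff_contDiff]
    refine contMDiff_of_tsupport fun x hx => ?_
    have hxt : x ∈ e.target := hts (closure_mono (Function.support_mul_subset_left _ _) hx)
    refine ρ.contDiff.contMDiff.contMDiffAt.mul (l.contDiff.contMDiff.contMDiffAt.comp x ?_)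
    exact ((hy _ (e.map_target hxt)).contMDiffAt
      (e.open_source.mem_nhds (e.map_target hxt))).comp x
      (contMDiffAt_symm_of_mem_maximalAtlas he hxt)
  obtain ⟨g, hg, hgs⟩ := hadamard_division hs l hlw (fun x hlx => by
    by_cases hxt : x ∈ e.target
    · rw [hly _ (e.map_target hxt) (by rw [e.right_inv hxt]; exact hlx), mul_zero]
    · have : ρ x = 0 := by
        by_contra h
        exact hxt (hts (subset_tsupport _ h))
      rw [this, zero_mul])
  refine ⟨g, hg, ?_⟩
  rintro q ⟨hq, hqs⟩
  have hq' : ρ (e q) = 1 := hq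
  have := hgs (e q)
  rw [e.left_inv hqs, hq'] at this
  simpa using this

variable (E) in
theorem exists_isBFrame [FiniteDimensional ℝ E] [T2Space M] (Z : Set M) [IsHypersurface E Z]
    (p : M) : ∃ (U : Set M) (X : E →ₗ[ℝ] bVectorField E Z), p ∈ U ∧ IsBFrame Z U X := by
  obtain ⟨e, he, hpe, l, w, hcase⟩ := exists_slice_data E Z p
  obtain ⟨χ, -, hχ⟩ := (SmoothBumpFunction.nhds_basis_tsupport (I := 𝓘(ℝ, E)) p).mem_iff.1
    (e.open_source.mem_nhds hpe)
  have hχs : ∀ q, q ∉ e.source → χ q = 0 := fun q hq => by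
    by_contra h
    exact hq (hχ (subset_tsupport _ h))
  have hdiv : ∃ N ∈ 𝓝 p, ∀ Y : bVectorField E Z, ∃ g : E → ℝ, ContDiff ℝ ∞ g ∧
      ∀ q ∈ N, l (mfderiv 𝓘(ℝ, E) 𝓘(ℝ, E) e q (Y.1 q) : E) = l (e q) * g (e q) := by
    rcases hcase with ⟨hlw, hl⟩ | ⟨rfl, rfl, hl⟩
    · obtain ⟨N, hN, h⟩ := slice_coeff he hlw hpe
      refine ⟨N, hN, fun Y => h _ (contMDiffOn_chartCoord he Y.1) fun q hq hq0 => ?_⟩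
      exact slice_tangent he hl hq ((hl q hq).2 hq0) Y
    · exact ⟨univ, Filter.univ_mem, fun Y => ⟨0, contDiff_const, fun q _ => by
        rw [show (0 : E →L[ℝ] ℝ) (e q) = 0 from rfl, zero_mul]; rfl⟩⟩
  obtain ⟨N, hN, hdiv⟩ := hdiv
  let A : E → M → E := fun u q => u - l u • w + (l (e q) * l u) • w
  have hA : ∀ u, ContMDiffOn 𝓘(ℝ, E) 𝓘(ℝ, E) ∞ (A u) e.source := by
    intro u
    have h1 : ContDiff ℝ ∞ (fun x : E => u - l u • w + (l x * l u) • w) := by fun_prop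
    exact h1.contMDiff.comp_contMDiffOn (contMDiffOn_of_mem_maximalAtlas he)
  let X : E →ₗ[ℝ] bVectorField E Z :=
    { toFun := fun u => ⟨⟨fun q => χ q • mfderiv 𝓘(ℝ, E) 𝓘(ℝ, E) e.symm (e q) (A u q),
          ContMDiffOn.smul_section_of_tsupport χ.contMDiff.contMDiffOn e.open_source hχ
            (contMDiffOn_chartField he (hA u))⟩, by
          intro f hf hfZ z hz
          by_cases hzs : z ∈ e.source
          · rcases hcase with ⟨hlw, hl⟩ | ⟨-, -, hl⟩
            · have h0 : l (e z) = 0 := (hl z hzs).1 hz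
              have hk : l (A u z) = 0 := by simp [A, h0, hlw]
              have := slice_kernel he hl hzs hz hk hf hfZ
              exact (map_smul (mfderiv 𝓘(ℝ, E) 𝓘(ℝ, ℝ) f z : E →L[ℝ] ℝ) (χ z)
                (mfderiv 𝓘(ℝ, E) 𝓘(ℝ, E) e.symm (e z) (A u z) : E)).trans
                ((congrArg (χ z • ·) this).trans (smul_zero _))
            · exact absurd hz (hl z hzs)
          · have h0 : χ z • (mfderiv 𝓘(ℝ, E) 𝓘(ℝ, E) e.symm (e z) (A u z) : E) = 0 := by
              rw [hχs z hzs, zero_smul]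
            exact (congrArg (mfderiv 𝓘(ℝ, E) 𝓘(ℝ, ℝ) f z : E →L[ℝ] ℝ) h0).trans (map_zero _)⟩
      map_add' := by
        intro u v
        apply Subtype.ext
        apply ContMDiffSection.ext
        intro q
        have : A (u + v) q = A u q + A v q := by
          simp only [A, map_add, add_smul, mul_add]; abel
        have h2 : ∀ T : E →L[ℝ] E, χ q • T (A (u + v) q) = χ q • T (A u q) + χ q • T (A v q) := by
          intro T
          rw [this, map_add, smul_add]
        exact h2 (mfderiv 𝓘(ℝ, E) 𝓘(ℝ, E) e.symm (e q))
      map_smul' := by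
        intro c u
        apply Subtype.ext
        apply ContMDiffSection.ext
        intro q
        have : A (c • u) q = c • A u q := by
          simp only [A, map_smul, smul_eq_mul, smul_add, smul_sub, smul_smul]
          congr 2
          ring
        have h2 : ∀ T : E →L[ℝ] E, χ q • T (A (c • u) q) = c • χ q • T (A u q) := by
          intro T
          rw [this, map_smul, smul_comm]
        exact h2 (mfderiv 𝓘(ℝ, E) 𝓘(ℝ, E) e.symm (e q)) }
  have hX : ∀ u q, (X u).1 q = χ q • mfderiv 𝓘(ℝ, E) 𝓘(ℝ, E) e.symm (e q) (A u q) :=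
    fun _ _ => rfl
  have hU : ∀ q ∈ interior {q | χ q = 1}, χ q = 1 :=
    fun q hq => interior_subset (s := {q | χ q = 1}) hq
  have hXU : ∀ u, ∀ q ∈ interior {q | χ q = 1}, (X u).1 q =
      mfderiv 𝓘(ℝ, E) 𝓘(ℝ, E) e.symm (e q) (A u q) := by
    intro u q hq
    rw [hX, hU q hq, one_smul]
  refine ⟨interior N ∩ e.source ∩ interior {q | χ q = 1}, X, ⟨⟨?_, hpe⟩, ?_⟩, ⟨?_, ?_, ?_⟩⟩
  · exact mem_interior_iff_mem_nhds.2 hN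
  · exact mem_interior_iff_mem_nhds.2 χ.eventuallyEq_one
  · exact (isOpen_interior.inter e.open_source).inter isOpen_interior
  · intro Y
    obtain ⟨g, hg, hgN⟩ := hdiv Y
    let y : M → E := fun q => mfderiv 𝓘(ℝ, E) 𝓘(ℝ, E) e q (Y.1 q)
    have hy : ContMDiffOn 𝓘(ℝ, E) 𝓘(ℝ, E) ∞ y e.source := contMDiffOn_chartCoord he Y.1
    refine ⟨fun q => y q - l (y q) • w + g (e q) • w, ?_, ?_⟩
    · have h1 : ContMDiffOn 𝓘(ℝ, E) 𝓘(ℝ, ℝ) ∞ (fun q => g (e q)) e.source :=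
        hg.contMDiff.comp_contMDiffOn (contMDiffOn_of_mem_maximalAtlas he)
      have h2 : ContMDiffOn 𝓘(ℝ, E) 𝓘(ℝ, ℝ) ∞ (fun q => l (y q)) e.source :=
        l.contDiff.contMDiff.comp_contMDiffOn hy
      refine ContMDiffOn.mono (s := e.source) ?_ (fun q hq => hq.1.2)
      exact (hy.sub (h2.smul contMDiffOn_const)).add (h1.smul contMDiffOn_const)
    · rintro q ⟨⟨hqN, hqs⟩, hq1⟩
      rw [hXU _ q hq1, ← chart_symm_mfderiv he hqs (Y.1 q)]
      have hgq : l (y q) = l (e q) * g (e q) := hgN q (interior_subset hqN)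
      have : A (y q - l (y q) • w + g (e q) • w) q = y q := by
        rcases hcase with ⟨hlw, -⟩ | ⟨rfl, rfl, -⟩
        · simp only [A, map_add, map_sub, map_smul, smul_eq_mul, hlw, mul_one, sub_self, zero_add,
            ← hgq]
          abel
        · simp [A]
      exact (congrArg (fun x : E => (mfderiv 𝓘(ℝ, E) 𝓘(ℝ, E) e.symm (e q) : E →L[ℝ] E) x) this).symm
  · intro a ha h0 q hq
    have key : ∀ q ∈ interior N ∩ e.source ∩ interior {q | χ q = 1}, A (a q) q = 0 := by
      intro q hq
      have h1 := h0 q hq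
      rw [hXU _ q hq.2] at h1
      have h2 := chart_mfderiv_symm he hq.1.2 (A (a q) q)
      rw [← h2]
      exact (congrArg (fun x : E => (mfderiv 𝓘(ℝ, E) 𝓘(ℝ, E) e q : E →L[ℝ] E) x) h1).trans
        (map_zero (mfderiv 𝓘(ℝ, E) 𝓘(ℝ, E) e q : E →L[ℝ] E))
    rcases hcase with ⟨hlw, -⟩ | ⟨rfl, rfl, -⟩
    · have hl : ∀ q ∈ interior N ∩ e.source ∩ interior {q | χ q = 1}, l (e q) ≠ 0 →
          l (a q) = 0 := by
        intro q hq hne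
        have := congrArg l (key q hq)
        simp only [A, map_add, map_sub, map_smul, smul_eq_mul, hlw, mul_one, sub_self, zero_add,
          map_zero, mul_eq_zero] at this
        exact this.resolve_left hne
      suffices hla : l (a q) = 0 by
        have := key q hq
        simpa [A, hla] using this
      by_cases hne : l (e q) = 0
      swap
      · exact hl q hq hne
      have hUo : IsOpen (interior N ∩ e.source ∩ interior {q | χ q = 1}) :=
        (isOpen_interior.inter e.open_source).inter isOpen_interior
      let γ : ℝ → M := fun t => e.symm (e q + t • w)
      have hγ : Filter.Tendsto γ (𝓝 0) (𝓝 q) := by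
        have h1 : Filter.Tendsto (fun t : ℝ => e q + t • w) (𝓝 0) (𝓝 (e q)) := by
          have : Continuous (fun t : ℝ => e q + t • w) := by fun_prop
          simpa using this.tendsto 0
        have h2 := (e.continuousAt_symm (e.map_source hq.1.2)).tendsto
        rw [e.left_inv hq.1.2] at h2
        exact h2.comp h1
      have hγt : ∀ᶠ t : ℝ in 𝓝 0, e q + t • w ∈ e.target := by
        have : Continuous (fun t : ℝ => e q + t • w) := by fun_prop
        exact this.continuousAt.eventually_mem
          (by simpa using e.open_target.mem_nhds (e.map_source hq.1.2))
      have h1 : Filter.Tendsto (fun t => l (a (γ t))) (𝓝[≠] 0) (𝓝 (l (a q))) :=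
        (l.continuous.tendsto _).comp (((ha.continuousAt (hUo.mem_nhds hq)).tendsto.comp hγ).mono_left
          nhdsWithin_le_nhds)
      have h2 : ∀ᶠ t in 𝓝[≠] (0 : ℝ), l (a (γ t)) = 0 := by
        filter_upwards [nhdsWithin_le_nhds (hγ.eventually_mem (hUo.mem_nhds hq)),
          nhdsWithin_le_nhds hγt, self_mem_nhdsWithin] with t ht htt ht0
        refine hl _ ht ?_
        simp only [γ, e.right_inv htt, map_add, hne, map_smul, hlw, smul_eq_mul, mul_one, zero_add]
        exact ht0
      exact tendsto_nhds_unique h1 (tendsto_const_nhds.congr' (h2.mono fun t ht => ht.symm))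
    · simpa [A] using key q hq
end chartfields

noncomputable instance (Z : Set M) (p : M) : AddCommGroup (BTangentSpace E Z p) :=
  inferInstanceAs (AddCommGroup (bVectorField E Z ⧸ bVanishing E Z p))

noncomputable instance (Z : Set M) (p : M) : Module ℝ (BTangentSpace E Z p) :=
  inferInstanceAs (Module ℝ (bVectorField E Z ⧸ bVanishing E Z p))

/-- The value at `p` of a `b`-vector field, as an element of the `b`-tangent space. -/
noncomputable def bValue (Z : Set M) (p : M) : bVectorField E Z →ₗ[ℝ] BTangentSpace E Z p :=
  (bVanishing E Z p).mkQ

variable {E}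

theorem bValue_eq_zero_iff {Z : Set M} {p : M} {Y : bVectorField E Z} :
    bValue E Z p Y = 0 ↔ Y ∈ bVanishing E Z p :=
  Submodule.Quotient.mk_eq_zero _

theorem exists_fun_smul {Z : Set M} {f : M → ℝ} (hf : ContMDiff 𝓘(ℝ, E) 𝓘(ℝ, ℝ) ∞ f)
    (Y : bVectorField E Z) : ∃ Y' : bVectorField E Z, ∀ q, Y'.1 q = f q • Y.1 q := by
  refine ⟨⟨⟨fun q => f q • Y.1 q, hf.smul_section Y.1.contMDiff⟩, ?_⟩, fun q => rfl⟩
  intro g hg hgZ z hz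
  exact (map_smul (mfderiv 𝓘(ℝ, E) 𝓘(ℝ, ℝ) g z : E →L[ℝ] ℝ) (f z) (Y.1 z : E)).trans
    ((congrArg (f z • ·) (Y.2 g hg hgZ z hz)).trans (smul_zero _))

/-- The values at `q` of the members of a frame. -/
noncomputable def frameMap {Z : Set M} (X : E →ₗ[ℝ] bVectorField E Z) (q : M) :
    E →ₗ[ℝ] BTangentSpace E Z q :=
  bValue E Z q ∘ₗ X

namespace IsBFrame

variable {Z U : Set M} {X : E →ₗ[ℝ] bVectorField E Z}

theorem coeff_of_mem_bVanishing (h : IsBFrame Z U X) {p : M} {Y : bVectorField E Z}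
    (hY : Y ∈ bVanishing E Z p) : ∃ a : M → E, ContMDiffOn 𝓘(ℝ, E) 𝓘(ℝ, E) ∞ a U ∧
      (∀ q ∈ U, Y.1 q = (X (a q)).1 q) ∧ a p = 0 := by
  induction hY using Submodule.span_induction with
  | mem Y hY =>
    obtain ⟨f, hf, hfp, Y', hY'⟩ := hY
    obtain ⟨a, ha, haU⟩ := h.exists_coeff Y'
    refine ⟨fun q => f q • a q, hf.contMDiffOn.smul ha, fun q hq => ?_, by simp [hfp]⟩
    rw [hY', haU q hq, map_smul]
    rfl
  | zero => exact ⟨fun _ => 0, contMDiffOn_const, fun q _ => by rw [map_zero], rfl⟩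
  | add Y₁ Y₂ _ _ h₁ h₂ =>
    obtain ⟨a, ha, haU, hap⟩ := h₁
    obtain ⟨b, hb, hbU, hbp⟩ := h₂
    refine ⟨fun q => a q + b q, ha.add hb, fun q hq => ?_, by simp [hap, hbp]⟩
    rw [map_add]
    exact congrArg₂ (· + ·) (haU q hq) (hbU q hq)
  | smul c Y _ h₁ =>
    obtain ⟨a, ha, haU, hap⟩ := h₁
    refine ⟨fun q => c • a q,
      (contMDiff_const (I := 𝓘(ℝ, E)) (I' := 𝓘(ℝ, ℝ)) (c := c)).contMDiffOn.smul ha, fun q hq => ?_, by simp [hap]⟩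
    rw [map_smul]
    exact congrArg (c • ·) (haU q hq)

theorem mem_bVanishing [FiniteDimensional ℝ E] [T2Space M] (h : IsBFrame Z U X) {p : M}
    (hp : p ∈ U) {Y : bVectorField E Z} {a : M → E} (ha : ContMDiffOn 𝓘(ℝ, E) 𝓘(ℝ, E) ∞ a U)
    (haU : ∀ q ∈ U, Y.1 q = (X (a q)).1 q) (hap : a p = 0) : Y ∈ bVanishing E Z p := by
  obtain ⟨χ, -, hχ⟩ := (SmoothBumpFunction.nhds_basis_tsupport (I := 𝓘(ℝ, E)) p).mem_iff.1
    (h.isOpen.mem_nhds hp)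
  have hχs : ∀ q, q ∉ U → χ q = 0 := fun q hq => by
    by_contra h
    exact hq (hχ (subset_tsupport _ h))
  let b := Module.finBasis ℝ E
  have h1 : ContMDiff 𝓘(ℝ, E) 𝓘(ℝ, ℝ) ∞ (fun q => 1 - χ q) := contMDiff_const.sub χ.contMDiff
  have h2 : ∀ i, ContMDiff 𝓘(ℝ, E) 𝓘(ℝ, ℝ) ∞ (fun q => χ q * b.coord i (a q)) := by
    intro i
    refine contMDiff_of_tsupport fun x hx => ?_
    have hxU : x ∈ U := hχ (closure_mono (Function.support_mul_subset_left _ _) hx)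
    exact χ.contMDiffAt.mul
      ((LinearMap.toContinuousLinearMap (b.coord i)).contDiff.contMDiff.contMDiffAt.comp x
        ((ha x hxU).contMDiffAt (h.isOpen.mem_nhds hxU)))
  obtain ⟨Y₀, hY₀⟩ := exists_fun_smul h1 Y
  choose Y' hY' using fun i => exists_fun_smul (h2 i) (X (b i))
  have hsum : Y = Y₀ + ∑ i, Y' i := by
    apply Subtype.ext
    apply ContMDiffSection.ext
    intro q
    have hcoe : ((Y₀ + ∑ i, Y' i : bVectorField E Z)).1 q = Y₀.1 q + ∑ i, (Y' i).1 q := by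
      let ev : bVectorField E Z →ₗ[ℝ] TangentSpace 𝓘(ℝ, E) q :=
        { toFun := fun W => W.1 q, map_add' := fun _ _ => rfl, map_smul' := fun _ _ => rfl }
      change ev (Y₀ + ∑ i, Y' i) = ev Y₀ + ∑ i, ev (Y' i)
      rw [map_add, map_sum]
    rw [hcoe, hY₀]
    by_cases hq : q ∈ U
    · have hXa : (X (a q)).1 q = ∑ i, b.coord i (a q) • (X (b i)).1 q := by
        let ev : bVectorField E Z →ₗ[ℝ] TangentSpace 𝓘(ℝ, E) q :=
          { toFun := fun W => W.1 q, map_add' := fun _ _ => rfl, map_smul' := fun _ _ => rfl }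
        change ev (X (a q)) = ∑ i, b.coord i (a q) • ev (X (b i))
        conv_lhs => rw [← b.sum_repr (a q)]
        simp only [map_sum, map_smul]
        rfl
      simp only [hY', mul_smul]
      rw [← Finset.smul_sum, ← hXa, ← haU q hq, sub_smul, one_smul]
      abel
    · simp only [hY', hχs q hq, zero_mul, zero_smul, Finset.sum_const_zero, sub_zero, one_smul,
        add_zero]
  rw [hsum]
  refine add_mem (Submodule.subset_span ⟨_, h1, by simp, Y, hY₀⟩) (sum_mem fun i _ => ?_)
  exact Submodule.subset_span ⟨_, h2 i, by simp [hap], X (b i), hY' i⟩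

theorem bValue_eq [FiniteDimensional ℝ E] [T2Space M] (h : IsBFrame Z U X) {p : M}
    (hp : p ∈ U) {Y : bVectorField E Z} {a : M → E} (ha : ContMDiffOn 𝓘(ℝ, E) 𝓘(ℝ, E) ∞ a U)
    (haU : ∀ q ∈ U, Y.1 q = (X (a q)).1 q) : bValue E Z p Y = frameMap X p (a p) := by
  rw [← sub_eq_zero]
  change bValue E Z p Y - bValue E Z p (X (a p)) = 0
  rw [← map_sub, bValue_eq_zero_iff]
  refine h.mem_bVanishing hp (a := fun q => a q - a p) (ha.sub contMDiffOn_const)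
    (fun q hq => ?_) (sub_self _)
  rw [map_sub]
  exact congrArg (· - (X (a p)).1 q) (haU q hq)

theorem frameMap_bijective [FiniteDimensional ℝ E] [T2Space M] (h : IsBFrame Z U X) {p : M}
    (hp : p ∈ U) : Function.Bijective (frameMap X p) := by
  constructor
  · rw [← LinearMap.ker_eq_bot, LinearMap.ker_eq_bot']
    intro u hu
    obtain ⟨a, ha, haU, hap⟩ := h.coeff_of_mem_bVanishing (bValue_eq_zero_iff.1 hu)
    have := h.coeff_unique (fun q => u - a q) (contMDiffOn_const.sub ha).continuousOn
      (fun q hq => by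
        rw [map_sub]
        exact sub_eq_zero.2 (haU q hq)) p hp
    simpa [hap] using this
  · intro v
    obtain ⟨Y, rfl⟩ := Submodule.mkQ_surjective _ v
    obtain ⟨a, ha, haU⟩ := h.exists_coeff Y
    exact ⟨a p, (h.bValue_eq hp ha haU).symm⟩

end IsBFrame

open Classical in
/-- The coordinates of a `b`-tangent vector with respect to a frame. -/
noncomputable def frameCoord {Z : Set M} (X : E →ₗ[ℝ] bVectorField E Z) (q : M) :
    BTangentSpace E Z q →ₗ[ℝ] E :=
  if h : Function.Bijective (frameMap X q) then (LinearEquiv.ofBijective _ h).symm else 0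

section bundle
variable [FiniteDimensional ℝ E] [T2Space M] {Z : Set M}

theorem IsBFrame.frameCoord_frameMap {U : Set M} {X : E →ₗ[ℝ] bVectorField E Z}
    (h : IsBFrame Z U X) {q : M} (hq : q ∈ U) (u : E) : frameCoord X q (frameMap X q u) = u := by
  rw [frameCoord, dif_pos (h.frameMap_bijective hq)]
  exact (LinearEquiv.ofBijective _ (h.frameMap_bijective hq)).symm_apply_apply u

theorem IsBFrame.frameMap_frameCoord {U : Set M} {X : E →ₗ[ℝ] bVectorField E Z}
    (h : IsBFrame Z U X) {q : M} (hq : q ∈ U) (v : BTangentSpace E Z q) :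
    frameMap X q (frameCoord X q v) = v := by
  obtain ⟨u, rfl⟩ := (h.frameMap_bijective hq).2 v
  rw [h.frameCoord_frameMap hq]

/-- The local trivialization of the `b`-tangent bundle given by a frame. -/
noncomputable def framePretrivialization {U : Set M} {X : E →ₗ[ℝ] bVectorField E Z}
    (h : IsBFrame Z U X) : Pretrivialization E (π E (BTangentSpace E Z)) where
  toFun v := (v.1, frameCoord X v.1 v.2)
  invFun y := ⟨y.1, frameMap X y.1 y.2⟩
  source := π E (BTangentSpace E Z) ⁻¹' U
  target := U ×ˢ univ
  map_source' v hv := ⟨hv, mem_univ _⟩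
  map_target' y hy := hy.1
  left_inv' := by
    rintro ⟨q, v⟩ hv
    exact congrArg (TotalSpace.mk q) (h.frameMap_frameCoord hv v)
  right_inv' := by
    rintro ⟨q, u⟩ ⟨hq, -⟩
    exact congrArg (Prod.mk q) (h.frameCoord_frameMap hq u)
  open_target := h.isOpen.prod isOpen_univ
  baseSet := U
  open_baseSet := h.isOpen
  source_eq := rfl
  target_eq := rfl
  proj_toFun _ _ := rfl

noncomputable instance framePretrivialization_isLinear {U : Set M}
    {X : E →ₗ[ℝ] bVectorField E Z} (h : IsBFrame Z U X) :
    (framePretrivialization h).IsLinear ℝ where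
  linear q _ := ⟨fun v w => map_add (frameCoord X q) v w, fun c v => map_smul (frameCoord X q) c v⟩

theorem framePretrivialization_symm {U : Set M} {X : E →ₗ[ℝ] bVectorField E Z}
    (h : IsBFrame Z U X) {q : M} (hq : q ∈ U) (u : E) :
    (framePretrivialization h).symm q u = frameMap X q u := by
  rw [Pretrivialization.symm_apply _ hq]
  rfl

theorem exists_contMDiffOn_coordChange {U U' : Set M} {X X' : E →ₗ[ℝ] bVectorField E Z}
    (h : IsBFrame Z U X) (h' : IsBFrame Z U' X') :
    ∃ f : M → E →L[ℝ] E, ContMDiffOn 𝓘(ℝ, E) 𝓘(ℝ, E →L[ℝ] E) ∞ f (U ∩ U') ∧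
      ∀ q ∈ U ∩ U', ∀ u, f q u =
        (framePretrivialization h' ⟨q, (framePretrivialization h).symm q u⟩).2 := by
  let b := Module.finBasis ℝ E
  choose a ha haU using fun i => h'.exists_coeff (X (b i))
  refine ⟨fun q => ∑ i, (LinearMap.toContinuousLinearMap (b.coord i)).smulRight (a i q), ?_, ?_⟩
  · refine contMDiffOn_finsetSum fun i _ => ?_
    exact ((ContinuousLinearMap.smulRightL ℝ E E
      (LinearMap.toContinuousLinearMap (b.coord i))).contDiff.contMDiff.comp_contMDiffOn
      ((ha i).mono inter_subset_right))
  · rintro q ⟨hq, hq'⟩ u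
    rw [framePretrivialization_symm h hq]
    change _ = frameCoord X' q (frameMap X q u)
    have : ∀ i, frameCoord X' q (frameMap X q (b i)) = a i q := by
      intro i
      change frameCoord X' q (bValue E Z q (X (b i))) = a i q
      rw [h'.bValue_eq hq' (ha i) (haU i), h'.frameCoord_frameMap hq']
    conv_rhs => rw [← b.sum_repr u]
    simp only [map_sum, map_smul, this]
    simp

variable (E Z) in
noncomputable def bFrameSet [IsHypersurface E Z] (p : M) : Set M := (exists_isBFrame E Z p).choose

variable (E Z) in
noncomputable def bFrameAt [IsHypersurface E Z] (p : M) : E →ₗ[ℝ] bVectorField E Z :=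
  (exists_isBFrame E Z p).choose_spec.choose

theorem mem_bFrameSet [IsHypersurface E Z] (p : M) : p ∈ bFrameSet E Z p :=
  (exists_isBFrame E Z p).choose_spec.choose_spec.1

theorem isBFrame_bFrameAt [IsHypersurface E Z] (p : M) :
    IsBFrame Z (bFrameSet E Z p) (bFrameAt E Z p) :=
  (exists_isBFrame E Z p).choose_spec.choose_spec.2

variable [IsHypersurface E Z]

noncomputable instance (p : M) : TopologicalSpace (BTangentSpace E Z p) :=
  .induced (frameCoord (bFrameAt E Z p) p) inferInstance

variable (E Z) in
/-- The vector bundle structure of the `b`-tangent bundle, whose trivializations are given by the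
local frames of `b`-vector fields. -/
noncomputable def bTangentPrebundle : VectorPrebundle ℝ E (BTangentSpace E Z) where
  pretrivializationAtlas := {e | ∃ (U : Set M) (X : E →ₗ[ℝ] bVectorField E Z)
    (h : IsBFrame Z U X), e = framePretrivialization h}
  pretrivialization_linear' := by
    rintro _ ⟨U, X, h, rfl⟩
    infer_instance
  pretrivializationAt p := framePretrivialization (isBFrame_bFrameAt (E := E) (Z := Z) p)
  mem_base_pretrivializationAt p := mem_bFrameSet p
  pretrivialization_mem_atlas p := ⟨_, _, _, rfl⟩
  exists_coordChange := by
    rintro _ ⟨U, X, h, rfl⟩ _ ⟨U', X', h', rfl⟩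
    obtain ⟨f, hf, hf'⟩ := exists_contMDiffOn_coordChange h h'
    exact ⟨f, hf.continuousOn, hf'⟩
  totalSpaceMk_isInducing p := by
    have h1 : Topology.IsInducing (frameCoord (bFrameAt E Z p) p) := ⟨rfl⟩
    have h2 : Topology.IsInducing (Prod.mk p : E → M × E) := (Topology.isInducing_const_prod (x := p)).2 .id
    exact h2.comp h1

instance : (bTangentPrebundle E Z).IsContMDiff 𝓘(ℝ, E) ∞ where
  exists_contMDiffCoordChange := by
    rintro _ ⟨U, X, h, rfl⟩ _ ⟨U', X', h', rfl⟩
    exact exists_contMDiffOn_coordChange h h'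

noncomputable instance : TopologicalSpace (TotalSpace E (BTangentSpace E Z)) :=
  (bTangentPrebundle E Z).totalSpaceTopology

noncomputable instance : FiberBundle E (BTangentSpace E Z) :=
  (bTangentPrebundle E Z).toFiberBundle

instance : VectorBundle ℝ E (BTangentSpace E Z) := (bTangentPrebundle E Z).toVectorBundle

instance : ContMDiffVectorBundle ∞ E (BTangentSpace E Z) 𝓘(ℝ, E) :=
  (bTangentPrebundle E Z).contMDiffVectorBundle 𝓘(ℝ, E)

end bundle

variable (E) in
/-- The total space of the `b`-tangent bundle. -/
abbrev BTangentBundle (Z : Set M) := TotalSpace E (BTangentSpace E Z)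

section
variable [FiniteDimensional ℝ E] [T2Space M] 
variable (E) in
/-- The fibres of the `b`-cotangent bundle, the dual bundle of the `b`-tangent bundle. -/
abbrev BCotangentSpace (Z : Set M) [IsHypersurface E Z] (p : M) : Type _ :=
  BTangentSpace E Z p →L[ℝ] Bundle.Trivial M ℝ p
variable (E) in
/-- The total space of the `b`-cotangent bundle; it is a smooth manifold as the total space of a
smooth bundle of continuous linear maps. -/
abbrev BCotangentBundle (Z : Set M) [IsHypersurface E Z] : Type _ :=
  TotalSpace (E →L[ℝ] ℝ) (BCotangentSpace E Z)

end
end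

/-- A point of a one-dimensional manifold is a hypersurface. -/
instance isHypersurface_singleton {N : Type*} [TopologicalSpace N] [T1Space N]
    [ChartedSpace ℝ N] [IsManifold 𝓘(ℝ, ℝ) ∞ N] (x : N) : IsHypersurface ℝ ({x} : Set N) where
  isClosed := isClosed_singleton
  exists_slice := by
    rintro p rfl
    let c := chartAt ℝ p
    let t : ℝ ≃ₜ ℝ := Homeomorph.addRight (-(c p))
    have hc : c ∈ IsManifold.maximalAtlas 𝓘(ℝ, ℝ) ∞ N := IsManifold.chart_mem_maximalAtlas p
    refine ⟨c.transHomeomorph t, ?_, mem_chart_source ℝ p, ContinuousLinearMap.id ℝ ℝ, ?_, ?_⟩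
    · rw [IsManifold.mem_maximalAtlas_iff_contMDiffOn]
      have h1 : ContDiff ℝ ∞ (fun y : ℝ => y + -(c p)) := by fun_prop
      have h2 : ContDiff ℝ ∞ (fun y : ℝ => y + -(-(c p))) := by fun_prop
      refine ⟨h1.contMDiff.comp_contMDiffOn (contMDiffOn_of_mem_maximalAtlas hc), ?_⟩
      exact (contMDiffOn_symm_of_mem_maximalAtlas hc).comp h2.contMDiff.contMDiffOn
        (fun y hy => hy)
    · intro h
      simpa using congrArg (fun L : ℝ →L[ℝ] ℝ => L 1) h
    · intro q hq
      have hp : p ∈ c.source := mem_chart_source ℝ p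
      constructor
      · rintro rfl
        simp [t]
      · intro h
        refine c.injOn hq hp ?_
        have : c q + -(c p) = 0 := h
        linarith

section differential
variable {E : Type*} [NormedAddCommGroup E] [NormedSpace ℝ E] [FiniteDimensional ℝ E]
  {M : Type*} [TopologicalSpace M] [T2Space M] [ChartedSpace E M] [IsManifold 𝓘(ℝ, E) ∞ M]
  {E' : Type*} [NormedAddCommGroup E'] [NormedSpace ℝ E'] [FiniteDimensional ℝ E']
  {N : Type*} [TopologicalSpace N] [T2Space N] [ChartedSpace E' N] [IsManifold 𝓘(ℝ, E') ∞ N]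

/-- The natural map from the `b`-tangent space to the tangent space. -/
noncomputable def bAnchor (Z : Set M) (p : M) :
    BTangentSpace E Z p →ₗ[ℝ] TangentSpace 𝓘(ℝ, E) p :=
  (bVanishing E Z p).liftQ
    { toFun := fun X => X.1 p, map_add' := fun _ _ => rfl, map_smul' := fun _ _ => rfl } (by
      rw [bVanishing, Submodule.span_le]
      rintro Y ⟨f, -, hf, X, hY⟩
      change Y.1 p = 0
      rw [hY, hf, zero_smul])

variable (E E')

/-- `Φ` is a differential of the map `φ` on `b`-tangent bundles: a smooth bundle map over `φ` that
induces the usual differential on tangent vectors. -/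
structure IsBDifferential (Z : Set M) [IsHypersurface E Z] (W : Set N) [IsHypersurface E' W]
    (φ : M → N) (Φ : ∀ p, BTangentSpace E Z p →L[ℝ] BTangentSpace E' W (φ p)) : Prop where
  contMDiff : ContMDiff (𝓘(ℝ, E).prod 𝓘(ℝ, E)) (𝓘(ℝ, E').prod 𝓘(ℝ, E')) ∞
    (fun v : BTangentBundle E Z => (⟨φ v.1, Φ v.1 v.2⟩ : BTangentBundle E' W))
  anchor : ∀ (p : M) (v : BTangentSpace E Z p),
    bAnchor W (φ p) (Φ p v) = mfderiv 𝓘(ℝ, E) 𝓘(ℝ, E') φ p (bAnchor Z p v)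

open Classical in
/-- The map induced by `φ` on `b`-tangent vectors, the unique differential of `φ` on the `b`-tangent
bundles (zero by convention if this does not exist or is not unique). -/
noncomputable def bDifferential (Z : Set M) [IsHypersurface E Z] (W : Set N)
    [IsHypersurface E' W] (φ : M → N) (p : M) :
    BTangentSpace E Z p →L[ℝ] BTangentSpace E' W (φ p) :=
  if h : ∃! Φ, IsBDifferential E E' Z W φ Φ then h.choose p else 0

/-- The pull-back by `φ` of a `b`-covector at `q = φ p`. -/
noncomputable def bPullback (Z : Set M) [IsHypersurface E Z] (W : Set N) [IsHypersurface E' W]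
    (φ : M → N) {p : M} {q : N} (h : φ p = q) (α : BCotangentSpace E' W q) :
    BCotangentSpace E Z p :=
  ContinuousLinearMap.comp α (h ▸ bDifferential E E' Z W φ p)

/-- The relation `(β) (φ_* v) = α v` for all `v` in the fibre of the `b`-tangent bundle over the base
point of `α`; the base point of `β` is the image under `φ` of that of `α`. -/
def DescendsTo (Z : Set M) [IsHypersurface E Z] (W : Set N) [IsHypersurface E' W] (φ : M → N)
    (α : BCotangentBundle E Z) (β : BCotangentBundle E' W) : Prop :=
  ∃ b : BCotangentSpace E' W (φ α.proj), β = ⟨φ α.proj, b⟩ ∧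
    ∀ v : BTangentSpace E Z α.proj, b (bDifferential E E' Z W φ α.proj v) = α.2 v

end differential

/-- `pr : P → B` is a smooth principal bundle with structure group the Lie group `K`, acting smoothly
on `P` from the left: over small open sets `V` of `B`, there is a `K`-equivariant diffeomorphism
of `pr ⁻¹ V` with `V × K` over `V`. -/
structure IsPrincipalBundle {K EK HK P EP HP B EB HB : Type*}
    [NormedAddCommGroup EK] [NormedSpace ℝ EK] [TopologicalSpace HK] [Group K] [TopologicalSpace K]
    [ChartedSpace HK K]
    [NormedAddCommGroup EP] [NormedSpace ℝ EP] [TopologicalSpace HP] [TopologicalSpace P]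
    [ChartedSpace HP P]
    [NormedAddCommGroup EB] [NormedSpace ℝ EB] [TopologicalSpace HB] [TopologicalSpace B]
    [ChartedSpace HB B]
    (IK : ModelWithCorners ℝ EK HK) (IP : ModelWithCorners ℝ EP HP)
    (IB : ModelWithCorners ℝ EB HB) (act : K → P → P) (pr : P → B) : Prop where
  one_act : ∀ x, act 1 x = x
  mul_act : ∀ k k' x, act (k * k') x = act k (act k' x)
  contMDiff_act : ContMDiff (IK.prod IP) IP ∞ (fun y : K × P => act y.1 y.2)
  locally_trivial : ∀ b : B, ∃ (V : Set B) (e : OpenPartialHomeomorph P (B × K)),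
    IsOpen V ∧ b ∈ V ∧ e.source = pr ⁻¹' V ∧ e.target = V ×ˢ univ ∧
    ContMDiffOn IP (IB.prod IK) ∞ e e.source ∧
    ContMDiffOn (IB.prod IK) IP ∞ e.symm e.target ∧
    ∀ x ∈ e.source, (e x).1 = pr x ∧ ∀ k, (e (act k x)).2 = k * (e x).2

/-- The square with sides `f : P → A`, `g : P → B`, `a : A → C`, `b : B → C` is a pull-back square of
smooth manifolds: it commutes, and has the universal property for smooth maps from manifolds. -/
structure IsSmoothPullback.{w} {P EP HP A EA HA B EB HB C : Type*}
    [NormedAddCommGroup EP] [NormedSpace ℝ EP] [TopologicalSpace HP] [TopologicalSpace P]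
    [ChartedSpace HP P]
    [NormedAddCommGroup EA] [NormedSpace ℝ EA] [TopologicalSpace HA] [TopologicalSpace A]
    [ChartedSpace HA A]
    [NormedAddCommGroup EB] [NormedSpace ℝ EB] [TopologicalSpace HB] [TopologicalSpace B]
    [ChartedSpace HB B]
    (IP : ModelWithCorners ℝ EP HP) (IA : ModelWithCorners ℝ EA HA)
    (IB : ModelWithCorners ℝ EB HB) (f : P → A) (g : P → B) (a : A → C) (b : B → C) : Prop where
  contMDiff_left : ContMDiff IP IA ∞ f
  contMDiff_right : ContMDiff IP IB ∞ g
  comm : ∀ x, a (f x) = b (g x)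
  lift : ∀ {EN N : Type w} [NormedAddCommGroup EN] [NormedSpace ℝ EN] [FiniteDimensional ℝ EN]
    [TopologicalSpace N] [ChartedSpace EN N] [IsManifold 𝓘(ℝ, EN) ∞ N] (u : N → A) (v : N → B),
    ContMDiff 𝓘(ℝ, EN) IA ∞ u → ContMDiff 𝓘(ℝ, EN) IB ∞ v → (∀ y, a (u y) = b (v y)) →
    ∃! c : N → P, ContMDiff 𝓘(ℝ, EN) IP ∞ c ∧ (∀ y, f (c y) = u y) ∧ ∀ y, g (c y) = v y

section coset
variable {G : Type*} [Group G] [TopologicalSpace G] (H : Subgroup G)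

/-- The space `G/H` of the orbits `Hg` of the left translations by `H` on `G`. -/
abbrev CosetSpace : Type _ := Quotient (MulAction.orbitRel H G)

/-- The projection `G → G/H`. -/
abbrev cosetMk (g : G) : CosetSpace H := Quotient.mk (MulAction.orbitRel H G) g

variable (E : Type*) [NormedAddCommGroup E] [NormedSpace ℝ E] [FiniteDimensional ℝ E]
  (EH : Type*) [NormedAddCommGroup EH] [NormedSpace ℝ EH]
  [T2Space G] [ChartedSpace E G] [LieGroup 𝓘(ℝ, E) ∞ G]
  [IsHypersurface E (H : Set G)] [ChartedSpace EH H]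

/-- The `b`-cotangent lift of the left translation by `h`: the pull-back by the translation by `h⁻¹`. -/
noncomputable def bCotangentLift (h : H) (α : BCotangentBundle E (H : Set G)) :
    BCotangentBundle E (H : Set G) :=
  ⟨h * α.1, bPullback E E (H : Set G) (H : Set G) (fun g : G => (h : G)⁻¹ * g)
    (inv_mul_cancel_left (h : G) α.1) α.2⟩

/-- The fundamental vector field of the element `ξ` of the Lie algebra of `H`, for the action of `H`
on `G` by left translations; its value at `g` is the right translate of `ξ` by `g`. -/
noncomputable def fundamentalField (ξ : TangentSpace 𝓘(ℝ, EH) (1 : H)) (g : G) : TangentSpace 𝓘(ℝ, E) g :=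
  mfderiv 𝓘(ℝ, EH) 𝓘(ℝ, E) (fun h : H => (h : G) * g) 1 ξ

/-- The fibre at `g` of the vertical bundle, as a subspace of the `b`-tangent space: the values at `g`
of the fundamental fields, which are `b`-vector fields. -/
noncomputable def bVerticalSpace (g : G) : Submodule ℝ (BTangentSpace E (H : Set G) g) :=
  Submodule.span ℝ {w | ∃ (ξ : TangentSpace 𝓘(ℝ, EH) (1 : H)) (Y : bVectorField E (H : Set G)),
    (∀ g', Y.1 g' = fundamentalField H E EH ξ g') ∧ w = bValue E (H : Set G) g Y}

/-- The annihilator of the vertical bundle in the `b`-cotangent bundle of `G`. -/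
def verticalAnnihilator : Set (BCotangentBundle E (H : Set G)) :=
  {α | ∀ w ∈ bVerticalSpace H E EH α.1, α.2 w = 0}

end coset
end BGeometry

universe w

/-! Near each point of `G` a submersion chart turns the projection `π` into a linear form `l` whose
kernel consists of the orbit directions; fix `w` with `l w = 1`. The `b`-vector fields of `G` are
then framed by the coordinate fields along `ker l` and by the field along `w` multiplied by a factor
`c ∘ l`, where `c` is the identity if the chart is centred on `H` and `1` if it avoids `H`. On `G/H`
the coordinate field is multiplied by the same `c`. The two factors cancel, so in these adapted
frames (`exists_isAdapted`) the `b`-differential of `π` has the constant matrix `l`. In particular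
it is onto at every point, including those of `H`, and its kernel is exactly the vertical bundle
(`mem_bVerticalSpace_iff`).

The `b`-differentials themselves are controlled by density. Off the hypersurface the natural map
from `b`-tangent to tangent vectors is injective, so a continuous map into the `b`-tangent bundle is
determined by its image in the tangent bundle as soon as it avoids the hypersurface densely
(`eqOn_of_bAnchorTotal`). This gives the uniqueness of differentials, the gluing of local ones, the
vanishing of `π_*` on fundamental fields, and `π_* ∘ (L_h)_* = π_*`.

In adapted frames a covector lies in the annihilator iff it is a multiple of `l`. So the annihilator
is locally a linear slice of the cotangent bundle with one fibre coordinate, and its elements are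
the covectors that factor through `π_*`. Hence it is the fibre product of `G` and the `b`-cotangent
bundle of `G/H` over `G/H`, smoothly as well (`contMDiffAt_verticalAnnihilator`). The lifted action
moves only the base point (`DescendsToCoset.bCotangentLift`), so the principal bundle `G → G/H`
pulls back to the desired one (`IsPrincipalBundle.of_pullback`).

The smooth structure on `G/H` comes from coordinates of the form "element of `H` times point of a
transversal curve" near `1` (`exists_coset_chart_at_one`), moved around by right translations. -/

namespace BGeometry

/-! ### Frames of `b`-vector fields in a slice chart -/

section frames
variable {E : Type*} [NormedAddCommGroup E] [NormedSpace ℝ E]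
  {M : Type*} [TopologicalSpace M] [ChartedSpace E M] [IsManifold 𝓘(ℝ, E) ∞ M]

/-- In a chart `e` in which `Z` is the hyperplane `l = 0` (or empty), the coordinate fields, with
the field transversal to `Z` multiplied by `l ∘ e`, are a frame of `b`-vector fields. -/
theorem exists_isBFrame_slice [FiniteDimensional ℝ E] [T2Space M] {Z : Set M}
    {e : OpenPartialHomeomorph M E} (he : e ∈ IsManifold.maximalAtlas 𝓘(ℝ, E) ∞ M) {p : M}
    (hpe : p ∈ e.source) {l : E →L[ℝ] ℝ} {w : E} (hlw : l w = 1) {c : ℝ → ℝ}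
    (hcase : (c = id ∧ ∀ q ∈ e.source, q ∈ Z ↔ l (e q) = 0) ∨
      (c = (fun _ => 1) ∧ ∀ q ∈ e.source, q ∉ Z)) :
    ∃ (U : Set M) (X : E →ₗ[ℝ] bVectorField E Z), p ∈ U ∧ U ⊆ e.source ∧ IsBFrame Z U X ∧
      ∀ u, ∀ q ∈ U, (X u).1 q =
        mfderiv 𝓘(ℝ, E) 𝓘(ℝ, E) e.symm (e q) (u - l u • w + (c (l (e q)) * l u) • w) := by
  have hcd : ContDiff ℝ ∞ c := by
    rcases hcase with ⟨rfl, -⟩ | ⟨rfl, -⟩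
    · exact contDiff_id
    · exact contDiff_const
  obtain ⟨χ, -, hχ⟩ := (SmoothBumpFunction.nhds_basis_tsupport (I := 𝓘(ℝ, E)) p).mem_iff.1
    (e.open_source.mem_nhds hpe)
  have hχs : ∀ q, q ∉ e.source → χ q = 0 := fun q hq => by
    by_contra h
    exact hq (hχ (subset_tsupport _ h))
  -- The transversal component of a `b`-vector field is divisible by `c ∘ l`: by Hadamard's lemma
  -- when `c` is the identity, trivially when `c = 1`.
  have hdiv : ∃ N ∈ 𝓝 p, ∀ Y : bVectorField E Z, ∃ g : M → ℝ,
      ContMDiffOn 𝓘(ℝ, E) 𝓘(ℝ, ℝ) ∞ g e.source ∧ ∀ q ∈ N ∩ e.source,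
        l (mfderiv 𝓘(ℝ, E) 𝓘(ℝ, E) e q (Y.1 q) : E) = c (l (e q)) * g q := by
    rcases hcase with ⟨rfl, hl⟩ | ⟨rfl, hl⟩
    · obtain ⟨N, hN, h⟩ := slice_coeff he hlw hpe
      refine ⟨N, hN, fun Y => ?_⟩
      obtain ⟨g, hg, hgN⟩ := h _ (contMDiffOn_chartCoord he Y.1) fun q hq hq0 =>
        slice_tangent he hl hq ((hl q hq).2 hq0) Y
      exact ⟨fun q => g (e q), hg.contMDiff.comp_contMDiffOn (contMDiffOn_of_mem_maximalAtlas he),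
        fun q hq => hgN q hq.1⟩
    · exact ⟨univ, Filter.univ_mem, fun Y => ⟨fun q => l (mfderiv 𝓘(ℝ, E) 𝓘(ℝ, E) e q (Y.1 q) : E),
        l.contDiff.contMDiff.comp_contMDiffOn (contMDiffOn_chartCoord he Y.1),
        fun q _ => (one_mul _).symm⟩⟩
  obtain ⟨N, hN, hdiv⟩ := hdiv
  -- The part of `u` in `ker l` is kept and the part along `w` is scaled by `c ∘ l`. Keeping `c` as
  -- a parameter makes it possible to use the same factor on the source and on the target of a
  -- submersion.
  let A : E → M → E := fun u q => u - l u • w + (c (l (e q)) * l u) • w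
  have hA : ∀ u, ContMDiffOn 𝓘(ℝ, E) 𝓘(ℝ, E) ∞ (A u) e.source := by
    intro u
    have h1 : ContDiff ℝ ∞ (fun x : E => u - l u • w + (c (l x) * l u) • w) := by
      have := hcd.comp l.contDiff
      exact contDiff_const.add ((this.mul contDiff_const).smul contDiff_const)
    exact h1.contMDiff.comp_contMDiffOn (contMDiffOn_of_mem_maximalAtlas he)
  let X : E →ₗ[ℝ] bVectorField E Z :=
    { toFun := fun u => ⟨⟨fun q => χ q • mfderiv 𝓘(ℝ, E) 𝓘(ℝ, E) e.symm (e q) (A u q),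
          ContMDiffOn.smul_section_of_tsupport χ.contMDiff.contMDiffOn e.open_source hχ
            (contMDiffOn_chartField he (hA u))⟩, by
          intro f hf hfZ z hz
          by_cases hzs : z ∈ e.source
          · rcases hcase with ⟨rfl, hl⟩ | ⟨-, hl⟩
            · have h0 : l (e z) = 0 := (hl z hzs).1 hz
              have hk : l (A u z) = 0 := by simp [A, h0, hlw]
              have := slice_kernel he hl hzs hz hk hf hfZ
              exact (map_smul (mfderiv 𝓘(ℝ, E) 𝓘(ℝ, ℝ) f z : E →L[ℝ] ℝ) (χ z)
                (mfderiv 𝓘(ℝ, E) 𝓘(ℝ, E) e.symm (e z) (A u z) : E)).trans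
                ((congrArg (χ z • ·) this).trans (smul_zero _))
            · exact absurd hz (hl z hzs)
          · have h0 : χ z • (mfderiv 𝓘(ℝ, E) 𝓘(ℝ, E) e.symm (e z) (A u z) : E) = 0 := by
              rw [hχs z hzs, zero_smul]
            exact (congrArg (mfderiv 𝓘(ℝ, E) 𝓘(ℝ, ℝ) f z : E →L[ℝ] ℝ) h0).trans (map_zero _)⟩
      map_add' := by
        intro u v
        apply Subtype.ext
        apply ContMDiffSection.ext
        intro q
        have : A (u + v) q = A u q + A v q := by
          simp only [A, map_add, add_smul, mul_add]; abel
        have h2 : ∀ T : E →L[ℝ] E, χ q • T (A (u + v) q) = χ q • T (A u q) + χ q • T (A v q) := by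
          intro T
          rw [this, map_add, smul_add]
        exact h2 (mfderiv 𝓘(ℝ, E) 𝓘(ℝ, E) e.symm (e q))
      map_smul' := by
        intro c u
        apply Subtype.ext
        apply ContMDiffSection.ext
        intro q
        have : A (c • u) q = c • A u q := by
          simp only [A, map_smul, smul_eq_mul, smul_add, smul_sub, smul_smul]
          congr 2
          ring
        have h2 : ∀ T : E →L[ℝ] E, χ q • T (A (c • u) q) = c • χ q • T (A u q) := by
          intro T
          rw [this, map_smul, smul_comm]
        exact h2 (mfderiv 𝓘(ℝ, E) 𝓘(ℝ, E) e.symm (e q)) }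
  have hX : ∀ u q, (X u).1 q = χ q • mfderiv 𝓘(ℝ, E) 𝓘(ℝ, E) e.symm (e q) (A u q) :=
    fun _ _ => rfl
  have hU : ∀ q ∈ interior {q | χ q = 1}, χ q = 1 :=
    fun q hq => interior_subset (s := {q | χ q = 1}) hq
  have hXU : ∀ u, ∀ q ∈ interior {q | χ q = 1}, (X u).1 q =
      mfderiv 𝓘(ℝ, E) 𝓘(ℝ, E) e.symm (e q) (A u q) := by
    intro u q hq
    rw [hX, hU q hq, one_smul]
  refine ⟨interior N ∩ e.source ∩ interior {q | χ q = 1}, X, ⟨⟨?_, hpe⟩, ?_⟩,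
    fun q hq => hq.1.2, ⟨?_, ?_, ?_⟩, fun u q hq => hXU u q hq.2⟩
  · exact mem_interior_iff_mem_nhds.2 hN
  · exact mem_interior_iff_mem_nhds.2 χ.eventuallyEq_one
  · exact (isOpen_interior.inter e.open_source).inter isOpen_interior
  · intro Y
    obtain ⟨g, hg, hgN⟩ := hdiv Y
    let y : M → E := fun q => mfderiv 𝓘(ℝ, E) 𝓘(ℝ, E) e q (Y.1 q)
    have hy : ContMDiffOn 𝓘(ℝ, E) 𝓘(ℝ, E) ∞ y e.source := contMDiffOn_chartCoord he Y.1
    -- The solution `a` of `A a = y`: same part in `ker l`, transversal part divided by `c ∘ l`.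
    refine ⟨fun q => y q - l (y q) • w + g q • w, ?_, ?_⟩
    · have h2 : ContMDiffOn 𝓘(ℝ, E) 𝓘(ℝ, ℝ) ∞ (fun q => l (y q)) e.source :=
        l.contDiff.contMDiff.comp_contMDiffOn hy
      refine ContMDiffOn.mono (s := e.source) ?_ (fun q hq => hq.1.2)
      exact (hy.sub (h2.smul contMDiffOn_const)).add (hg.smul contMDiffOn_const)
    · rintro q ⟨⟨hqN, hqs⟩, hq1⟩
      rw [hXU _ q hq1, ← chart_symm_mfderiv he hqs (Y.1 q)]
      have hgq : l (y q) = c (l (e q)) * g q := hgN q ⟨interior_subset hqN, hqs⟩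
      have : A (y q - l (y q) • w + g q • w) q = y q := by
        simp only [A, map_add, map_sub, map_smul, smul_eq_mul, hlw, mul_one, sub_self, zero_add,
          ← hgq]
        abel
      exact (congrArg (fun x : E => (mfderiv 𝓘(ℝ, E) 𝓘(ℝ, E) e.symm (e q) : E →L[ℝ] E) x) this).symm
  · intro a ha h0 q hq
    have key : ∀ q ∈ interior N ∩ e.source ∩ interior {q | χ q = 1}, A (a q) q = 0 := by
      intro q hq
      have h1 := h0 q hq
      rw [hXU _ q hq.2] at h1
      have h2 := chart_mfderiv_symm he hq.1.2 (A (a q) q)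
      rw [← h2]
      exact (congrArg (fun x : E => (mfderiv 𝓘(ℝ, E) 𝓘(ℝ, E) e q : E →L[ℝ] E) x) h1).trans
        (map_zero (mfderiv 𝓘(ℝ, E) 𝓘(ℝ, E) e q : E →L[ℝ] E))
    suffices hla : l (a q) = 0 by
      have := key q hq
      simpa [A, hla] using this
    have hl' : ∀ q ∈ interior N ∩ e.source ∩ interior {q | χ q = 1}, c (l (e q)) ≠ 0 →
        l (a q) = 0 := by
      intro q hq hne
      have := congrArg l (key q hq)
      simp only [A, map_add, map_sub, map_smul, smul_eq_mul, hlw, mul_one, sub_self, zero_add,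
        map_zero, mul_eq_zero] at this
      exact this.resolve_left hne
    rcases hcase with ⟨rfl, -⟩ | ⟨rfl, -⟩
    · have hl : ∀ q ∈ interior N ∩ e.source ∩ interior {q | χ q = 1}, l (e q) ≠ 0 →
          l (a q) = 0 := hl'
      by_cases hne : l (e q) = 0
      swap
      · exact hl q hq hne
      have hUo : IsOpen (interior N ∩ e.source ∩ interior {q | χ q = 1}) :=
        (isOpen_interior.inter e.open_source).inter isOpen_interior
      -- At a point of the hyperplane the factor `c ∘ l` vanishes and gives no information on `l (a
      -- q)`; the value is obtained as a limit along a transversal line, using the continuity of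
      -- `a`.
      let γ : ℝ → M := fun t => e.symm (e q + t • w)
      have hγ : Filter.Tendsto γ (𝓝 0) (𝓝 q) := by
        have h1 : Filter.Tendsto (fun t : ℝ => e q + t • w) (𝓝 0) (𝓝 (e q)) := by
          have : Continuous (fun t : ℝ => e q + t • w) := by fun_prop
          simpa using this.tendsto 0
        have h2 := (e.continuousAt_symm (e.map_source hq.1.2)).tendsto
        rw [e.left_inv hq.1.2] at h2
        exact h2.comp h1
      have hγt : ∀ᶠ t : ℝ in 𝓝 0, e q + t • w ∈ e.target := by
        have : Continuous (fun t : ℝ => e q + t • w) := by fun_prop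
        exact this.continuousAt.eventually_mem
          (by simpa using e.open_target.mem_nhds (e.map_source hq.1.2))
      have h1 : Filter.Tendsto (fun t => l (a (γ t))) (𝓝[≠] 0) (𝓝 (l (a q))) :=
        (l.continuous.tendsto _).comp (((ha.continuousAt (hUo.mem_nhds hq)).tendsto.comp hγ).mono_left
          nhdsWithin_le_nhds)
      have h2 : ∀ᶠ t in 𝓝[≠] (0 : ℝ), l (a (γ t)) = 0 := by
        filter_upwards [nhdsWithin_le_nhds (hγ.eventually_mem (hUo.mem_nhds hq)),
          nhdsWithin_le_nhds hγt, self_mem_nhdsWithin] with t ht htt ht0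
        refine hl _ ht ?_
        simp only [γ, e.right_inv htt, map_add, hne, map_smul, hlw, smul_eq_mul, mul_one, zero_add]
        exact ht0
      exact tendsto_nhds_unique h1 (tendsto_const_nhds.congr' (h2.mono fun t ht => ht.symm))
    · exact hl' q hq one_ne_zero

end frames

/-! ### The `b`-tangent and `b`-cotangent bundles in frames; the natural map off the hypersurface -/

section
variable {E : Type*} [NormedAddCommGroup E] [NormedSpace ℝ E] [FiniteDimensional ℝ E]
  {M : Type*} [TopologicalSpace M] [T2Space M] [ChartedSpace E M] [IsManifold 𝓘(ℝ, E) ∞ M]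
  {Z : Set M}

/-- In a slice chart a line in a direction `v` with `l v ≠ 0` leaves `Z` at once. -/
theorem dense_compl_of_isHypersurface (E : Type*) [NormedAddCommGroup E] [NormedSpace ℝ E]
    {M : Type*} [TopologicalSpace M] [ChartedSpace E M]
    (Z : Set M) [hZ : IsHypersurface E Z] : Dense Zᶜ := by
  intro p
  by_cases hp : p ∈ Z
  swap
  · exact subset_closure hp
  obtain ⟨e, he, hpe, l, hl, hq⟩ := hZ.exists_slice p hp
  obtain ⟨v, hv⟩ : ∃ v, l v ≠ 0 := by
    by_contra! h
    exact hl (ContinuousLinearMap.ext h)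
  have hc : Filter.Tendsto (fun t : ℝ => e p + t • v) (𝓝 0) (𝓝 (e p)) := by
    have : Continuous (fun t : ℝ => e p + t • v) := by fun_prop
    simpa using this.tendsto 0
  have h2 := (e.continuousAt_symm (e.map_source hpe)).tendsto
  rw [e.left_inv hpe] at h2
  refine mem_closure_of_tendsto ((h2.comp hc).mono_left (nhdsWithin_le_nhds (s := {0}ᶜ))) ?_
  filter_upwards [nhdsWithin_le_nhds (hc.eventually_mem (e.open_target.mem_nhds
    (e.map_source hpe))), self_mem_nhdsWithin] with t ht ht0 hmem
  have := (hq _ (e.map_target ht)).1 hmem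
  rw [e.right_inv ht] at this
  simp only [map_add, (hq p hpe).1 hp, map_smul, smul_eq_mul, zero_add, mul_eq_zero] at this
  exact this.elim ht0 hv

/-- Away from `Z` the `b`-vector fields span the tangent space. -/
theorem exists_bVectorField_eq (hZ : IsClosed Z) {q : M} (hq : q ∉ Z) (v : E) :
    ∃ Y : bVectorField E Z, (Y.1 q : E) = v := by
  -- A covector with `l w = 1`, as needed for a slice frame, exists only if `E` is nontrivial.
  rcases subsingleton_or_nontrivial E with hE | hE
  · exact ⟨0, hE.elim _ _⟩
  obtain ⟨w, hw⟩ := exists_ne (0 : E)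
  obtain ⟨l, hl⟩ := SeparatingDual.exists_eq_one (R := ℝ) hw
  have hs : ((chartAt E q).restr Zᶜ).source = (chartAt E q).source ∩ Zᶜ :=
    OpenPartialHomeomorph.restr_source' _ _ hZ.isOpen_compl
  have he : (chartAt E q).restr Zᶜ ∈ IsManifold.maximalAtlas 𝓘(ℝ, E) ∞ M :=
    restr_mem_maximalAtlas (contDiffGroupoid ∞ 𝓘(ℝ, E))
      (IsManifold.chart_mem_maximalAtlas q) hZ.isOpen_compl
  have hqs : q ∈ ((chartAt E q).restr Zᶜ).source := by
    rw [hs]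
    exact ⟨mem_chart_source E q, hq⟩
  obtain ⟨U, X, hqU, -, -, hX⟩ := exists_isBFrame_slice (Z := Z) he hqs hl (c := fun _ => 1)
    (Or.inr ⟨rfl, fun x hx => by rw [hs] at hx; exact hx.2⟩)
  let u : E := mfderiv 𝓘(ℝ, E) 𝓘(ℝ, E) ((chartAt E q).restr Zᶜ) q v
  have hu : u - l u • w + (1 * l u) • w = u := by rw [one_mul, sub_add_cancel]
  refine ⟨X u, (hX u q hqU).trans ?_⟩
  rw [hu]
  exact chart_symm_mfderiv he hqs v

namespace IsBFrame
variable {U : Set M} {X : E →ₗ[ℝ] bVectorField E Z}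

/-- Off `Z` the `b`-vector fields take all values, so evaluating the frame is a surjective
endomorphism of the finite-dimensional space `E`, hence injective. -/
theorem eval_injective (h : IsBFrame Z U X) (hZ : IsClosed Z) {q : M} (hqU : q ∈ U)
    (hq : q ∉ Z) {u v : E} (huv : ((X u).1 q : E) = (X v).1 q) : u = v := by
  let ev : E →ₗ[ℝ] E :=
    { toFun := fun u => (X u).1 q
      map_add' := fun u v => by rw [map_add]; rfl
      map_smul' := fun c u => by rw [map_smul]; rfl }
  have hs : Function.Surjective ev := by
    intro v
    obtain ⟨Y, hY⟩ := exists_bVectorField_eq hZ hq v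
    obtain ⟨a, -, haU⟩ := h.exists_coeff Y
    exact ⟨a q, (haU q hqU).symm.trans hY⟩
  exact (LinearMap.injective_iff_surjective.2 hs) huv

end IsBFrame

theorem bAnchor_bValue (q : M) (Y : bVectorField E Z) : bAnchor Z q (bValue E Z q Y) = Y.1 q := rfl

variable [IsHypersurface E Z]

theorem bAnchor_injective {q : M} (hq : q ∉ Z) : Function.Injective (bAnchor (E := E) Z q) := by
  have h := isBFrame_bFrameAt (E := E) (Z := Z) q
  have hZ : IsClosed Z := IsHypersurface.isClosed E
  intro v w hvw
  obtain ⟨u, rfl⟩ := (h.frameMap_bijective (mem_bFrameSet q)).2 v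
  obtain ⟨u', rfl⟩ := (h.frameMap_bijective (mem_bFrameSet q)).2 w
  rw [h.eval_injective hZ (mem_bFrameSet q) hq hvw]

namespace IsBFrame
variable {U : Set M} {X : E →ₗ[ℝ] bVectorField E Z}

/-- The local trivialization of the `b`-tangent bundle given by a frame. -/
noncomputable def trivialization (h : IsBFrame Z U X) :
    Trivialization E (π E (BTangentSpace E Z)) :=
  (bTangentPrebundle E Z).trivializationOfMemPretrivializationAtlas
    (e := framePretrivialization h) ⟨U, X, h, rfl⟩

instance (h : IsBFrame Z U X) : MemTrivializationAtlas h.trivialization where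
  out := ⟨_, ⟨U, X, h, rfl⟩, rfl⟩

theorem mem_trivialization_source (h : IsBFrame Z U X) {v : BTangentBundle E Z} (hv : v.1 ∈ U) :
    v ∈ h.trivialization.source := h.trivialization.mem_source.2 hv

theorem symmL_trivialization (h : IsBFrame Z U X) {q : M} (hq : q ∈ U) (u : E) :
    h.trivialization.symmL ℝ q u = frameMap X q u := by
  rw [Trivialization.symmL_apply, Trivialization.symm_apply _ (by exact hq)]
  · rfl
  · exact hq

section
variable {EY HY Y : Type*} [NormedAddCommGroup EY] [NormedSpace ℝ EY] [TopologicalSpace HY]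
  {IY : ModelWithCorners ℝ EY HY} [TopologicalSpace Y] [ChartedSpace HY Y]

theorem contMDiffAt_iff (h : IsBFrame Z U X) {f : Y → BTangentBundle E Z} {y : Y}
    (hy : (f y).1 ∈ U) : ContMDiffAt IY (𝓘(ℝ, E).prod 𝓘(ℝ, E)) ∞ f y ↔
      ContMDiffAt IY 𝓘(ℝ, E) ∞ (fun x => (f x).1) y ∧
      ContMDiffAt IY 𝓘(ℝ, E) ∞ (fun x => frameCoord X (f x).1 (f x).2) y :=
  h.trivialization.contMDiffAt_iff (h.mem_trivialization_source hy)

theorem contMDiffAt_frameMap (h : IsBFrame Z U X) {f : Y → M} {a : Y → E} {y : Y}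
    (hf : ContMDiffAt IY 𝓘(ℝ, E) ∞ f y) (hy : f y ∈ U) (ha : ContMDiffAt IY 𝓘(ℝ, E) ∞ a y) :
    ContMDiffAt IY (𝓘(ℝ, E).prod 𝓘(ℝ, E)) ∞
      (fun x => (⟨f x, frameMap X (f x) (a x)⟩ : BTangentBundle E Z)) y := by
  rw [h.contMDiffAt_iff hy]
  refine ⟨hf, ha.congr_of_eventuallyEq ?_⟩
  filter_upwards [hf.continuousAt.preimage_mem_nhds (h.isOpen.mem_nhds hy)] with x hx
  exact h.frameCoord_frameMap hx (a x)

instance {B F : Type*} [TopologicalSpace B] [TopologicalSpace F] :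
    MemTrivializationAtlas (Bundle.Trivial.trivialization B F) where
  out := mem_singleton _

/-- The local trivialization of the `b`-cotangent bundle given by a frame. -/
noncomputable def cotrivialization (h : IsBFrame Z U X) :
    Trivialization (E →L[ℝ] ℝ) (π (E →L[ℝ] ℝ) (BCotangentSpace E Z)) :=
  h.trivialization.continuousLinearMap (RingHom.id ℝ) (Bundle.Trivial.trivialization M ℝ)

instance (h : IsBFrame Z U X) : MemTrivializationAtlas h.cotrivialization :=
  inferInstanceAs (MemTrivializationAtlas (h.trivialization.continuousLinearMap (RingHom.id ℝ)
    (Bundle.Trivial.trivialization M ℝ)))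

theorem cotrivialization_baseSet (h : IsBFrame Z U X) : h.cotrivialization.baseSet = U := by
  change U ∩ univ = U
  exact inter_univ _

/-- The coordinates of a covector in a frame. -/
noncomputable def coframe (h : IsBFrame Z U X) (α : BCotangentBundle E Z) : E →L[ℝ] ℝ :=
  (h.cotrivialization α).2

theorem cotrivialization_apply (h : IsBFrame Z U X) (α : BCotangentBundle E Z) :
    h.cotrivialization α = (α.1, h.coframe α) := rfl

theorem coframe_apply (h : IsBFrame Z U X) {α : BCotangentBundle E Z} (hα : α.1 ∈ U) (u : E) :
    h.coframe α u = α.2 (frameMap X α.1 u) := by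
  rw [coframe, cotrivialization, Trivialization.continuousLinearMap_apply]
  simp only [ContinuousLinearMap.comp_apply, h.symmL_trivialization hα]
  simp

theorem contMDiffAt_cotangent_iff (h : IsBFrame Z U X) {f : Y → BCotangentBundle E Z} {y : Y}
    (hy : (f y).1 ∈ U) : ContMDiffAt IY (𝓘(ℝ, E).prod 𝓘(ℝ, E →L[ℝ] ℝ)) ∞ f y ↔
      ContMDiffAt IY 𝓘(ℝ, E) ∞ (fun x => (f x).1) y ∧
      ContMDiffAt IY 𝓘(ℝ, E →L[ℝ] ℝ) ∞ (fun x => h.coframe (f x)) y :=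
  h.cotrivialization.contMDiffAt_iff
    (h.cotrivialization.mem_source.2 (by rw [h.cotrivialization_baseSet]; exact hy))

end
end IsBFrame

theorem contMDiff_bValue (Y : bVectorField E Z) : ContMDiff 𝓘(ℝ, E) (𝓘(ℝ, E).prod 𝓘(ℝ, E)) ∞
    (fun q => (⟨q, bValue E Z q Y⟩ : BTangentBundle E Z)) := by
  intro q
  have h := isBFrame_bFrameAt (E := E) (Z := Z) q
  obtain ⟨a, ha, haU⟩ := h.exists_coeff Y
  have hU := h.isOpen.mem_nhds (mem_bFrameSet q)
  refine (h.contMDiffAt_frameMap contMDiffAt_id (mem_bFrameSet q)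
    (ha.contMDiffAt hU)).congr_of_eventuallyEq ?_
  filter_upwards [hU] with x hx
  exact congrArg (TotalSpace.mk x) (h.bValue_eq hx ha haU)

/-- Hausdorffness of the target is what allows an equality of continuous maps to be extended from a
dense set. Points of one fibre are separated in a trivialization, all others in the base. -/
theorem FiberBundle.t2Space_totalSpace {B F : Type*} [TopologicalSpace B] [TopologicalSpace F]
    [T2Space B] [T2Space F] {V : B → Type*} [TopologicalSpace (TotalSpace F V)]
    [∀ b, TopologicalSpace (V b)] [FiberBundle F V] : T2Space (TotalSpace F V) := by
  refine ⟨fun x y hxy => ?_⟩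
  by_cases hb : x.1 = y.1
  · let e := trivializationAt F V x.1
    have hx : x ∈ e.source := FiberBundle.mem_trivializationAt_proj_source
    have hy : y ∈ e.source := by
      rw [e.mem_source, ← hb]
      exact e.mem_source.1 hx
    obtain ⟨u, v, hu, hv, hxu, hyv, huv⟩ := t2_separation (fun h => hxy (e.injOn hx hy h))
    refine ⟨_, _, e.toOpenPartialHomeomorph.isOpen_inter_preimage hu,
      e.toOpenPartialHomeomorph.isOpen_inter_preimage hv, ⟨hx, hxu⟩, ⟨hy, hyv⟩, ?_⟩
    exact (huv.preimage e).mono inter_subset_right inter_subset_right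
  · obtain ⟨u, v, hu, hv, hxu, hyv, huv⟩ := t2_separation hb
    have hc := FiberBundle.continuous_proj F V
    exact ⟨_, _, hu.preimage hc, hv.preimage hc, hxu, hyv, huv.preimage _⟩

instance : T2Space (BTangentBundle E Z) := FiberBundle.t2Space_totalSpace

/-- The natural map from the `b`-tangent bundle to the tangent bundle. -/
noncomputable def bAnchorTotal (v : BTangentBundle E Z) : TangentBundle 𝓘(ℝ, E) M :=
  ⟨v.1, bAnchor Z v.1 v.2⟩

theorem bAnchorTotal_injOn : InjOn (bAnchorTotal (E := E) (Z := Z)) {v | v.1 ∉ Z} := by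
  rintro ⟨q, v⟩ hq ⟨q', v'⟩ hq' h
  obtain rfl : q = q' := congrArg (fun x => x.1) h
  have : bAnchor Z q v = bAnchor Z q v' := by
    simpa [bAnchorTotal] using h
  rw [bAnchor_injective hq this]

/-- Maps to the `b`-tangent bundle are determined by their composition with the natural map to the
tangent bundle, if a dense set of points is mapped to fibres outside the hypersurface. -/
theorem eqOn_of_bAnchorTotal {Y : Type*} [TopologicalSpace Y] {f g : Y → BTangentBundle E Z}
    {O D : Set Y} (hO : IsOpen O) (hD : Dense D) (hf : ContinuousOn f O) (hg : ContinuousOn g O)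
    (hfg : ∀ y ∈ O, bAnchorTotal (f y) = bAnchorTotal (g y)) (hfZ : ∀ y ∈ O ∩ D, (f y).1 ∉ Z) :
    EqOn f g O := by
  have h : EqOn f g (O ∩ D) := fun y hy => by
    refine bAnchorTotal_injOn (hfZ y hy) ?_ (hfg y hy.1)
    have : (f y).1 = (g y).1 := congrArg (fun x => x.1) (hfg y hy.1)
    rw [mem_ofPred_eq, ← this]
    exact hfZ y hy
  exact h.of_subset_closure hf hg inter_subset_left (hD.open_subset_closure_inter hO)

end

/-! ### Differentials on `b`-tangent bundles -/

section
variable {E : Type*} [NormedAddCommGroup E] [NormedSpace ℝ E] [FiniteDimensional ℝ E]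
  {M : Type*} [TopologicalSpace M] [T2Space M] [ChartedSpace E M] [IsManifold 𝓘(ℝ, E) ∞ M]
  {E' : Type*} [NormedAddCommGroup E'] [NormedSpace ℝ E'] [FiniteDimensional ℝ E']
  {N : Type*} [TopologicalSpace N] [T2Space N] [ChartedSpace E' N] [IsManifold 𝓘(ℝ, E') ∞ N]
  {Z : Set M} [IsHypersurface E Z] {W : Set N} [IsHypersurface E' W] {φ : M → N}

/-- `D` is the matrix over `O` of the differential of `φ` with respect to the frames `X` and `X'` of
`b`-vector fields. -/
structure IsBMatrix (φ : M → N) (O U : Set M) (X : E →ₗ[ℝ] bVectorField E Z) (U' : Set N)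
    (X' : E' →ₗ[ℝ] bVectorField E' W) (D : M → E →L[ℝ] E') : Prop where
  isOpen : IsOpen O
  frame : IsBFrame Z U X
  frame' : IsBFrame W U' X'
  subset : O ⊆ U
  mapsTo : MapsTo φ O U'
  contMDiffOn : ContMDiffOn 𝓘(ℝ, E) 𝓘(ℝ, E →L[ℝ] E') ∞ D O
  apply_eq : ∀ q ∈ O, ∀ u, ((X' (D q u)).1 (φ q) : E') = mfderiv 𝓘(ℝ, E) 𝓘(ℝ, E') φ q ((X u).1 q)

theorem IsBDifferential.bAnchorTotal_eq
    {Φ : ∀ p, BTangentSpace E Z p →L[ℝ] BTangentSpace E' W (φ p)}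
    (h : IsBDifferential E E' Z W φ Φ) (v : BTangentBundle E Z) :
    bAnchorTotal (⟨φ v.1, Φ v.1 v.2⟩ : BTangentBundle E' W) =
      tangentMap 𝓘(ℝ, E) 𝓘(ℝ, E') φ (bAnchorTotal v) :=
  congrArg (TotalSpace.mk (φ v.1)) (h.anchor v.1 v.2)

theorem dense_preimage_proj {D : Set M} (hD : Dense D) :
    Dense {v : BTangentBundle E Z | v.1 ∈ D} :=
  hD.preimage (FiberBundle.isOpenMap_proj E (BTangentSpace E Z))

theorem isOpen_preimage_proj {O : Set M} (hO : IsOpen O) :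
    IsOpen {v : BTangentBundle E Z | v.1 ∈ O} :=
  hO.preimage (FiberBundle.continuous_proj E (BTangentSpace E Z))

namespace IsBMatrix
variable {O U : Set M} {X : E →ₗ[ℝ] bVectorField E Z} {U' : Set N}
  {X' : E' →ₗ[ℝ] bVectorField E' W} {D : M → E →L[ℝ] E'}

/-- The map of `b`-tangent bundles with matrix `D`. -/
noncomputable def total (_ : IsBMatrix φ O U X U' X' D) (v : BTangentBundle E Z) :
    BTangentBundle E' W :=
  ⟨φ v.1, frameMap X' (φ v.1) (D v.1 (frameCoord X v.1 v.2))⟩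

theorem contMDiffAt_total (h : IsBMatrix φ O U X U' X' D)
    (hφ : ContMDiff 𝓘(ℝ, E) 𝓘(ℝ, E') ∞ φ) {v : BTangentBundle E Z} (hv : v.1 ∈ O) :
    ContMDiffAt (𝓘(ℝ, E).prod 𝓘(ℝ, E)) (𝓘(ℝ, E').prod 𝓘(ℝ, E')) ∞ h.total v := by
  have h1 : ContMDiffAt (𝓘(ℝ, E).prod 𝓘(ℝ, E)) 𝓘(ℝ, E) ∞ (fun x : BTangentBundle E Z => x.1) v :=
    Bundle.contMDiffAt_proj _
  have h2 := ((h.frame.contMDiffAt_iff (h.subset hv)).1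
    (contMDiffAt_id (I := 𝓘(ℝ, E).prod 𝓘(ℝ, E)))).2
  have h3 := (h.contMDiffOn.contMDiffAt (h.isOpen.mem_nhds hv)).comp v h1
  exact h.frame'.contMDiffAt_frameMap (hφ.contMDiffAt.comp v h1) (h.mapsTo hv) (h3.clm_apply h2)

theorem continuousOn_total (h : IsBMatrix φ O U X U' X' D)
    (hφ : ContMDiff 𝓘(ℝ, E) 𝓘(ℝ, E') ∞ φ) : ContinuousOn h.total {v | v.1 ∈ O} :=
  fun _ hv => (h.contMDiffAt_total hφ hv).continuousAt.continuousWithinAt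

theorem bAnchorTotal_total (h : IsBMatrix φ O U X U' X' D) {v : BTangentBundle E Z}
    (hv : v.1 ∈ O) :
    bAnchorTotal (h.total v) = tangentMap 𝓘(ℝ, E) 𝓘(ℝ, E') φ (bAnchorTotal v) := by
  refine congrArg (TotalSpace.mk (φ v.1)) ?_
  refine (h.apply_eq _ hv _).trans ?_
  conv_rhs => rw [bAnchorTotal, ← h.frame.frameMap_frameCoord (h.subset hv) v.2]
  rfl

/-- Where `φ p ∉ W` the natural map of the target is injective, so compatibility with `tangentMap`
leaves no choice; density and continuity do the rest. Taking for `F` another local matrix map gives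
the gluing, taking a global differential gives the uniqueness. -/
theorem eqOn_total (h : IsBMatrix φ O U X U' X' D)
    (hφ : ContMDiff 𝓘(ℝ, E) 𝓘(ℝ, E') ∞ φ) (hd : Dense {p | φ p ∉ W})
    {F : BTangentBundle E Z → BTangentBundle E' W} {O₁ : Set M} (hO₁ : IsOpen O₁)
    (hF : ContinuousOn F {v | v.1 ∈ O₁})
    (hFa : ∀ v, v.1 ∈ O₁ → bAnchorTotal (F v) = tangentMap 𝓘(ℝ, E) 𝓘(ℝ, E') φ (bAnchorTotal v)) :
    EqOn h.total F {v | v.1 ∈ O ∩ O₁} :=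
  eqOn_of_bAnchorTotal (isOpen_preimage_proj (h.isOpen.inter hO₁)) (dense_preimage_proj hd)
    ((h.continuousOn_total hφ).mono fun _ hv => hv.1) (hF.mono fun _ hv => hv.2)
    (fun v hv => (h.bAnchorTotal_total hv.1).trans (hFa v hv.2).symm) fun _ hv => hv.2

theorem apply_frameMap (h : IsBMatrix φ O U X U' X' D)
    (hφ : ContMDiff 𝓘(ℝ, E) 𝓘(ℝ, E') ∞ φ) (hd : Dense {p | φ p ∉ W})
    {Φ : ∀ p, BTangentSpace E Z p →L[ℝ] BTangentSpace E' W (φ p)}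
    (hΦ : IsBDifferential E E' Z W φ Φ) {q : M} (hq : q ∈ O) (u : E) :
    Φ q (frameMap X q u) = frameMap X' (φ q) (D q u) := by
  have := h.eqOn_total hφ hd isOpen_univ hΦ.contMDiff.continuous.continuousOn
    (fun v _ => hΦ.bAnchorTotal_eq v) (x := ⟨q, frameMap X q u⟩) ⟨hq, mem_univ _⟩
  have h2 := eq_of_heq (TotalSpace.mk.inj this).2
  rw [← h2, h.frame.frameCoord_frameMap (h.subset hq)]

end IsBMatrix

/-- Existence is a local matter: by `eqOn_total` any two local matrix maps agree on their overlap,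
and any differential agrees with each of them. -/
theorem existsUnique_isBDifferential (hφ : ContMDiff 𝓘(ℝ, E) 𝓘(ℝ, E') ∞ φ)
    (hd : Dense {p | φ p ∉ W})
    (h : ∀ p, ∃ (O U : Set M) (X : E →ₗ[ℝ] bVectorField E Z) (U' : Set N)
      (X' : E' →ₗ[ℝ] bVectorField E' W) (D : M → E →L[ℝ] E'),
      p ∈ O ∧ IsBMatrix φ O U X U' X' D) :
    ∃! Φ, IsBDifferential E E' Z W φ Φ := by
  choose O U X U' X' D hp hD using h
  -- Each fibre uses the matrix chosen at its own base point, so smoothness requires the comparison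
  -- `hΦO` with one fixed matrix on a neighbourhood.
  let Φ : ∀ p, BTangentSpace E Z p →L[ℝ] BTangentSpace E' W (φ p) := fun p =>
    ((hD p).frame'.trivialization.symmL ℝ (φ p)).comp
      ((D p p).comp ((hD p).frame.trivialization.continuousLinearMapAt ℝ p))
  have hΦ : ∀ p v, (⟨φ p, Φ p v⟩ : BTangentBundle E' W) = (hD p).total ⟨p, v⟩ := by
    intro p v
    refine congrArg (TotalSpace.mk (φ p)) ?_
    have h1 : (hD p).frame.trivialization.continuousLinearMapAt ℝ p v = frameCoord (X p) p v := by
      have hb : p ∈ (hD p).frame.trivialization.baseSet := (hD p).subset (hp p)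
      rw [Trivialization.continuousLinearMapAt_apply, Trivialization.linearMapAt_apply, if_pos hb]
      rfl
    simp only [Φ, ContinuousLinearMap.comp_apply, h1,
      (hD p).frame'.symmL_trivialization ((hD p).mapsTo (hp p))]
  have hΦO : ∀ p, ∀ v : BTangentBundle E Z, v.1 ∈ O p →
      (⟨φ v.1, Φ v.1 v.2⟩ : BTangentBundle E' W) = (hD p).total v := by
    intro p v hv
    rw [hΦ]
    exact (hD v.1).eqOn_total hφ hd (hD p).isOpen ((hD p).continuousOn_total hφ)
      (fun v hv => (hD p).bAnchorTotal_total hv) ⟨hp v.1, hv⟩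
  refine ⟨Φ, ⟨?_, ?_⟩, ?_⟩
  · intro v
    refine ((hD v.1).contMDiffAt_total hφ (hp v.1)).congr_of_eventuallyEq ?_
    filter_upwards [(isOpen_preimage_proj (hD v.1).isOpen).mem_nhds (hp v.1)] with x hx
    exact hΦO v.1 x hx
  · intro p v
    have := (hD p).bAnchorTotal_total (v := ⟨p, v⟩) (hp p)
    rw [← hΦ] at this
    exact eq_of_heq (TotalSpace.mk.inj this).2
  · intro Ψ hΨ
    funext p
    ext v
    have := (hD p).eqOn_total hφ hd isOpen_univ hΨ.contMDiff.continuous.continuousOn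
      (fun v _ => hΨ.bAnchorTotal_eq v) (x := ⟨p, v⟩) ⟨hp p, mem_univ _⟩
    rw [← hΦ] at this
    exact (eq_of_heq (TotalSpace.mk.inj this).2).symm

theorem isBDifferential_bDifferential (h : ∃! Φ, IsBDifferential E E' Z W φ Φ) :
    IsBDifferential E E' Z W φ (bDifferential E E' Z W φ) := by
  have : bDifferential E E' Z W φ = h.choose := by
    funext p
    rw [bDifferential, dif_pos h]
  rw [this]
  exact h.choose_spec.1

/-- The image of a `b`-vector field under a diffeomorphism mapping `Z` to `W`. -/
theorem exists_push_bVectorField (φ : M ≃ₘ⟮𝓘(ℝ, E), 𝓘(ℝ, E')⟯ N) (hφ : ∀ p, φ p ∈ W ↔ p ∈ Z)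
    (Y : bVectorField E Z) : ∃ Y' : bVectorField E' W, ∀ q,
      (Y'.1 (φ q) : E') = mfderiv 𝓘(ℝ, E) 𝓘(ℝ, E') φ q (Y.1 q) := by
  have hm : ∀ q, MDifferentiableAt 𝓘(ℝ, E) 𝓘(ℝ, E') φ q := fun q =>
    φ.contMDiff.mdifferentiable (by simp) q
  have hcast : ∀ q q', q' = q →
      (mfderiv 𝓘(ℝ, E) 𝓘(ℝ, E') φ q' (Y.1 q') : E') = mfderiv 𝓘(ℝ, E) 𝓘(ℝ, E') φ q (Y.1 q) := by
    rintro q _ rfl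
    rfl
  let s : N → E' := fun y => mfderiv 𝓘(ℝ, E) 𝓘(ℝ, E') φ (φ.symm y) (Y.1 (φ.symm y))
  have hs : ContMDiff 𝓘(ℝ, E') (𝓘(ℝ, E').prod 𝓘(ℝ, E')) ∞
      (fun y => (⟨y, s y⟩ : TotalSpace E' (TangentSpace 𝓘(ℝ, E') : N → Type _))) := by
    have h1 := (φ.contMDiff.contMDiff_tangentMap (m := ∞) (by simp)).comp
      (Y.1.contMDiff.comp φ.symm.contMDiff)
    convert h1 using 1
    funext y
    exact congrArg (fun z => (⟨z, s y⟩ :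
      TotalSpace E' (TangentSpace 𝓘(ℝ, E') : N → Type _))) (φ.apply_symm_apply y).symm
  refine ⟨⟨⟨s, hs⟩, ?_⟩, fun q => hcast _ _ (φ.symm_apply_apply q)⟩
  intro f hf hfW y hy
  obtain ⟨q, rfl⟩ := φ.surjective y
  have h2 := Y.2 (f ∘ φ) (hf.comp φ.contMDiff) (fun z hz => hfW _ ((hφ z).2 hz)) q ((hφ q).1 hy)
  rw [mfderiv_comp q (hf.mdifferentiable (by simp) _) (hm q)] at h2
  have h3 := hcast q _ (φ.symm_apply_apply q)
  exact (congrArg (mfderiv 𝓘(ℝ, E') 𝓘(ℝ, ℝ) f (φ q) : E' →L[ℝ] ℝ) h3).trans h2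

/-- Push the frame fields of the source forward; the coefficients of the images in a frame of the
target are the columns of a smooth local matrix. -/
theorem existsUnique_isBDifferential_diffeomorph (φ : M ≃ₘ⟮𝓘(ℝ, E), 𝓘(ℝ, E')⟯ N)
    (hφ : ∀ p, φ p ∈ W ↔ p ∈ Z) : ∃! Φ, IsBDifferential E E' Z W φ Φ := by
  refine existsUnique_isBDifferential φ.contMDiff ?_ fun p => ?_
  · simp only [hφ]
    exact dense_compl_of_isHypersurface E Z
  have h := isBFrame_bFrameAt (E := E) (Z := Z) p
  have h' := isBFrame_bFrameAt (E := E') (Z := W) (φ p)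
  let b := Module.finBasis ℝ E
  choose Y' hY' using fun i => exists_push_bVectorField φ hφ (bFrameAt E Z p (b i))
  choose a ha haU using fun i => h'.exists_coeff (Y' i)
  have hO : IsOpen (bFrameSet E Z p ∩ φ ⁻¹' bFrameSet E' W (φ p)) :=
    h.isOpen.inter (h'.isOpen.preimage φ.continuous)
  refine ⟨_, _, _, _, _, fun q => ∑ i, (LinearMap.toContinuousLinearMap (b.coord i)).smulRight
    (a i (φ q)), ?_, hO, h, h', inter_subset_left, fun q hq => hq.2, ?_, ?_⟩
  · exact ⟨mem_bFrameSet p, mem_bFrameSet (φ p)⟩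
  · refine contMDiffOn_finsetSum fun i _ => ?_
    exact ((ContinuousLinearMap.smulRightL ℝ E E'
      (LinearMap.toContinuousLinearMap (b.coord i))).contDiff.contMDiff.comp_contMDiffOn
      ((ha i).comp φ.contMDiff.contMDiffOn fun q hq => hq.2))
  · rintro q ⟨-, hq⟩ u
    let ev : bVectorField E Z →ₗ[ℝ] E :=
      { toFun := fun Y => Y.1 q, map_add' := fun _ _ => rfl, map_smul' := fun _ _ => rfl }
    let ev' : bVectorField E' W →ₗ[ℝ] E' :=
      { toFun := fun Y => Y.1 (φ q), map_add' := fun _ _ => rfl, map_smul' := fun _ _ => rfl }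
    let T : E →L[ℝ] E' := mfderiv 𝓘(ℝ, E) 𝓘(ℝ, E') φ q
    have key : ∀ i, ev' (bFrameAt E' W (φ p) (a i (φ q))) = T (ev (bFrameAt E Z p (b i))) :=
      fun i => (haU i (φ q) hq).symm.trans (hY' i q)
    change ev' (bFrameAt E' W (φ p) _) = T (ev (bFrameAt E Z p u))
    conv_rhs => rw [← b.sum_repr u]
    rw [_root_.sum_apply]
    simp only [map_sum, map_smul, ContinuousLinearMap.smulRight_apply, key]
    rfl

end

/-! ### Submersions onto one-dimensional manifolds -/

section charts
variable {E : Type*} [NormedAddCommGroup E] [NormedSpace ℝ E]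
  {M : Type*} [TopologicalSpace M] [ChartedSpace E M] [IsManifold 𝓘(ℝ, E) ∞ M]

theorem transHomeomorph_mem_maximalAtlas {e : OpenPartialHomeomorph M E}
    (he : e ∈ IsManifold.maximalAtlas 𝓘(ℝ, E) ∞ M) (t : E ≃ₜ E) (ht : ContDiff ℝ ∞ t)
    (ht' : ContDiff ℝ ∞ t.symm) :
    e.transHomeomorph t ∈ IsManifold.maximalAtlas 𝓘(ℝ, E) ∞ M := by
  rw [IsManifold.mem_maximalAtlas_iff_contMDiffOn]
  exact ⟨ht.contMDiff.comp_contMDiffOn (contMDiffOn_of_mem_maximalAtlas he),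
    (contMDiffOn_symm_of_mem_maximalAtlas he).comp ht'.contMDiff.contMDiffOn fun y hy => hy⟩

/-- A submersion onto a one-dimensional manifold is in suitable charts a linear form, which is the
same for all points. -/
theorem exists_charts_of_isSubmersion {N : Type*} [TopologicalSpace N] [ChartedSpace ℝ N]
    [IsManifold 𝓘(ℝ, ℝ) ∞ N] [Nonempty M] {f : M → N}
    (hf : Manifold.IsSubmersion 𝓘(ℝ, E) 𝓘(ℝ, ℝ) ∞ f) :
    ∃ (l : E →L[ℝ] ℝ) (w : E), l w = 1 ∧ ∀ (p : M) (V : Set N), IsOpen V → f p ∈ V →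
      ∃ φ ∈ IsManifold.maximalAtlas 𝓘(ℝ, E) ∞ M, ∃ ψ ∈ IsManifold.maximalAtlas 𝓘(ℝ, ℝ) ∞ N,
        p ∈ φ.source ∧ MapsTo f φ.source ψ.source ∧ ψ.source ⊆ V ∧ ψ (f p) = 0 ∧
        ∀ q ∈ φ.source, ψ (f q) = l (φ q) := by
  obtain ⟨F, _, _, h⟩ := hf
  have hfc : Continuous f := (Manifold.IsSubmersionOfComplement.contMDiff h).continuous
  let p₀ : M := Classical.arbitrary M
  let L₀ := (h p₀).equiv
  refine ⟨(ContinuousLinearMap.fst ℝ ℝ F).comp (L₀ : E →L[ℝ] ℝ × F), L₀.symm (1, 0), by simp,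
    fun p V hV hpV => ?_⟩
  let φ₀ := (h p).domChart
  let ψ₀ := (h p).codChart
  let L := (h p).equiv
  let s : ℝ := ψ₀ (f p)
  -- The linear form is fixed by the splitting `L₀` at one base point. At `p` the chart is corrected
  -- by `L₀⁻¹ ∘ L`, which turns the first component of `L` into that form, and then translated to
  -- match the shift by `s` that makes `ψ (f p) = 0`.
  let t : E ≃ₜ E := (L.trans L₀.symm).toHomeomorph.trans
    (Homeomorph.addRight (-(s • L₀.symm (1, 0))))
  let t' : ℝ ≃ₜ ℝ := Homeomorph.addRight (-s)
  have ht : ContDiff ℝ ∞ t := by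
    change ContDiff ℝ ∞ (fun x => L₀.symm (L x) + -(s • L₀.symm (1, 0)))
    fun_prop
  have ht' : ContDiff ℝ ∞ t.symm := by
    change ContDiff ℝ ∞ (fun x => L.symm (L₀ (x + -(-(s • L₀.symm (1, 0))))))
    fun_prop
  have h1 : ContDiff ℝ ∞ t' := by
    change ContDiff ℝ ∞ (fun y : ℝ => y + -s)
    fun_prop
  have h1' : ContDiff ℝ ∞ t'.symm := by
    change ContDiff ℝ ∞ (fun y : ℝ => y + -(-s))
    fun_prop
  have hfV := hV.preimage hfc
  refine ⟨(φ₀.restr (f ⁻¹' V)).transHomeomorph t, transHomeomorph_mem_maximalAtlas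
    (restr_mem_maximalAtlas (contDiffGroupoid ∞ 𝓘(ℝ, E)) (h p).domChart_mem_maximalAtlas hfV)
    t ht ht', (ψ₀.restr V).transHomeomorph t', transHomeomorph_mem_maximalAtlas
    (restr_mem_maximalAtlas (contDiffGroupoid ∞ 𝓘(ℝ, ℝ)) (h p).codChart_mem_maximalAtlas hV)
    t' h1 h1', ?_, ?_, ?_, ?_, ?_⟩
  · change p ∈ (φ₀.restr (f ⁻¹' V)).source
    rw [OpenPartialHomeomorph.restr_source' _ _ hfV]
    exact ⟨(h p).mem_domChart_source, hpV⟩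
  · intro q hq
    change q ∈ (φ₀.restr (f ⁻¹' V)).source at hq
    change f q ∈ (ψ₀.restr V).source
    rw [OpenPartialHomeomorph.restr_source' _ _ hfV] at hq
    rw [OpenPartialHomeomorph.restr_source' _ _ hV]
    exact ⟨(h p).source_subset_preimage_source hq.1, hq.2⟩
  · intro y hy
    change y ∈ (ψ₀.restr V).source at hy
    rw [OpenPartialHomeomorph.restr_source' _ _ hV] at hy
    exact hy.2
  · exact add_neg_cancel s
  · intro q hq
    change q ∈ (φ₀.restr (f ⁻¹' V)).source at hq
    rw [OpenPartialHomeomorph.restr_source' _ _ hfV] at hq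
    have hx : φ₀ q ∈ (φ₀.extend 𝓘(ℝ, E)).target := by
      simpa using φ₀.map_source hq.1
    have h2 := (h p).writtenInCharts hx
    have h3 : ψ₀ (f q) = (L (φ₀ q)).1 := by
      simpa [φ₀.left_inv hq.1, φ₀, ψ₀, L] using! h2
    change ψ₀ (f q) + -s = (L₀ (L₀.symm (L (φ₀ q)) + -(s • L₀.symm (1, 0)))).1
    simp [h3]

/-- A submersion onto a one-dimensional manifold has local sections. -/
theorem exists_section_of_isSubmersion {N : Type*} [TopologicalSpace N] [ChartedSpace ℝ N]
    [IsManifold 𝓘(ℝ, ℝ) ∞ N] {f : M → N}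
    (hf : Manifold.IsSubmersion 𝓘(ℝ, E) 𝓘(ℝ, ℝ) ∞ f) (p : M) :
    ∃ (V : Set N) (s : N → M), IsOpen V ∧ f p ∈ V ∧ ContMDiffOn 𝓘(ℝ, ℝ) 𝓘(ℝ, E) ∞ s V ∧
      ∀ y ∈ V, f (s y) = y := by
  have : Nonempty M := ⟨p⟩
  obtain ⟨l, w, hlw, h⟩ := exists_charts_of_isSubmersion hf
  obtain ⟨φ, hφ, ψ, hψ, hp, hmaps, -, hψp, hl⟩ := h p univ isOpen_univ (mem_univ _)
  -- The section is the transversal line through `φ p`, on which `l` restores the coordinate of `N`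
  -- because `l w = 1` and `l (φ p) = 0`.
  let γ : ℝ → E := fun t => φ p + t • w
  have hγ : ContDiff ℝ ∞ γ := by fun_prop
  have hγc : ContinuousOn (γ ∘ ψ) ψ.source := hγ.continuous.comp_continuousOn ψ.continuousOn
  have hpV : f p ∈ ψ.source ∩ (γ ∘ ψ) ⁻¹' φ.target := by
    refine ⟨hmaps hp, ?_⟩
    simp only [mem_preimage, Function.comp, γ, hψp, zero_smul, add_zero]
    exact φ.map_source hp
  refine ⟨ψ.source ∩ (γ ∘ ψ) ⁻¹' φ.target, φ.symm ∘ γ ∘ ψ,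
    hγc.isOpen_inter_preimage ψ.open_source φ.open_target, hpV, ?_, ?_⟩
  · exact (contMDiffOn_symm_of_mem_maximalAtlas hφ).comp
      ((hγ.contMDiff.comp_contMDiffOn (contMDiffOn_of_mem_maximalAtlas hψ)).mono inter_subset_left)
      fun y hy => hy.2
  · rintro y ⟨hy, hyt⟩
    have hs := φ.map_target hyt
    refine ψ.injOn (hmaps hs) hy ?_
    rw [hl _ hs]
    rw [φ.right_inv hyt]
    simp [γ, hlw, ← hl p hp, hψp]

/-- The differential of a map which is linear in suitable charts. -/
theorem mfderiv_apply_of_charts {E' : Type*} [NormedAddCommGroup E'] [NormedSpace ℝ E']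
    {N : Type*} [TopologicalSpace N] [ChartedSpace E' N] [IsManifold 𝓘(ℝ, E') ∞ N] {f : M → N}
    (hf : ContMDiff 𝓘(ℝ, E) 𝓘(ℝ, E') ∞ f) {φ : OpenPartialHomeomorph M E}
    (hφ : φ ∈ IsManifold.maximalAtlas 𝓘(ℝ, E) ∞ M) {ψ : OpenPartialHomeomorph N E'}
    (hψ : ψ ∈ IsManifold.maximalAtlas 𝓘(ℝ, E') ∞ N) {l : E →L[ℝ] E'}
    (hmaps : MapsTo f φ.source ψ.source) (hl : ∀ q ∈ φ.source, ψ (f q) = l (φ q)) {q : M}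
    (hq : q ∈ φ.source) (v : E) :
    (mfderiv 𝓘(ℝ, E) 𝓘(ℝ, E') f q (mfderiv 𝓘(ℝ, E) 𝓘(ℝ, E) φ.symm (φ q) v) : E') =
      mfderiv 𝓘(ℝ, E') 𝓘(ℝ, E') ψ.symm (ψ (f q)) (l v) := by
  have hx := φ.map_source hq
  have h1 : HasMFDerivAt 𝓘(ℝ, E) 𝓘(ℝ, E) φ.symm (φ q) (mfderiv 𝓘(ℝ, E) 𝓘(ℝ, E) φ.symm (φ q)) :=
    ((mdifferentiable_of_mem_maximalAtlas hφ).mdifferentiableAt_symm hx).hasMFDerivAt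
  have h2 : HasMFDerivAt 𝓘(ℝ, E) 𝓘(ℝ, E') f (φ.symm (φ q)) (mfderiv 𝓘(ℝ, E) 𝓘(ℝ, E') f q) := by
    rw [φ.left_inv hq]
    exact (hf.mdifferentiable (by simp) q).hasMFDerivAt
  have h3 : HasMFDerivAt 𝓘(ℝ, E') 𝓘(ℝ, E') ψ.symm (l (φ q))
      (mfderiv 𝓘(ℝ, E') 𝓘(ℝ, E') ψ.symm (ψ (f q))) := by
    rw [← hl q hq]
    exact ((mdifferentiable_of_mem_maximalAtlas hψ).mdifferentiableAt_symm
      (ψ.map_source (hmaps hq))).hasMFDerivAt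
  have h4 : HasMFDerivAt 𝓘(ℝ, E) 𝓘(ℝ, E') l (φ q) l := l.hasMFDerivAt
  have h5 := h2.comp (φ q) h1
  have h6 : f ∘ φ.symm =ᶠ[𝓝 (φ q)] ψ.symm ∘ l := by
    filter_upwards [φ.open_target.mem_nhds hx] with x hx
    have hs := φ.map_target hx
    have := hl _ hs
    rw [φ.right_inv hx] at this
    simp only [Function.comp, ← this, ψ.left_inv (hmaps hs)]
  have h7 := (h3.comp (φ q) h4).congr_of_eventuallyEq h6
  have h8 := hasMFDerivAt_unique h5 h7
  exact congrArg (fun L : E →L[ℝ] E' => L v) h8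

end charts

section
variable {E₁ E₂ E₃ : Type*} [NormedAddCommGroup E₁] [NormedSpace ℝ E₁] [NormedAddCommGroup E₂]
  [NormedSpace ℝ E₂] [NormedAddCommGroup E₃] [NormedSpace ℝ E₃]
  {M₁ M₂ M₃ : Type*} [TopologicalSpace M₁] [ChartedSpace E₁ M₁] [TopologicalSpace M₂]
  [ChartedSpace E₂ M₂] [TopologicalSpace M₃] [ChartedSpace E₃ M₃]

/-- The chain rule with the intermediate point `y` kept apart from `f x`, so that identities such as
`1 * z = z` require no transport between tangent spaces. -/
theorem mfderiv_comp_apply_of_map_eq {g : M₂ → M₃} {f : M₁ → M₂} {x : M₁} {y : M₂} (hy : f x = y)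
    (hg : MDifferentiableAt 𝓘(ℝ, E₂) 𝓘(ℝ, E₃) g y) (hf : MDifferentiableAt 𝓘(ℝ, E₁) 𝓘(ℝ, E₂) f x)
    (v : E₁) : (mfderiv 𝓘(ℝ, E₁) 𝓘(ℝ, E₃) (g ∘ f) x v : E₃) =
      (mfderiv 𝓘(ℝ, E₂) 𝓘(ℝ, E₃) g y : E₂ →L[ℝ] E₃)
        ((mfderiv 𝓘(ℝ, E₁) 𝓘(ℝ, E₂) f x : E₁ →L[ℝ] E₂) v) := by
  subst hy
  rw [mfderiv_comp x hg hf]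
  rfl

end

/-! ### Cosets and fundamental fields -/

section coset
variable {E : Type*} [NormedAddCommGroup E] [NormedSpace ℝ E] [FiniteDimensional ℝ E]
  {EH : Type*} [NormedAddCommGroup EH] [NormedSpace ℝ EH]
  {G : Type*} [Group G] [TopologicalSpace G]
  [ChartedSpace E G] [LieGroup 𝓘(ℝ, E) ∞ G]
  {H : Subgroup G}

theorem cosetMk_eq_iff {g g' : G} : cosetMk H g = cosetMk H g' ↔ g * g'⁻¹ ∈ H := by
  rw [Quotient.eq, MulAction.orbitRel_apply]
  constructor
  · rintro ⟨h, rfl⟩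
    simp [Subgroup.smul_def]
  · intro h
    exact ⟨⟨_, h⟩, by simp [Subgroup.smul_def]⟩

theorem cosetMk_mul (h : H) (g : G) : cosetMk H ((h : G) * g) = cosetMk H g :=
  cosetMk_eq_iff.2 (by simp)

theorem cosetMk_mem_singleton_iff {g : G} : cosetMk H g ∈ ({cosetMk H 1} : Set (CosetSpace H)) ↔
    g ∈ (H : Set G) := by
  rw [mem_singleton_iff, cosetMk_eq_iff, inv_one, mul_one, SetLike.mem_coe]

variable [ChartedSpace EH H] [LieGroup 𝓘(ℝ, EH) ∞ H]

/-- The topological embedding gives continuity into `H`; a continuous map into an immersed manifold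
is smooth if its composition with the immersion is. -/
theorem contMDiffAt_subgroup_of_val
    (hH : Manifold.IsSmoothEmbedding 𝓘(ℝ, EH) 𝓘(ℝ, E) ∞ (Subtype.val : H → G))
    {EY HY Y : Type*} [NormedAddCommGroup EY] [NormedSpace ℝ EY] [TopologicalSpace HY]
    {IY : ModelWithCorners ℝ EY HY} [TopologicalSpace Y] [ChartedSpace HY Y] {f : Y → H} {y : Y}
    (hf : ContMDiffAt IY 𝓘(ℝ, E) ∞ (fun x => (f x : G)) y) : ContMDiffAt IY 𝓘(ℝ, EH) ∞ f y :=
  (ContMDiffAt.iff_comp_isImmersionAt (hH.isImmersion.isImmersionAt (f y))).2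
    ⟨hH.isEmbedding.continuousAt_iff.2 hf.continuousAt, hf⟩

variable [T2Space G] [IsHypersurface E (H : Set G)]

/-- At `g` the field is the differential of the action `H × G → G` at `(1, g)`, applied to `(ξ, 0)`;
this exhibits it as a composition of smooth maps. -/
theorem contMDiff_fundamentalField
    (hH : Manifold.IsSmoothEmbedding 𝓘(ℝ, EH) 𝓘(ℝ, E) ∞ (Subtype.val : H → G))
    (ξ : TangentSpace 𝓘(ℝ, EH) (1 : H)) : ContMDiff 𝓘(ℝ, E) (𝓘(ℝ, E).prod 𝓘(ℝ, E)) ∞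
      (fun g => (⟨g, fundamentalField H E EH ξ g⟩ : TangentBundle 𝓘(ℝ, E) G)) := by
  have hm : ContMDiff (𝓘(ℝ, EH).prod 𝓘(ℝ, E)) 𝓘(ℝ, E) ∞ (fun p : H × G => (p.1 : G) * p.2) :=
    (hH.contMDiff.comp contMDiff_fst).mul contMDiff_snd
  let F₁ : G → TangentBundle 𝓘(ℝ, EH) H × TangentBundle 𝓘(ℝ, E) G :=
    fun g => (⟨1, ξ⟩, ⟨g, 0⟩)
  have S₁ : ContMDiff 𝓘(ℝ, E) (𝓘(ℝ, EH).tangent.prod 𝓘(ℝ, E).tangent) ∞ F₁ :=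
    contMDiff_const.prodMk (Bundle.contMDiff_zeroSection _ _)
  have S₂ : ContMDiff (𝓘(ℝ, EH).tangent.prod 𝓘(ℝ, E).tangent) (𝓘(ℝ, EH).prod 𝓘(ℝ, E)).tangent ∞
      (equivTangentBundleProd 𝓘(ℝ, EH) H 𝓘(ℝ, E) G).symm := contMDiff_equivTangentBundleProd_symm
  have S₃ := hm.contMDiff_tangentMap (m := ∞) (by simp)
  convert! (S₃.comp S₂).comp S₁ with g
  · simp [F₁]
  · have h := mfderiv_prod_eq_add_apply (v := ((ξ, 0) : EH × E))
      (hm.mdifferentiable (by simp) ((1 : H), g))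
    let a : E := mfderiv 𝓘(ℝ, EH) 𝓘(ℝ, E) (fun h : H => (h : G) * g) 1 ξ
    let T : E →L[ℝ] E := mfderiv 𝓘(ℝ, E) 𝓘(ℝ, E) (fun z : G => ((1 : H) : G) * z) g
    have h0 : a + T 0 = a := by rw [map_zero, add_zero]
    exact h0.symm.trans h.symm

/-- The fundamental fields are `b`-vector fields. -/
theorem exists_bVectorField_eq_fundamentalField
    (hH : Manifold.IsSmoothEmbedding 𝓘(ℝ, EH) 𝓘(ℝ, E) ∞ (Subtype.val : H → G))
    (ξ : TangentSpace 𝓘(ℝ, EH) (1 : H)) :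
    ∃ Y : bVectorField E (H : Set G), ∀ g, Y.1 g = fundamentalField H E EH ξ g := by
  refine ⟨⟨⟨fundamentalField H E EH ξ, contMDiff_fundamentalField hH ξ⟩, ?_⟩, fun g => rfl⟩
  intro f hf hfH z hz
  have h1 : ContMDiff 𝓘(ℝ, EH) 𝓘(ℝ, E) ∞ (fun h : H => (h : G) * z) :=
    hH.contMDiff.mul contMDiff_const
  have h2 := mfderiv_comp_apply_of_map_eq (x := (1 : H)) (y := z) (by simp)
    (hf.mdifferentiable (by simp) z) (h1.mdifferentiable (by simp) 1) ξ
  -- Tangency to `H`: the orbit of a point `z` of `H` stays in `H`, where `f` vanishes.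
  have h3 : f ∘ (fun h : H => (h : G) * z) = fun _ => 0 :=
    funext fun h => hfH _ (H.mul_mem h.2 hz)
  rw [h3, mfderiv_const] at h2
  exact h2.symm

theorem mfderiv_cosetMk_fundamentalField [ChartedSpace ℝ (CosetSpace H)]
    [IsManifold 𝓘(ℝ, ℝ) ∞ (CosetSpace H)]
    (hH : Manifold.IsSmoothEmbedding 𝓘(ℝ, EH) 𝓘(ℝ, E) ∞ (Subtype.val : H → G))
    (hπ : ContMDiff 𝓘(ℝ, E) 𝓘(ℝ, ℝ) ∞ (cosetMk H))
    (ξ : TangentSpace 𝓘(ℝ, EH) (1 : H)) (g : G) :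
    (mfderiv 𝓘(ℝ, E) 𝓘(ℝ, ℝ) (cosetMk H) g (fundamentalField H E EH ξ g) : ℝ) = 0 := by
  have h1 : ContMDiff 𝓘(ℝ, EH) 𝓘(ℝ, E) ∞ (fun h : H => (h : G) * g) :=
    hH.contMDiff.mul contMDiff_const
  have h2 := mfderiv_comp_apply_of_map_eq (x := (1 : H)) (y := g) (by simp)
    (hπ.mdifferentiable (by simp) g) (h1.mdifferentiable (by simp) 1) ξ
  have h3 : cosetMk H ∘ (fun h : H => (h : G) * g) = fun _ => cosetMk H g :=
    funext fun h => cosetMk_mul h g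
  rw [h3, mfderiv_const] at h2
  exact h2.symm

/-- The values of the fundamental fields exhaust the directions tangent to the orbits. -/
theorem exists_fundamentalField_eq
    (hH : Manifold.IsSmoothEmbedding 𝓘(ℝ, EH) 𝓘(ℝ, E) ∞ (Subtype.val : H → G))
    {φ : OpenPartialHomeomorph G E} (hφ : φ ∈ IsManifold.maximalAtlas 𝓘(ℝ, E) ∞ G) {q : G}
    (hq : q ∈ φ.source) {u : E}
    (hu : ∀ t : ℝ, φ q + t • u ∈ φ.target → cosetMk H (φ.symm (φ q + t • u)) = cosetMk H q) :
    ∃ ξ : TangentSpace 𝓘(ℝ, EH) (1 : H),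
      (fundamentalField H E EH ξ q : E) = mfderiv 𝓘(ℝ, E) 𝓘(ℝ, E) φ.symm (φ q) u := by
  let γ : ℝ → E := fun t => φ q + t • u
  have hγ : ContDiff ℝ ∞ γ := by fun_prop
  have hγ0 : γ 0 = φ q := by simp [γ]
  have hγt : ∀ᶠ t in 𝓝 (0 : ℝ), γ t ∈ φ.target :=
    hγ.continuous.continuousAt.eventually_mem
      (by rw [hγ0]; exact φ.open_target.mem_nhds (φ.map_source hq))
  classical
  -- The curve in direction `u` stays in the orbit of `q`, so it has the form `k t * q` with `k t ∈
  -- H` for small `t`, and `ξ` is the velocity of `k` at `0`. The default value `1` occurs only away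
  -- from `t = 0`.
  let k : ℝ → H := fun t => if h : φ.symm (γ t) * q⁻¹ ∈ H then ⟨_, h⟩ else 1
  have hk : ∀ᶠ t in 𝓝 (0 : ℝ), (k t : G) = φ.symm (γ t) * q⁻¹ := by
    filter_upwards [hγt] with t ht
    have : φ.symm (γ t) * q⁻¹ ∈ H := cosetMk_eq_iff.1 (hu t ht)
    simp [k, this]
  have hc : ContMDiffAt 𝓘(ℝ, ℝ) 𝓘(ℝ, E) ∞ (fun t => φ.symm (γ t)) 0 := by
    have h1 := contMDiffAt_symm_of_mem_maximalAtlas hφ (φ.map_source hq)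
    rw [← hγ0] at h1
    exact h1.comp (0 : ℝ) hγ.contMDiff.contMDiffAt
  have hkc : ContMDiffAt 𝓘(ℝ, ℝ) 𝓘(ℝ, EH) ∞ k 0 := contMDiffAt_subgroup_of_val hH
    ((hc.mul contMDiffAt_const).congr_of_eventuallyEq hk)
  have hk0 : k 0 = 1 := by
    apply Subtype.ext
    rw [hk.self_of_nhds, hγ0, φ.left_inv hq, mul_inv_cancel]
    rfl
  have h1 : ContMDiff 𝓘(ℝ, EH) 𝓘(ℝ, E) ∞ (fun h : H => (h : G) * q) :=
    hH.contMDiff.mul contMDiff_const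
  have hA := mfderiv_comp_apply_of_map_eq (x := (0 : ℝ)) hk0 (h1.mdifferentiable (by simp) 1)
    (hkc.mdifferentiableAt (by simp)) 1
  have hB := mfderiv_comp_apply_of_map_eq (x := (0 : ℝ)) hγ0
    ((mdifferentiable_of_mem_maximalAtlas hφ).mdifferentiableAt_symm (φ.map_source hq))
    (hγ.contMDiff.mdifferentiable (by simp) 0) 1
  have heq : (fun h : H => (h : G) * q) ∘ k =ᶠ[𝓝 0] φ.symm ∘ γ := by
    filter_upwards [hk] with t ht
    simp [ht]
  rw [heq.mfderiv_eq] at hA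
  have h3 : (mfderiv 𝓘(ℝ, ℝ) 𝓘(ℝ, E) γ 0 : ℝ →L[ℝ] E) 1 = u := by
    have : HasDerivAt γ u 0 := by
      have := ((hasDerivAt_id (0 : ℝ)).smul_const u).const_add (φ q)
      rwa [one_smul] at this
    rw [mfderiv_eq_fderiv]
    exact (congrArg (fun L : ℝ →L[ℝ] E => L 1) this.hasFDerivAt.fderiv).trans (one_smul ℝ u)
  refine ⟨mfderiv 𝓘(ℝ, ℝ) 𝓘(ℝ, EH) k 0 (1 : ℝ), hA.symm.trans (hB.trans ?_)⟩
  exact congrArg (mfderiv 𝓘(ℝ, E) 𝓘(ℝ, E) φ.symm (φ q) : E →L[ℝ] E) h3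

end coset

/-! ### Adapted frames; the vertical bundle as kernel of the projection -/

section coset
variable {E : Type*} [NormedAddCommGroup E] [NormedSpace ℝ E] [FiniteDimensional ℝ E]
  {EH : Type*} [NormedAddCommGroup EH] [NormedSpace ℝ EH]
  {G : Type*} [Group G] [TopologicalSpace G] [IsTopologicalGroup G] [T2Space G]
  [ChartedSpace E G] [LieGroup 𝓘(ℝ, E) ∞ G]
  {H : Subgroup G} [IsClosed (H : Set G)] [IsHypersurface E (H : Set G)]

theorem dense_cosetMk_notMem (E : Type*) [NormedAddCommGroup E] [NormedSpace ℝ E]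
    {G : Type*} [Group G] [TopologicalSpace G] [ChartedSpace E G]
    {H : Subgroup G} [IsHypersurface E (H : Set G)] :
    Dense {g : G | cosetMk H g ∉ ({cosetMk H 1} : Set (CosetSpace H))} := by
  simp only [cosetMk_mem_singleton_iff]
  exact dense_compl_of_isHypersurface E _

theorem existsUnique_isBDifferential_mul_left (h : H) :
    ∃! Φ, IsBDifferential E E (H : Set G) (H : Set G) (fun g : G => (h : G) * g) Φ := by
  let φ : G ≃ₘ⟮𝓘(ℝ, E), 𝓘(ℝ, E)⟯ G :=
    { toEquiv := Equiv.mulLeft (h : G)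
      contMDiff_toFun := contMDiff_mul_left
      contMDiff_invFun := contMDiff_mul_left }
  exact existsUnique_isBDifferential_diffeomorph φ fun p => H.mul_mem_cancel_left h.2

variable [ChartedSpace ℝ (CosetSpace H)] [IsManifold 𝓘(ℝ, ℝ) ∞ (CosetSpace H)]

/-- A chart of `G` and frames of `b`-vector fields of `G` and `G/H` with respect to which the
differential of the projection is the linear form `l`. -/
structure IsAdapted (l : E →L[ℝ] ℝ) (φ : OpenPartialHomeomorph G E) (O U : Set G)
    (X : E →ₗ[ℝ] bVectorField E (H : Set G)) (U' : Set (CosetSpace H))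
    (X' : ℝ →ₗ[ℝ] bVectorField ℝ ({cosetMk H 1} : Set (CosetSpace H))) : Prop extends
    IsBMatrix (cosetMk H) O U X U' X' (fun _ => l) where
  chart_mem : φ ∈ IsManifold.maximalAtlas 𝓘(ℝ, E) ∞ G
  subset_source : O ⊆ φ.source
  map_eq : ∀ q ∈ φ.source, ∀ q' ∈ φ.source, l (φ q) = l (φ q') → cosetMk H q = cosetMk H q'
  apply_of_eq_zero : ∀ q ∈ O, ∀ u, l u = 0 →
    ((X u).1 q : E) = mfderiv 𝓘(ℝ, E) 𝓘(ℝ, E) φ.symm (φ q) u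

/-- The transversal fields of `G` and of `G/H` are scaled by the same `c`, evaluated at `l (φ q)`
and at `ψ (π q)`. These numbers are equal, so the differential of `π` maps the frame by `l`, with no
zero or pole along `H`. Both `l` and `w` are independent of the point, so that one linear model
serves for all charts of the annihilator. -/
theorem exists_isAdapted (hπ : Manifold.IsSubmersion 𝓘(ℝ, E) 𝓘(ℝ, ℝ) ∞ (cosetMk H)) :
    ∃ (l : E →L[ℝ] ℝ) (w : E), l w = 1 ∧ ∀ p : G, ∃ (φ : OpenPartialHomeomorph G E) (O U : Set G)
      (X : E →ₗ[ℝ] bVectorField E (H : Set G)) (U' : Set (CosetSpace H))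
      (X' : ℝ →ₗ[ℝ] bVectorField ℝ ({cosetMk H 1} : Set (CosetSpace H))),
      p ∈ O ∧ IsAdapted l φ O U X U' X' := by
  obtain ⟨l, w, hlw, hch⟩ := exists_charts_of_isSubmersion hπ
  refine ⟨l, w, hlw, fun p => ?_⟩
  -- Over `[e]` the chart `ψ` is centred there, so that `ψ` is itself the defining function; over
  -- any other point the charts are shrunk to avoid `[e]` and no factor is needed.
  obtain ⟨φ, hφ, ψ, hψ, hp, hmaps, hl, c, hc⟩ :
      ∃ φ ∈ IsManifold.maximalAtlas 𝓘(ℝ, E) ∞ G,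
        ∃ ψ ∈ IsManifold.maximalAtlas 𝓘(ℝ, ℝ) ∞ (CosetSpace H), p ∈ φ.source ∧
        MapsTo (cosetMk H) φ.source ψ.source ∧ (∀ q ∈ φ.source, ψ (cosetMk H q) = l (φ q)) ∧
        ∃ c : ℝ → ℝ, (c = id ∧ ∀ y ∈ ψ.source, y ∈ ({cosetMk H 1} : Set (CosetSpace H)) ↔ ψ y = 0) ∨
          (c = (fun _ => 1) ∧ ∀ y ∈ ψ.source, y ∉ ({cosetMk H 1} : Set (CosetSpace H))) := by
    by_cases hp : cosetMk H p = cosetMk H 1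
    · obtain ⟨φ, hφ, ψ, hψ, hps, hmaps, -, hψp, hl⟩ := hch p univ isOpen_univ (mem_univ _)
      refine ⟨φ, hφ, ψ, hψ, hps, hmaps, hl, id, Or.inl ⟨rfl, fun y hy => ?_⟩⟩
      rw [mem_singleton_iff, ← hp]
      refine ⟨fun h => by rw [h, hψp], fun h => ψ.injOn hy (hmaps hps) (by rw [h, hψp])⟩
    · obtain ⟨φ, hφ, ψ, hψ, hps, hmaps, hV, hψp, hl⟩ := hch p {cosetMk H 1}ᶜ
        isClosed_singleton.isOpen_compl hp
      exact ⟨φ, hφ, ψ, hψ, hps, hmaps, hl, fun _ => 1, Or.inr ⟨rfl, fun y hy => hV hy⟩⟩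
  have hπc := (Manifold.IsSubmersion.contMDiff hπ)
  obtain ⟨U, X, hpU, hUs, hXf, hX⟩ := exists_isBFrame_slice (Z := (H : Set G)) hφ hp hlw (c := c) (by
    refine hc.imp (fun h => ⟨h.1, fun q hq => ?_⟩) fun h => ⟨h.1, fun q hq => ?_⟩
    · rw [← hl q hq, ← h.2 _ (hmaps hq), cosetMk_mem_singleton_iff]
    · rw [← cosetMk_mem_singleton_iff]
      exact h.2 _ (hmaps hq))
  obtain ⟨U', X', hpU', hUs', hXf', hX'⟩ := exists_isBFrame_slice
    (Z := ({cosetMk H 1} : Set (CosetSpace H))) hψ (hmaps hp) (l := ContinuousLinearMap.id ℝ ℝ)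
    (w := 1) rfl (c := c) hc
  refine ⟨φ, U ∩ cosetMk H ⁻¹' U', U, X, U', X', ⟨hpU, hpU'⟩, ⟨⟨?_, hXf, hXf', inter_subset_left,
    fun q hq => hq.2, contMDiffOn_const, ?_⟩, hφ, fun q hq => hUs hq.1, ?_, ?_⟩⟩
  · exact hXf.isOpen.inter (hXf'.isOpen.preimage hπc.continuous)
  · rintro q ⟨hq, hq'⟩ u
    have h1 := mfderiv_apply_of_charts hπc hφ hψ hmaps hl (hUs hq)
      (u - l u • w + (c (l (φ q)) * l u) • w)
    have h2 : l (u - l u • w + (c (l (φ q)) * l u) • w) = l u - l u • (1 : ℝ) +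
        (c (ContinuousLinearMap.id ℝ ℝ (ψ (cosetMk H q))) * l u) • (1 : ℝ) := by
      rw [ContinuousLinearMap.id_apply, hl q (hUs hq)]
      simp [hlw]
    rw [h2] at h1
    have h3 := congrArg (mfderiv 𝓘(ℝ, E) 𝓘(ℝ, ℝ) (cosetMk H) q : E →L[ℝ] ℝ) (hX u q hq)
    exact ((hX' (l u) _ hq').trans h1.symm).trans h3.symm
  · intro q hq q' hq' h
    exact ψ.injOn (hmaps hq) (hmaps hq') (by rw [hl q hq, hl q' hq', h])
  · rintro q ⟨hq, -⟩ u hu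
    have h2 : u - l u • w + (c (l (φ q)) * l u) • w = u := by simp [hu]
    have h1 := hX u q hq
    rw [h2] at h1
    exact h1

theorem existsUnique_isBDifferential_cosetMk
    (hπ : Manifold.IsSubmersion 𝓘(ℝ, E) 𝓘(ℝ, ℝ) ∞ (cosetMk H)) :
    ∃! Φ, IsBDifferential E ℝ (H : Set G) {cosetMk H 1} (cosetMk H) Φ := by
  obtain ⟨l, w, -, h⟩ := exists_isAdapted hπ
  refine existsUnique_isBDifferential (Manifold.IsSubmersion.contMDiff hπ)
    (dense_cosetMk_notMem E) fun p => ?_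
  obtain ⟨φ, O, U, X, U', X', hp, hX⟩ := h p
  exact ⟨O, U, X, U', X', _, hp, hX.toIsBMatrix⟩

/-- The differential of the projection on `b`-tangent vectors. -/
noncomputable abbrev bProj (H : Subgroup G) [IsClosed (H : Set G)] [IsHypersurface E (H : Set G)]
    [ChartedSpace ℝ (CosetSpace H)] [IsManifold 𝓘(ℝ, ℝ) ∞ (CosetSpace H)] (g : G) :
    BTangentSpace E (H : Set G) g →L[ℝ]
      BTangentSpace ℝ ({cosetMk H 1} : Set (CosetSpace H)) (cosetMk H g) :=
  bDifferential E ℝ (H : Set G) {cosetMk H 1} (cosetMk H) g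

theorem isBDifferential_bProj (hπ : Manifold.IsSubmersion 𝓘(ℝ, E) 𝓘(ℝ, ℝ) ∞ (cosetMk H)) :
    IsBDifferential E ℝ (H : Set G) {cosetMk H 1} (cosetMk H) (bProj H) :=
  isBDifferential_bDifferential (existsUnique_isBDifferential_cosetMk hπ)

namespace IsAdapted
variable {l : E →L[ℝ] ℝ} {φ : OpenPartialHomeomorph G E} {O U : Set G}
    {X : E →ₗ[ℝ] bVectorField E (H : Set G)} {U' : Set (CosetSpace H)}
    {X' : ℝ →ₗ[ℝ] bVectorField ℝ ({cosetMk H 1} : Set (CosetSpace H))}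

theorem bProj_frameMap (hX : IsAdapted l φ O U X U' X')
    (hπ : Manifold.IsSubmersion 𝓘(ℝ, E) 𝓘(ℝ, ℝ) ∞ (cosetMk H)) {q : G} (hq : q ∈ O) (u : E) :
    bProj H q (frameMap X q u) = frameMap X' (cosetMk H q) (l u) :=
  hX.toIsBMatrix.apply_frameMap (Manifold.IsSubmersion.contMDiff hπ) (dense_cosetMk_notMem E)
    (isBDifferential_bProj hπ) hq u

end IsAdapted

theorem bProj_surjective (hπ : Manifold.IsSubmersion 𝓘(ℝ, E) 𝓘(ℝ, ℝ) ∞ (cosetMk H)) (g : G) :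
    Function.Surjective (bProj (E := E) H g) := by
  obtain ⟨l, w, hlw, h⟩ := exists_isAdapted hπ
  obtain ⟨φ, O, U, X, U', X', hp, hX⟩ := h g
  intro v
  obtain ⟨t, rfl⟩ := (hX.frame'.frameMap_bijective (hX.mapsTo hp)).2 v
  exact ⟨frameMap X g (t • w), by rw [hX.bProj_frameMap hπ hp]; simp [hlw]⟩

variable [ChartedSpace EH H] [LieGroup 𝓘(ℝ, EH) ∞ H]

/-- The usual differential of `π` kills fundamental fields, but over `[e]` this does not determine
the `b`-tangent vector. The sections `π_* ζ` and `0` along `π` are both continuous and agree off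
`H`, hence everywhere. -/
theorem bProj_bValue_eq_zero
    (hH : Manifold.IsSmoothEmbedding 𝓘(ℝ, EH) 𝓘(ℝ, E) ∞ (Subtype.val : H → G))
    (hπ : Manifold.IsSubmersion 𝓘(ℝ, E) 𝓘(ℝ, ℝ) ∞ (cosetMk H))
    {ξ : TangentSpace 𝓘(ℝ, EH) (1 : H)} {Y : bVectorField E (H : Set G)}
    (hY : ∀ g, Y.1 g = fundamentalField H E EH ξ g) (g : G) :
    bProj H g (bValue E (H : Set G) g Y) = 0 := by
  have hπc := Manifold.IsSubmersion.contMDiff hπ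
  have hΦ := isBDifferential_bProj hπ
  let f₁ : G → BTangentBundle ℝ ({cosetMk H 1} : Set (CosetSpace H)) :=
    fun g => ⟨cosetMk H g, bProj H g (bValue E (H : Set G) g Y)⟩
  let f₂ : G → BTangentBundle ℝ ({cosetMk H 1} : Set (CosetSpace H)) := fun g => ⟨cosetMk H g, 0⟩
  have h₁ : Continuous f₁ := (hΦ.contMDiff.comp (contMDiff_bValue Y)).continuous
  have h₂ : Continuous f₂ :=
    ((Bundle.contMDiff_zeroSection (n := ∞) ℝ
      (BTangentSpace ℝ ({cosetMk H 1} : Set (CosetSpace H)))).comp hπc).continuous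
  have h := eqOn_of_bAnchorTotal isOpen_univ (dense_cosetMk_notMem E (H := H)) h₁.continuousOn
    h₂.continuousOn (fun q _ => ?_) (fun q hq => hq.2) (mem_univ g)
  · exact eq_of_heq (TotalSpace.mk.inj h).2
  · refine congrArg (TotalSpace.mk (cosetMk H q)) ((hΦ.anchor q _).trans ?_)
    rw [map_zero, bAnchor_bValue, hY]
    exact mfderiv_cosetMk_fundamentalField hH hπc ξ q

/-- A direction `u` in `ker l` is tangent to the orbit, so some fundamental field has at `q` the
tangent vector of `u`. To compare `b`-tangent vectors also on `H`, let `a q` be its coefficient in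
the frame: it lies in `ker l` since `π_*` kills it, and on `ker l` the frame is unscaled, so the
tangent vector determines the coefficient and `a q = u`. -/
theorem IsAdapted.frameMap_mem_bVerticalSpace {l : E →L[ℝ] ℝ} {φ : OpenPartialHomeomorph G E}
    {O U : Set G} {X : E →ₗ[ℝ] bVectorField E (H : Set G)} {U' : Set (CosetSpace H)}
    {X' : ℝ →ₗ[ℝ] bVectorField ℝ ({cosetMk H 1} : Set (CosetSpace H))}
    (hX : IsAdapted l φ O U X U' X')
    (hH : Manifold.IsSmoothEmbedding 𝓘(ℝ, EH) 𝓘(ℝ, E) ∞ (Subtype.val : H → G))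
    (hπ : Manifold.IsSubmersion 𝓘(ℝ, E) 𝓘(ℝ, ℝ) ∞ (cosetMk H)) {q : G} (hq : q ∈ O) {u : E}
    (hu : l u = 0) : frameMap X q u ∈ bVerticalSpace H E EH q := by
  have hqs := hX.subset_source hq
  obtain ⟨ξ, hξ⟩ := exists_fundamentalField_eq hH hX.chart_mem hqs (u := u) fun t ht =>
    hX.map_eq _ (φ.map_target ht) _ hqs (by rw [φ.right_inv ht]; simp [hu])
  obtain ⟨Y, hY⟩ := exists_bVectorField_eq_fundamentalField hH ξ
  obtain ⟨a, ha, haU⟩ := hX.frame.exists_coeff Y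
  have h1 := hX.frame.bValue_eq (hX.subset hq) ha haU
  have h2 := bProj_bValue_eq_zero hH hπ hY q
  rw [h1, hX.bProj_frameMap hπ hq] at h2
  have h3 : l (a q) = 0 :=
    (hX.frame'.frameMap_bijective (hX.mapsTo hq)).1 (h2.trans (map_zero _).symm)
  have h4 : mfderiv 𝓘(ℝ, E) 𝓘(ℝ, E) φ.symm (φ q) (a q) =
      mfderiv 𝓘(ℝ, E) 𝓘(ℝ, E) φ.symm (φ q) u :=
    (hX.apply_of_eq_zero q hq _ h3).symm.trans ((haU q (hX.subset hq)).symm.trans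
      ((hY q).trans hξ))
  have h5 := congrArg (mfderiv 𝓘(ℝ, E) 𝓘(ℝ, E) φ q : E →L[ℝ] E) h4
  have h6 : a q = u := (chart_mfderiv_symm hX.chart_mem hqs _).symm.trans
    (h5.trans (chart_mfderiv_symm hX.chart_mem hqs u))
  rw [← h6, ← h1]
  exact Submodule.subset_span ⟨ξ, Y, hY, rfl⟩

/-- The vertical bundle is the kernel of the differential of the projection. -/
theorem mem_bVerticalSpace_iff
    (hH : Manifold.IsSmoothEmbedding 𝓘(ℝ, EH) 𝓘(ℝ, E) ∞ (Subtype.val : H → G))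
    (hπ : Manifold.IsSubmersion 𝓘(ℝ, E) 𝓘(ℝ, ℝ) ∞ (cosetMk H)) {g : G}
    {v : BTangentSpace E (H : Set G) g} : v ∈ bVerticalSpace H E EH g ↔ bProj H g v = 0 := by
  constructor
  · intro h
    have : bVerticalSpace H E EH g ≤ LinearMap.ker (bProj (E := E) H g).toLinearMap := by
      rw [bVerticalSpace, Submodule.span_le]
      rintro _ ⟨ξ, Y, hY, rfl⟩
      exact bProj_bValue_eq_zero hH hπ hY g
    exact this h
  · intro h
    obtain ⟨l, w, -, hl⟩ := exists_isAdapted hπ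
    obtain ⟨φ, O, U, X, U', X', hp, hX⟩ := hl g
    obtain ⟨u, rfl⟩ := (hX.frame.frameMap_bijective (hX.subset hp)).2 v
    rw [hX.bProj_frameMap hπ hp] at h
    exact hX.frameMap_mem_bVerticalSpace hH hπ hp
      ((hX.frame'.frameMap_bijective (hX.mapsTo hp)).1 (h.trans (map_zero _).symm))

end coset

/-! ### Principal bundles from sections and from pull-backs -/

section principal
variable {K EK HK P EP HP B EB HB : Type*}
    [NormedAddCommGroup EK] [NormedSpace ℝ EK] [TopologicalSpace HK] [Group K] [TopologicalSpace K]
    [ChartedSpace HK K]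
    [NormedAddCommGroup EP] [NormedSpace ℝ EP] [TopologicalSpace HP] [TopologicalSpace P]
    [ChartedSpace HP P]
    [NormedAddCommGroup EB] [NormedSpace ℝ EB] [TopologicalSpace HB] [TopologicalSpace B]
    [ChartedSpace HB B]
    {IK : ModelWithCorners ℝ EK HK} {IP : ModelWithCorners ℝ EP HP}
    {IB : ModelWithCorners ℝ EB HB} {act : K → P → P} {pr : P → B}

/-- A local section `s` and an equivariant group coordinate `κ` normalized by `κ ∘ s = 1` give the
trivialization `x ↦ (pr x, κ x)`, with inverse `(y, k) ↦ act k (s y)`. -/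
theorem IsPrincipalBundle.of_exists_section (hone : ∀ x, act 1 x = x)
    (hmul : ∀ k k' x, act (k * k') x = act k (act k' x))
    (hact : ContMDiff (IK.prod IP) IP ∞ (fun y : K × P => act y.1 y.2))
    (hpr : ContMDiff IP IB ∞ pr) (hinv : ∀ k x, pr (act k x) = pr x)
    (hs : ∀ b : B, ∃ (V : Set B) (s : B → P) (κ : P → K), IsOpen V ∧ b ∈ V ∧
      ContMDiffOn IB IP ∞ s V ∧ ContMDiffOn IP IK ∞ κ (pr ⁻¹' V) ∧ (∀ y ∈ V, pr (s y) = y) ∧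
      (∀ y ∈ V, κ (s y) = 1) ∧ ∀ x ∈ pr ⁻¹' V, act (κ x) (s (pr x)) = x ∧
        ∀ k, κ (act k x) = k * κ x) :
    IsPrincipalBundle IK IP IB act pr where
  one_act := hone
  mul_act := hmul
  contMDiff_act := hact
  locally_trivial b := by
    obtain ⟨V, s, κ, hV, hb, hsm, hκ, hprs, hκs, hx⟩ := hs b
    have h1 : ContMDiffOn IP (IB.prod IK) ∞ (fun x => (pr x, κ x)) (pr ⁻¹' V) :=
      hpr.contMDiffOn.prodMk hκ
    have h2 : ContMDiffOn (IB.prod IK) IP ∞ (fun y : B × K => act y.2 (s y.1)) (V ×ˢ univ) :=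
      hact.comp_contMDiffOn (contMDiffOn_snd.prodMk
        (hsm.comp contMDiffOn_fst fun y hy => hy.1))
    refine ⟨V,
      { toFun := fun x => (pr x, κ x)
        invFun := fun y => act y.2 (s y.1)
        source := pr ⁻¹' V
        target := V ×ˢ univ
        map_source' := fun x hx => ⟨hx, mem_univ _⟩
        map_target' := fun y hy => by
          simpa only [mem_preimage, hinv, hprs _ hy.1] using hy.1
        left_inv' := fun x hxV => (hx x hxV).1
        right_inv' := fun y hy => by
          refine Prod.ext ?_ ?_
          · simp only [hinv, hprs _ hy.1]
          · have : s y.1 ∈ pr ⁻¹' V := by simpa only [mem_preimage, hprs _ hy.1] using hy.1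
            simp only [(hx _ this).2, hκs _ hy.1, mul_one]
        open_source := hV.preimage hpr.continuous
        open_target := hV.prod isOpen_univ
        continuousOn_toFun := h1.continuousOn
        continuousOn_invFun := h2.continuousOn }, hV, hb, rfl, rfl, h1, h2, fun x hxV => ?_⟩
    exact ⟨rfl, (hx x hxV).2⟩

/-- `hqf`, `hext` and `hlift` make `P` the set-theoretic fibre product of `A` and `B` over `C`, so
identities in `P` are checked on the two components. A section `s` of `q` pulls back to `y ↦ lift (s
(b y)) y`, and the group coordinate to `κ ∘ f`. Of the smooth structure of the fibre product only
`hsm`, for sections of `pr`, is needed. -/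
theorem IsPrincipalBundle.of_pullback {A EA HA C EC HC : Type*}
    [NormedAddCommGroup EA] [NormedSpace ℝ EA] [TopologicalSpace HA] [TopologicalSpace A]
    [ChartedSpace HA A]
    [NormedAddCommGroup EC] [NormedSpace ℝ EC] [TopologicalSpace HC] [TopologicalSpace C]
    [ChartedSpace HC C] {IA : ModelWithCorners ℝ EA HA} {IC : ModelWithCorners ℝ EC HC}
    {actA : K → A → A} {q : A → C} {f : P → A} {b : B → C} {lift : A → B → P}
    (hone : ∀ a, actA 1 a = a) (hmul : ∀ k k' a, actA (k * k') a = actA k (actA k' a))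
    (hf : ContMDiff IP IA ∞ f) (hpr : ContMDiff IP IB ∞ pr) (hb : ContMDiff IB IC ∞ b)
    (hqf : ∀ x, q (f x) = b (pr x)) (hfact : ∀ k x, f (act k x) = actA k (f x))
    (hinv : ∀ k x, pr (act k x) = pr x)
    (hext : ∀ x x', f x = f x' → pr x = pr x' → x = x')
    (hlift : ∀ a y, q a = b y → f (lift a y) = a ∧ pr (lift a y) = y)
    (hact : ContMDiff (IK.prod IP) IP ∞ (fun y : K × P => act y.1 y.2))
    (hsm : ∀ (s : B → P) (V : Set B), IsOpen V → ContMDiffOn IB IA ∞ (fun y => f (s y)) V →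
      (∀ y ∈ V, pr (s y) = y) → ContMDiffOn IB IP ∞ s V)
    (hs : ∀ c : C, ∃ (V : Set C) (s : C → A) (κ : A → K), IsOpen V ∧ c ∈ V ∧
      ContMDiffOn IC IA ∞ s V ∧ ContMDiffOn IA IK ∞ κ (q ⁻¹' V) ∧ (∀ y ∈ V, q (s y) = y) ∧
      (∀ y ∈ V, κ (s y) = 1) ∧ ∀ x ∈ q ⁻¹' V, actA (κ x) (s (q x)) = x ∧
        ∀ k, κ (actA k x) = k * κ x) :
    IsPrincipalBundle IK IP IB act pr := by
  refine .of_exists_section (fun x => hext _ _ ?_ (hinv 1 x)) (fun k k' x => hext _ _ ?_ ?_) hact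
    hpr hinv fun y => ?_
  · rw [hfact, hone]
  · rw [hfact, hfact, hfact, hmul]
  · rw [hinv, hinv, hinv]
  obtain ⟨V, s, κ, hV, hbV, hsV, hκ, hsec, hκs, hx⟩ := hs (b y)
  have h1 : ∀ y ∈ b ⁻¹' V, f (lift (s (b y)) y) = s (b y) ∧ pr (lift (s (b y)) y) = y :=
    fun y hy => hlift _ _ (hsec _ hy)
  have h2 : ∀ x ∈ pr ⁻¹' (b ⁻¹' V), f x ∈ q ⁻¹' V := fun x hx => by
    rw [mem_preimage, hqf]
    exact hx
  refine ⟨b ⁻¹' V, fun y => lift (s (b y)) y, fun x => κ (f x), hV.preimage hb.continuous, hbV,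
    hsm _ _ (hV.preimage hb.continuous) ?_ fun y hy => (h1 y hy).2, hκ.comp hf.contMDiffOn h2,
    fun y hy => (h1 y hy).2, fun y hy => ?_, fun x hxV => ⟨hext _ _ ?_ ?_, fun k => ?_⟩⟩
  · exact (hsV.comp hb.contMDiffOn fun y hy => hy).congr fun y hy => (h1 y hy).1
  · simp only [(h1 y hy).1, hκs _ hy]
  · rw [hfact, (h1 _ hxV).1, ← hqf, (hx _ (h2 x hxV)).1]
  · simp only [hinv, (h1 _ hxV).2]
  · simp only [hfact, (hx _ (h2 x hxV)).2]

/-- Near each point `pr` is a local homeomorphism followed by the projection of a product. -/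
theorem IsPrincipalBundle.isOpenMap (h : IsPrincipalBundle IK IP IB act pr) : IsOpenMap pr := by
  refine isOpenMap_iff_nhds_le.2 fun x => ?_
  obtain ⟨V, e, hV, hb, hs, -, -, -, he⟩ := h.locally_trivial (pr x)
  have hx : x ∈ e.source := by rw [hs]; exact hb
  have h1 : Filter.map (Prod.fst ∘ e) (𝓝 x) = 𝓝 (pr x) := by
    rw [← Filter.map_map, e.map_nhds_eq hx, map_fst_nhds, (he x hx).1]
  have h2 : (Prod.fst ∘ e) =ᶠ[𝓝 x] pr := by
    filter_upwards [e.open_source.mem_nhds hx] with y hy using (he y hy).1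
  rw [← h1, Filter.map_congr h2]

end principal

/-! ### The principal bundle `G → G/H` -/

section coset
variable {E : Type*} [NormedAddCommGroup E] [NormedSpace ℝ E] [FiniteDimensional ℝ E]
  {EH : Type*} [NormedAddCommGroup EH] [NormedSpace ℝ EH]
  {G : Type*} [Group G] [TopologicalSpace G] [IsTopologicalGroup G] [T2Space G]
  [ChartedSpace E G] [LieGroup 𝓘(ℝ, E) ∞ G]
  {H : Subgroup G} [IsClosed (H : Set G)] [ChartedSpace EH H] [LieGroup 𝓘(ℝ, EH) ∞ H]
  [ChartedSpace ℝ (CosetSpace H)] [IsManifold 𝓘(ℝ, ℝ) ∞ (CosetSpace H)]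

/-- A section `s` of the submersion determines the group coordinate `κ x = x * (s (π x))⁻¹`. It lies
in `H` over `V`, and is smooth into `H` because `H` is embedded. -/
theorem exists_section_cosetMk
    (hH : Manifold.IsSmoothEmbedding 𝓘(ℝ, EH) 𝓘(ℝ, E) ∞ (Subtype.val : H → G))
    (hπ : Manifold.IsSubmersion 𝓘(ℝ, E) 𝓘(ℝ, ℝ) ∞ (cosetMk H)) (b : CosetSpace H) :
    ∃ (V : Set (CosetSpace H)) (s : CosetSpace H → G) (κ : G → H), IsOpen V ∧ b ∈ V ∧
      ContMDiffOn 𝓘(ℝ, ℝ) 𝓘(ℝ, E) ∞ s V ∧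
      ContMDiffOn 𝓘(ℝ, E) 𝓘(ℝ, EH) ∞ κ (cosetMk H ⁻¹' V) ∧ (∀ y ∈ V, cosetMk H (s y) = y) ∧
      (∀ y ∈ V, κ (s y) = 1) ∧ ∀ x ∈ cosetMk H ⁻¹' V, (κ x : G) * s (cosetMk H x) = x ∧
        ∀ k : H, κ (k * x) = k * κ x := by
  classical
  obtain ⟨g, rfl⟩ := Quotient.exists_rep b
  obtain ⟨V, s, hV, hg, hs, hsec⟩ := exists_section_of_isSubmersion hπ g
  have hπc := Manifold.IsSubmersion.contMDiff hπ
  have hmem : ∀ x ∈ cosetMk H ⁻¹' V, x * (s (cosetMk H x))⁻¹ ∈ H := fun x hx =>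
    (cosetMk_eq_iff).1 (hsec _ hx).symm
  let κ : G → H := fun x =>
    if h : x * (s (cosetMk H x))⁻¹ ∈ H then ⟨x * (s (cosetMk H x))⁻¹, h⟩ else 1
  have hκ : ∀ x ∈ cosetMk H ⁻¹' V, (κ x : G) = x * (s (cosetMk H x))⁻¹ := fun x hx => by
    simp only [κ, dif_pos (hmem x hx)]
  have hopen : IsOpen (cosetMk H ⁻¹' V) := hV.preimage hπc.continuous
  refine ⟨V, s, κ, hV, hg, hs, fun x hx => ?_, hsec, fun y hy => ?_, fun x hx => ⟨?_, fun k => ?_⟩⟩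
  · refine (contMDiffAt_subgroup_of_val hH ?_).contMDiffWithinAt
    have h1 : ContMDiffAt 𝓘(ℝ, E) 𝓘(ℝ, E) ∞ (fun x => x * (s (cosetMk H x))⁻¹) x := by
      have h2 : ContMDiffAt 𝓘(ℝ, E) 𝓘(ℝ, E) ∞ (fun x => s (cosetMk H x)) x :=
        ((hs _ hx).contMDiffAt (hV.mem_nhds hx)).comp x hπc.contMDiffAt
      exact contMDiffAt_id.mul h2.inv
    refine h1.congr_of_eventuallyEq ?_
    filter_upwards [hopen.mem_nhds hx] with z hz using hκ z hz
  · have h1 : s y ∈ cosetMk H ⁻¹' V := by rw [mem_preimage, hsec y hy]; exact hy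
    refine Subtype.ext ?_
    rw [hκ _ h1, hsec y hy, mul_inv_cancel, OneMemClass.coe_one]
  · rw [hκ x hx, inv_mul_cancel_right]
  · have h1 : (k : G) * x ∈ cosetMk H ⁻¹' V := by rwa [mem_preimage, cosetMk_mul]
    refine Subtype.ext ?_
    rw [hκ _ h1, Subgroup.coe_mul, hκ x hx, cosetMk_mul, mul_assoc]

theorem isPrincipalBundle_cosetMk
    (hH : Manifold.IsSmoothEmbedding 𝓘(ℝ, EH) 𝓘(ℝ, E) ∞ (Subtype.val : H → G))
    (hπ : Manifold.IsSubmersion 𝓘(ℝ, E) 𝓘(ℝ, ℝ) ∞ (cosetMk H)) :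
    IsPrincipalBundle 𝓘(ℝ, EH) 𝓘(ℝ, E) 𝓘(ℝ, ℝ) (fun (h : H) (g : G) => (h : G) * g) (cosetMk H) :=
  .of_exists_section (fun x => one_mul x) (fun k k' x => mul_assoc (k : G) k' x)
    ((hH.contMDiff.comp contMDiff_fst).mul contMDiff_snd) (Manifold.IsSubmersion.contMDiff hπ)
    (fun k x => cosetMk_mul k x) (exists_section_cosetMk hH hπ)

end coset

/-! ### Embedded submanifolds that are linear in charts -/

section slice
variable {F F' : Type*} [NormedAddCommGroup F] [NormedSpace ℝ F] [NormedAddCommGroup F']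
  [NormedSpace ℝ F'] {A : Type*} [TopologicalSpace A] {I : ModelWithCorners ℝ F A} [I.Boundaryless]
  {M : Type*} [TopologicalSpace M] [ChartedSpace A M] [IsManifold I ∞ M]
  {i : F' →L[ℝ] F} {r : F →L[ℝ] F'} (hri : ∀ y, r (i y) = y) {P : Set M}

/-- The chart of a subset `P` of `M` given by a chart of `M` in which `P` is the subspace of the fixed
points of the projection `i ∘ r`. -/
noncomputable def sliceChart (C : OpenPartialHomeomorph M A)
    (hC : ∀ q ∈ C.source, q ∈ P ↔ i (r (I (C q))) = I (C q)) (p : P) :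
    OpenPartialHomeomorph P F' := by
  classical
  exact
  { toFun := fun q => r (I (C q))
    -- The default `p` is never taken on the target, where the point of `M` does lie in `P`.
    invFun := fun y => if h : C.symm (I.symm (i y)) ∈ P then ⟨C.symm (I.symm (i y)), h⟩ else p
    source := Subtype.val ⁻¹' C.source
    target := {y | I.symm (i y) ∈ C.target}
    map_source' := fun q hq => by
      change I.symm (i (r (I (C q)))) ∈ C.target
      rw [(hC q hq).1 q.2, I.left_inv]
      exact C.map_source hq
    map_target' := fun y hy => by
      have h : C.symm (I.symm (i y)) ∈ P := (hC _ (C.map_target hy)).2 (by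
        rw [C.right_inv hy, I.right_inv (by rw [I.range_eq_univ]; exact mem_univ _), hri])
      simp only [mem_preimage, dif_pos h]
      exact C.map_target hy
    left_inv' := fun q hq => by
      have h : C.symm (I.symm (i (r (I (C q))))) = q := by
        rw [(hC q hq).1 q.2, I.left_inv, C.left_inv hq]
      simp only [h, Subtype.coe_prop, dif_pos]
    right_inv' := fun y hy => by
      have h : C.symm (I.symm (i y)) ∈ P := (hC _ (C.map_target hy)).2 (by
        rw [C.right_inv hy, I.right_inv (by rw [I.range_eq_univ]; exact mem_univ _), hri])
      simp only [dif_pos h]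
      rw [C.right_inv hy, I.right_inv (by rw [I.range_eq_univ]; exact mem_univ _), hri]
    open_source := C.open_source.preimage continuous_subtype_val
    open_target := C.open_target.preimage (I.continuous_symm.comp i.continuous)
    continuousOn_toFun := r.continuous.comp_continuousOn (I.continuous.comp_continuousOn
      (C.continuousOn.comp continuous_subtype_val.continuousOn fun q hq => hq))
    continuousOn_invFun := by
      rw [Topology.IsInducing.subtypeVal.continuousOn_iff]
      have h1 : ContinuousOn (fun y => C.symm (I.symm (i y))) {y | I.symm (i y) ∈ C.target} :=
        C.symm.continuousOn.comp (I.continuous_symm.comp i.continuous).continuousOn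
          fun y hy => hy
      refine h1.congr fun y hy => ?_
      have h : C.symm (I.symm (i y)) ∈ P := (hC _ (C.map_target hy)).2 (by
        rw [C.right_inv hy, I.right_inv (by rw [I.range_eq_univ]; exact mem_univ _), hri])
      simp only [Function.comp, dif_pos h] }

theorem val_sliceChart_symm {C : OpenPartialHomeomorph M A}
    (hC : ∀ q ∈ C.source, q ∈ P ↔ i (r (I (C q))) = I (C q)) (p : P) {y : F'}
    (hy : y ∈ (sliceChart hri C hC p).target) :
    ((sliceChart hri C hC p).symm y : M) = C.symm (I.symm (i y)) := by
  have h : C.symm (I.symm (i y)) ∈ P := (hC _ (C.map_target hy)).2 (by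
    rw [C.right_inv hy, I.right_inv (by rw [I.range_eq_univ]; exact mem_univ _), hri])
  exact congrArg Subtype.val (dif_pos h)

/-- A subset of a manifold which is locally a linear subspace in suitable charts is an embedded
submanifold. -/
theorem exists_isSmoothEmbedding_of_slice (hri : ∀ y, r (i y) = y)
    (h : ∀ p ∈ P, ∃ C ∈ IsManifold.maximalAtlas I ∞ M, p ∈ C.source ∧
      ∀ q ∈ C.source, q ∈ P ↔ i (r (I (C q))) = I (C q)) :
    ∃ _ : ChartedSpace F' P, IsManifold 𝓘(ℝ, F') ∞ P ∧
      Manifold.IsSmoothEmbedding 𝓘(ℝ, F') I ∞ (Subtype.val : P → M) := by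
  choose C hCm hpC hC using h
  let cs : ChartedSpace F' P :=
    { atlas := {e | ∃ p : P, e = sliceChart hri (C p p.2) (hC p p.2) p}
      chartAt := fun p => sliceChart hri (C p p.2) (hC p p.2) p
      mem_chart_source := fun p => hpC p p.2
      chart_mem_atlas := fun p => ⟨p, rfl⟩ }
  have hman : IsManifold 𝓘(ℝ, F') ∞ P := by
    refine isManifold_of_contDiffOn 𝓘(ℝ, F') ∞ P ?_
    rintro _ _ ⟨p, rfl⟩ ⟨p', rfl⟩
    rw [← contMDiffOn_iff_contDiffOn]
    have hsymm : ContMDiffOn 𝓘(ℝ, F) I ∞ I.symm (range I) := I.contMDiffOn_symm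
    have h1 : ContMDiffOn 𝓘(ℝ, F') I ∞ (fun y => (C p p.2).symm (I.symm (i y)))
        {y | I.symm (i y) ∈ (C p p.2).target} :=
      (contMDiffOn_symm_of_mem_maximalAtlas (hCm p p.2)).comp
        (hsymm.comp_contMDiff i.contDiff.contMDiff
          fun y => by rw [I.range_eq_univ]; exact mem_univ _).contMDiffOn fun y hy => hy
    have h2 : ContMDiffOn I 𝓘(ℝ, F') ∞ (fun q => r (I (C p' p'.2 q))) (C p' p'.2).source :=
      r.contDiff.contMDiff.comp_contMDiffOn (I.contMDiff.comp_contMDiffOn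
        (contMDiffOn_of_mem_maximalAtlas (hCm p' p'.2)))
    have h3 : ∀ y ∈ ((sliceChart hri (C p p.2) (hC p p.2) p).symm ≫ₕ
        sliceChart hri (C p' p'.2) (hC p' p'.2) p').source,
        y ∈ (sliceChart hri (C p p.2) (hC p p.2) p).target ∧
        (C p p.2).symm (I.symm (i y)) ∈ (C p' p'.2).source := by
      intro y hy
      rw [OpenPartialHomeomorph.trans_source] at hy
      refine ⟨hy.1, ?_⟩
      rw [← val_sliceChart_symm hri (hC p p.2) p hy.1]
      exact hy.2
    have h4 : ContMDiffOn 𝓘(ℝ, F') 𝓘(ℝ, F') ∞ ((sliceChart hri (C p p.2) (hC p p.2) p).symm ≫ₕ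
        sliceChart hri (C p' p'.2) (hC p' p'.2) p')
        ((sliceChart hri (C p p.2) (hC p p.2) p).symm ≫ₕ
        sliceChart hri (C p' p'.2) (hC p' p'.2) p').source := by
      refine (h2.comp (h1.mono fun y hy => (h3 y hy).1) fun y hy => (h3 y hy).2).congr
        fun y hy => ?_
      rw [Function.comp, ← val_sliceChart_symm hri (hC p p.2) p (h3 y hy).1]
      rfl
    exact h4.mono (by simp)
  -- The retraction `r` of `i` splits `F` as `F' × ker r`, and in the slice charts the inclusion is
  -- `i`, the embedding of the first factor.
  refine ⟨cs, hman, Manifold.IsImmersionOfComplement.isImmersion (F := LinearMap.ker r.toLinearMap) fun p => ?_, .subtypeVal⟩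
  refine Manifold.IsImmersionAtOfComplement.mk_of_charts (E := F')
    ((ContinuousLinearEquiv.equivOfRightInverse r i hri).symm) (chartAt F' p) (C p p.2)
    (mem_chart_source F' p) (hpC p p.2) (IsManifold.chart_mem_maximalAtlas p) (hCm p p.2)
    (fun q hq => hq) fun y hy => ?_
  have hy' : y ∈ (sliceChart hri (C p p.2) (hC p p.2) p).target := by
    simp only [OpenPartialHomeomorph.extend, mfld_simps] at hy
    exact hy
  have h1 := val_sliceChart_symm hri (hC p p.2) p hy'
  have h2 : I (C p p.2 ((sliceChart hri (C p p.2) (hC p p.2) p).symm y)) = i y := by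
    rw [h1, (C p p.2).right_inv hy', I.right_inv (by rw [I.range_eq_univ]; exact mem_univ _)]
  simpa using! h2

end slice

/-! ### Charts of the `b`-cotangent bundle -/

section cochart
variable {E : Type*} [NormedAddCommGroup E] [NormedSpace ℝ E] [FiniteDimensional ℝ E]
  {M : Type*} [TopologicalSpace M] [T2Space M] [ChartedSpace E M] [IsManifold 𝓘(ℝ, E) ∞ M]
  {Z : Set M} [IsHypersurface E Z] {U : Set M} {X : E →ₗ[ℝ] bVectorField E Z}

/-- The chart of the `b`-cotangent bundle given by a chart of the base and a frame. -/
noncomputable def IsBFrame.cochart (h : IsBFrame Z U X) (φ : OpenPartialHomeomorph M E) :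
    OpenPartialHomeomorph (BCotangentBundle E Z) (ModelProd E (E →L[ℝ] ℝ)) :=
  h.cotrivialization.toOpenPartialHomeomorph.trans (φ.prod (OpenPartialHomeomorph.refl (E →L[ℝ] ℝ)))

theorem IsBFrame.mem_cochart_source (h : IsBFrame Z U X) {φ : OpenPartialHomeomorph M E}
    {α : BCotangentBundle E Z} :
    α ∈ (h.cochart φ).source ↔ α.1 ∈ U ∧ α.1 ∈ φ.source := by
  rw [cochart, OpenPartialHomeomorph.trans_source]
  simp [h.cotrivialization.mem_source, h.cotrivialization_baseSet, h.cotrivialization_apply]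

theorem IsBFrame.cochart_mem_maximalAtlas (h : IsBFrame Z U X) {φ : OpenPartialHomeomorph M E}
    (hφ : φ ∈ IsManifold.maximalAtlas 𝓘(ℝ, E) ∞ M) :
    h.cochart φ ∈ IsManifold.maximalAtlas (𝓘(ℝ, E).prod 𝓘(ℝ, E →L[ℝ] ℝ)) ∞
      (BCotangentBundle E Z) := by
  rw [IsManifold.mem_maximalAtlas_iff_contMDiffOn]
  have h0 : ContMDiffOn 𝓘(ℝ, E) 𝓘(ℝ, E) ∞ φ φ.source := contMDiffOn_of_mem_maximalAtlas hφ
  have h0' := contMDiffOn_symm_of_mem_maximalAtlas hφ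
  -- The model space carries two charted space structures, as itself and as a product; they are
  -- equal, and the smoothness of product maps refers to the second.
  have hself : chartedSpaceSelf (ModelProd E (E →L[ℝ] ℝ)) =
      prodChartedSpace E E (E →L[ℝ] ℝ) (E →L[ℝ] ℝ) := chartedSpaceSelf_prod.symm
  rw [hself]
  constructor
  · have h1 : ContMDiffOn (𝓘(ℝ, E).prod 𝓘(ℝ, E →L[ℝ] ℝ)) (𝓘(ℝ, E).prod 𝓘(ℝ, E →L[ℝ] ℝ)) ∞
        h.cotrivialization (h.cochart φ).source := by
      intro α hα
      refine (h.cotrivialization.contMDiffOn (IB := 𝓘(ℝ, E)) α ?_).mono fun β hβ => ?_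
      all_goals rw [h.cotrivialization.mem_source, h.cotrivialization_baseSet]
      exacts [(h.mem_cochart_source.1 hα).1, (h.mem_cochart_source.1 hβ).1]
    exact ((h0.prodMap contMDiffOn_id).comp h1 fun α hα =>
      ⟨(h.mem_cochart_source.1 hα).2, mem_univ _⟩)
  · have h1 : ContMDiffOn (𝓘(ℝ, E).prod 𝓘(ℝ, E →L[ℝ] ℝ)) (𝓘(ℝ, E).prod 𝓘(ℝ, E →L[ℝ] ℝ)) ∞
        h.cotrivialization.toOpenPartialHomeomorph.symm h.cotrivialization.target :=
      h.cotrivialization.contMDiffOn_symm (IB := 𝓘(ℝ, E))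
    have h2 := h1.comp ((h0'.prodMap (contMDiffOn_id (I := 𝓘(ℝ, E →L[ℝ] ℝ)) (s := univ))).mono
      fun (y : E × (E →L[ℝ] ℝ)) (hy : y ∈ (h.cochart φ).target) => hy.1) fun y hy => hy.2
    exact h2

end cochart

/-! ### The annihilator as fibre product, and the lifted action -/

section coset
variable {E : Type*} [NormedAddCommGroup E] [NormedSpace ℝ E] [FiniteDimensional ℝ E]
  {EH : Type*} [NormedAddCommGroup EH] [NormedSpace ℝ EH]
  {G : Type*} [Group G] [TopologicalSpace G] [IsTopologicalGroup G] [T2Space G]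
  [ChartedSpace E G] [LieGroup 𝓘(ℝ, E) ∞ G]
  {H : Subgroup G} [IsClosed (H : Set G)] [IsHypersurface E (H : Set G)]
  [ChartedSpace ℝ (CosetSpace H)] [IsManifold 𝓘(ℝ, ℝ) ∞ (CosetSpace H)]

section adapted
variable {l : E →L[ℝ] ℝ} {φ : OpenPartialHomeomorph G E} {O U : Set G}
  {X : E →ₗ[ℝ] bVectorField E (H : Set G)} {U' : Set (CosetSpace H)}
  {X' : ℝ →ₗ[ℝ] bVectorField ℝ ({cosetMk H 1} : Set (CosetSpace H))}

/-- Vertical vectors correspond to `ker l`, and a covector vanishes on `ker l` iff it is a multiple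
of `l`, the factor then being its value at `w`. Written as a fixed-point equation, this is the form
that the slice criterion requires. -/
theorem IsAdapted.mem_verticalAnnihilator_iff [ChartedSpace EH H] [LieGroup 𝓘(ℝ, EH) ∞ H]
    (hX : IsAdapted l φ O U X U' X')
    (hH : Manifold.IsSmoothEmbedding 𝓘(ℝ, EH) 𝓘(ℝ, E) ∞ (Subtype.val : H → G))
    (hπ : Manifold.IsSubmersion 𝓘(ℝ, E) 𝓘(ℝ, ℝ) ∞ (cosetMk H)) {w : E} (hlw : l w = 1)
    {α : BCotangentBundle E (H : Set G)} (hα : α.1 ∈ O) :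
    α ∈ verticalAnnihilator H E EH ↔ hX.frame.coframe α w • l = hX.frame.coframe α := by
  have hU := hX.subset hα
  constructor
  · intro h
    ext u
    have h1 : l (u - l u • w) = 0 := by simp [hlw]
    have h2 := h _ (hX.frameMap_mem_bVerticalSpace (EH := EH) hH hπ hα h1)
    rw [← hX.frame.coframe_apply hU] at h2
    have h3 : hX.frame.coframe α u - l u * hX.frame.coframe α w = 0 := by simpa using h2
    simp only [smul_apply, smul_eq_mul]
    linarith
  · intro h v hv
    obtain ⟨u, rfl⟩ := (hX.frame.frameMap_bijective hU).2 v
    rw [mem_bVerticalSpace_iff hH hπ, hX.bProj_frameMap hπ hα] at hv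
    have h1 : l u = 0 := (hX.frame'.frameMap_bijective (hX.mapsTo hα)).1 (hv.trans (map_zero _).symm)
    rw [← hX.frame.coframe_apply hU, ← h]
    simp [h1]

theorem exists_isSmoothEmbedding_verticalAnnihilator [ChartedSpace EH H] [LieGroup 𝓘(ℝ, EH) ∞ H]
    (hH : Manifold.IsSmoothEmbedding 𝓘(ℝ, EH) 𝓘(ℝ, E) ∞ (Subtype.val : H → G))
    (hπ : Manifold.IsSubmersion 𝓘(ℝ, E) 𝓘(ℝ, ℝ) ∞ (cosetMk H)) :
    ∃ _ : ChartedSpace (E × ℝ) (verticalAnnihilator H E EH),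
      IsManifold 𝓘(ℝ, E × ℝ) ∞ (verticalAnnihilator H E EH) ∧
      Manifold.IsSmoothEmbedding 𝓘(ℝ, E × ℝ) (𝓘(ℝ, E).prod 𝓘(ℝ, E →L[ℝ] ℝ)) ∞
        (Subtype.val : verticalAnnihilator H E EH → BCotangentBundle E (H : Set G)) := by
  obtain ⟨l, w, hlw, h⟩ := exists_isAdapted hπ
  -- The slice is `(x, t) ↦ (x, t • l)`, with retraction `(x, a) ↦ (x, a w)`; this is where the
  -- dimension `dim G + 1` comes from.
  let i : E × ℝ →L[ℝ] E × (E →L[ℝ] ℝ) :=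
    (ContinuousLinearMap.fst ℝ E ℝ).prod ((ContinuousLinearMap.snd ℝ E ℝ).smulRight l)
  let r : E × (E →L[ℝ] ℝ) →L[ℝ] E × ℝ :=
    (ContinuousLinearMap.fst ℝ E (E →L[ℝ] ℝ)).prod
      ((ContinuousLinearMap.apply ℝ ℝ w).comp (ContinuousLinearMap.snd ℝ E (E →L[ℝ] ℝ)))
  refine exists_isSmoothEmbedding_of_slice (i := i) (r := r) (fun y => ?_) fun α hα => ?_
  · simp [i, r, hlw]
  · obtain ⟨φ, O, U, X, U', X', hp, hX⟩ := h α.1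
    refine ⟨(hX.frame.cochart φ).restr (TotalSpace.proj ⁻¹' O), ?_, ?_, fun q hq => ?_⟩
    · exact restr_mem_maximalAtlas _ (hX.frame.cochart_mem_maximalAtlas hX.chart_mem)
        (hX.isOpen.preimage (FiberBundle.continuous_proj _ _))
    all_goals rw [OpenPartialHomeomorph.restr_source' _ _
      (hX.isOpen.preimage (FiberBundle.continuous_proj _ _))] at *
    · exact ⟨hX.frame.mem_cochart_source.2 ⟨hX.subset hp, hX.subset_source hp⟩, hp⟩
    · rw [hX.mem_verticalAnnihilator_iff hH hπ hlw hq.2]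
      refine ⟨fun h => Prod.ext rfl h, fun h => congrArg Prod.snd h⟩

end adapted

/-- The covector `β` of `G/H` pulls back to `α` under the projection. -/
abbrev DescendsToCoset (α : BCotangentBundle E (H : Set G))
    (β : BCotangentBundle ℝ ({cosetMk H 1} : Set (CosetSpace H))) : Prop :=
  DescendsTo E ℝ (H : Set G) {cosetMk H 1} (cosetMk H) α β

namespace DescendsToCoset
variable {α α' : BCotangentBundle E (H : Set G)}
  {β β' : BCotangentBundle ℝ ({cosetMk H 1} : Set (CosetSpace H))}

theorem proj_eq (h : DescendsToCoset α β) : β.1 = cosetMk H α.1 := by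
  obtain ⟨b, rfl, -⟩ := h
  rfl

theorem mem_verticalAnnihilator [ChartedSpace EH H] [LieGroup 𝓘(ℝ, EH) ∞ H]
    (hH : Manifold.IsSmoothEmbedding 𝓘(ℝ, EH) 𝓘(ℝ, E) ∞ (Subtype.val : H → G))
    (hπ : Manifold.IsSubmersion 𝓘(ℝ, E) 𝓘(ℝ, ℝ) ∞ (cosetMk H)) (h : DescendsToCoset α β) :
    α ∈ verticalAnnihilator H E EH := by
  obtain ⟨b, -, hb⟩ := h
  intro v hv
  rw [mem_bVerticalSpace_iff hH hπ] at hv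
  rw [← hb v]
  exact (congrArg b hv).trans (map_zero b)

/-- A covector of `G/H` is determined by its pull-back since `π_*` is onto on `b`-tangent spaces,
also over `[e]`. -/
theorem right_unique (hπ : Manifold.IsSubmersion 𝓘(ℝ, E) 𝓘(ℝ, ℝ) ∞ (cosetMk H))
    (h : DescendsToCoset α β) (h' : DescendsToCoset α β') : β = β' := by
  obtain ⟨b, rfl, hb⟩ := h
  obtain ⟨b', rfl, hb'⟩ := h'
  congr 1
  ext v
  obtain ⟨u, rfl⟩ := bProj_surjective hπ _ v
  exact (hb u).trans (hb' u).symm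

theorem left_unique (h : DescendsToCoset α β) (h' : DescendsToCoset α' β) (hα : α.1 = α'.1) :
    α = α' := by
  obtain ⟨g, a⟩ := α
  obtain ⟨g', a'⟩ := α'
  obtain rfl : g = g' := hα
  obtain ⟨b, rfl, hb⟩ := h
  obtain ⟨b', hbb, hb'⟩ := h'
  obtain rfl : b = b' := eq_of_heq (TotalSpace.mk.inj hbb).2
  congr 1
  ext v
  exact (hb v).symm.trans (hb' v)

end DescendsToCoset

theorem exists_descendsToCoset_left {g : G}
    {β : BCotangentBundle ℝ ({cosetMk H 1} : Set (CosetSpace H))} (h : cosetMk H g = β.1) :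
    ∃ α : BCotangentBundle E (H : Set G), α.1 = g ∧ DescendsToCoset α β := by
  obtain ⟨y, b⟩ := β
  obtain rfl : cosetMk H g = y := h
  exact ⟨⟨g, ContinuousLinearMap.comp b (bProj H g)⟩, rfl, b, rfl, fun v => rfl⟩

theorem exists_descendsToCoset_right [ChartedSpace EH H] [LieGroup 𝓘(ℝ, EH) ∞ H]
    (hH : Manifold.IsSmoothEmbedding 𝓘(ℝ, EH) 𝓘(ℝ, E) ∞ (Subtype.val : H → G))
    (hπ : Manifold.IsSubmersion 𝓘(ℝ, E) 𝓘(ℝ, ℝ) ∞ (cosetMk H))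
    {α : BCotangentBundle E (H : Set G)} (hα : α ∈ verticalAnnihilator H E EH) :
    ∃ β, DescendsToCoset α β := by
  obtain ⟨l, w, hlw, h⟩ := exists_isAdapted hπ
  obtain ⟨φ, O, U, X, U', X', hp, hX⟩ := h α.1
  -- In the frame of `G/H` the descended covector has the single coordinate `α (w)`, because `α` is
  -- the multiple `α (w) • l` of the matrix `l` of `π_*`.
  let b : BCotangentSpace ℝ ({cosetMk H 1} : Set (CosetSpace H)) (cosetMk H α.1) :=
    (hX.frame.coframe α w) • (hX.frame'.trivialization.continuousLinearMapAt ℝ (cosetMk H α.1))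
  refine ⟨⟨_, b⟩, b, rfl, fun v => ?_⟩
  obtain ⟨u, rfl⟩ := (hX.frame.frameMap_bijective (hX.subset hp)).2 v
  rw [← hX.frame.coframe_apply (hX.subset hp), ← (hX.mem_verticalAnnihilator_iff hH hπ hlw hp).1 hα]
  have h1 := hX.bProj_frameMap hπ hp u
  refine (congrArg b h1).trans ?_
  have h2 : hX.frame'.trivialization.continuousLinearMapAt ℝ (cosetMk H α.1)
      (frameMap X' (cosetMk H α.1) (l u)) = l u := by
    rw [← hX.frame'.symmL_trivialization (hX.mapsTo hp)]
    exact hX.frame'.trivialization.continuousLinearMapAt_symmL (hX.mapsTo hp) _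
  exact congrArg (fun t : ℝ => hX.frame.coframe α w * t) h2

section smooth
variable {EY HY Y : Type*} [NormedAddCommGroup EY] [NormedSpace ℝ EY] [TopologicalSpace HY]
  {IY : ModelWithCorners ℝ EY HY} [TopologicalSpace Y] [ChartedSpace HY Y]
  {f : Y → BCotangentBundle E (H : Set G)}
  {f' : Y → BCotangentBundle ℝ ({cosetMk H 1} : Set (CosetSpace H))} {y : Y}

/-- In adapted frames descent is precomposition with the constant form `l`. Evaluating at `w` or
multiplying by `l` therefore transfers smoothness between a covector and its descent. -/
theorem IsAdapted.coframe_eq {l : E →L[ℝ] ℝ} {φ : OpenPartialHomeomorph G E} {O U : Set G}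
    {X : E →ₗ[ℝ] bVectorField E (H : Set G)} {U' : Set (CosetSpace H)}
    {X' : ℝ →ₗ[ℝ] bVectorField ℝ ({cosetMk H 1} : Set (CosetSpace H))}
    (hX : IsAdapted l φ O U X U' X')
    (hπ : Manifold.IsSubmersion 𝓘(ℝ, E) 𝓘(ℝ, ℝ) ∞ (cosetMk H)) {α : BCotangentBundle E (H : Set G)}
    {β : BCotangentBundle ℝ ({cosetMk H 1} : Set (CosetSpace H))} (h : DescendsToCoset α β)
    (hα : α.1 ∈ O) (u : E) : hX.frame.coframe α u = hX.frame'.coframe β (l u) := by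
  obtain ⟨b, rfl, hb⟩ := h
  rw [hX.frame.coframe_apply (hX.subset hα), hX.frame'.coframe_apply (hX.mapsTo hα), ← hb]
  exact congrArg b (hX.bProj_frameMap hπ hα u)

theorem contMDiffAt_of_descendsToCoset_left
    (hπ : Manifold.IsSubmersion 𝓘(ℝ, E) 𝓘(ℝ, ℝ) ∞ (cosetMk H))
    (h : ∀ x, DescendsToCoset (f x) (f' x))
    (hf : ContMDiffAt IY (𝓘(ℝ, E).prod 𝓘(ℝ, E →L[ℝ] ℝ)) ∞ f y) :
    ContMDiffAt IY (𝓘(ℝ, ℝ).prod 𝓘(ℝ, ℝ →L[ℝ] ℝ)) ∞ f' y := by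
  obtain ⟨l, w, hlw, hl⟩ := exists_isAdapted hπ
  obtain ⟨φ, O, U, X, U', X', hp, hX⟩ := hl (f y).1
  obtain ⟨h1, h2⟩ := (hX.frame.contMDiffAt_cotangent_iff (hX.subset hp)).1 hf
  have hpr : (fun x => (f' x).1) = fun x => cosetMk H (f x).1 := funext fun x => (h x).proj_eq
  rw [hX.frame'.contMDiffAt_cotangent_iff (by rw [(h y).proj_eq]; exact hX.mapsTo hp), hpr]
  refine ⟨(Manifold.IsSubmersion.contMDiff hπ).contMDiffAt.comp y h1, ?_⟩
  have h3 : ContMDiffAt IY 𝓘(ℝ, ℝ →L[ℝ] ℝ) ∞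
      (fun x => hX.frame.coframe (f x) w • ContinuousLinearMap.id ℝ ℝ) y :=
    (h2.clm_apply contMDiffAt_const).smul contMDiffAt_const
  refine h3.congr_of_eventuallyEq ?_
  filter_upwards [h1.continuousAt.preimage_mem_nhds (hX.isOpen.mem_nhds hp)] with x hx
  ext
  simp [hX.coframe_eq hπ (h x) hx, hlw]

theorem contMDiffAt_of_descendsToCoset_right
    (hπ : Manifold.IsSubmersion 𝓘(ℝ, E) 𝓘(ℝ, ℝ) ∞ (cosetMk H))
    (h : ∀ x, DescendsToCoset (f x) (f' x))
    (hf : ContMDiffAt IY 𝓘(ℝ, E) ∞ (fun x => (f x).1) y)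
    (hf' : ContMDiffAt IY (𝓘(ℝ, ℝ).prod 𝓘(ℝ, ℝ →L[ℝ] ℝ)) ∞ f' y) :
    ContMDiffAt IY (𝓘(ℝ, E).prod 𝓘(ℝ, E →L[ℝ] ℝ)) ∞ f y := by
  obtain ⟨l, w, hlw, hl⟩ := exists_isAdapted hπ
  obtain ⟨φ, O, U, X, U', X', hp, hX⟩ := hl (f y).1
  rw [hX.frame.contMDiffAt_cotangent_iff (hX.subset hp)]
  refine ⟨hf, ?_⟩
  have h2 := ((hX.frame'.contMDiffAt_cotangent_iff
    (by rw [(h y).proj_eq]; exact hX.mapsTo hp)).1 hf').2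
  have h3 : ContMDiffAt IY 𝓘(ℝ, E →L[ℝ] ℝ) ∞ (fun x => hX.frame'.coframe (f' x) 1 • l) y :=
    (h2.clm_apply contMDiffAt_const).smul contMDiffAt_const
  refine h3.congr_of_eventuallyEq ?_
  filter_upwards [hf.continuousAt.preimage_mem_nhds (hX.isOpen.mem_nhds hp)] with x hx
  ext u
  rw [hX.coframe_eq hπ (h x) hx]
  have := (hX.frame'.coframe (f' x)).map_smul (l u) 1
  rw [smul_eq_mul, mul_one] at this
  rw [this]
  simp [mul_comm]

/-- The smooth structure of the annihilator is that of the fibre product: a map into it is smooth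
once its base point in `G` and its descended covector are. Smoothness of the action, of local
sections and of the universal lift all reduce to this. -/
theorem contMDiffAt_verticalAnnihilator [ChartedSpace EH H]
    [ChartedSpace (E × ℝ) (verticalAnnihilator H E EH)]
    [IsManifold 𝓘(ℝ, E × ℝ) ∞ (verticalAnnihilator H E EH)]
    (hemb : Manifold.IsSmoothEmbedding 𝓘(ℝ, E × ℝ) (𝓘(ℝ, E).prod 𝓘(ℝ, E →L[ℝ] ℝ)) ∞
      (Subtype.val : verticalAnnihilator H E EH → BCotangentBundle E (H : Set G)))
    (hπ : Manifold.IsSubmersion 𝓘(ℝ, E) 𝓘(ℝ, ℝ) ∞ (cosetMk H))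
    {F : Y → verticalAnnihilator H E EH} (h : ∀ x, DescendsToCoset (F x).1 (f' x))
    (hF : ContMDiffAt IY 𝓘(ℝ, E) ∞ (fun x => (F x).1.1) y)
    (hf' : ContMDiffAt IY (𝓘(ℝ, ℝ).prod 𝓘(ℝ, ℝ →L[ℝ] ℝ)) ∞ f' y) :
    ContMDiffAt IY 𝓘(ℝ, E × ℝ) ∞ F y := by
  have h1 := contMDiffAt_of_descendsToCoset_right hπ h hF hf'
  exact (ContMDiffAt.iff_comp_isImmersionAt (hemb.isImmersion.isImmersionAt (F y))).2
    ⟨hemb.isEmbedding.continuousAt_iff.2 h1.continuousAt, h1⟩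

end smooth

section action

/-- Both sides are continuous lifts of `d(π ∘ L_h) = dπ`, so they agree off `H` and then everywhere.
The equality is one of points of the total space, since their base points are equal only by
`cosetMk_mul`. -/
theorem bProj_mul_left (hπ : Manifold.IsSubmersion 𝓘(ℝ, E) 𝓘(ℝ, ℝ) ∞ (cosetMk H)) (h : H) (g : G)
    (v : BTangentSpace E (H : Set G) g) :
    (⟨cosetMk H (h * g), bProj H (h * g) (bDifferential E E (H : Set G) (H : Set G)
      (fun x : G => (h : G) * x) g v)⟩ : BTangentBundle ℝ ({cosetMk H 1} : Set (CosetSpace H))) =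
    ⟨cosetMk H g, bProj H g v⟩ := by
  have hπc := Manifold.IsSubmersion.contMDiff hπ
  have h1 := isBDifferential_bProj hπ
  have h2 := isBDifferential_bDifferential (existsUnique_isBDifferential_mul_left (E := E) h)
  have hL : ContMDiff 𝓘(ℝ, E) 𝓘(ℝ, E) ∞ (fun x : G => (h : G) * x) := contMDiff_mul_left
  refine eqOn_of_bAnchorTotal isOpen_univ (dense_preimage_proj (dense_cosetMk_notMem E (H := H)))
    (h1.contMDiff.comp h2.contMDiff).continuous.continuousOn h1.contMDiff.continuous.continuousOn
    (fun w _ => ?_) (fun w hw => ?_)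
    (mem_univ (⟨g, v⟩ : BTangentBundle E (H : Set G)))
  · refine (h1.bAnchorTotal_eq _).trans ((congrArg _ (h2.bAnchorTotal_eq w)).trans ?_)
    rw [h1.bAnchorTotal_eq w, ← tangentMap_comp_at _ (hπc.mdifferentiable (by simp) _)
      (hL.mdifferentiable (by simp) _)]
    congr 1
    exact funext fun x => cosetMk_mul h x
  · intro hm
    have hm' : cosetMk H ((h : G) * w.1) ∈ ({cosetMk H 1} : Set (CosetSpace H)) := hm
    rw [cosetMk_mul] at hm'
    exact hw.2 hm'

theorem DescendsToCoset.bCotangentLift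
    (hπ : Manifold.IsSubmersion 𝓘(ℝ, E) 𝓘(ℝ, ℝ) ∞ (cosetMk H)) (h : H)
    {α : BCotangentBundle E (H : Set G)}
    {β : BCotangentBundle ℝ ({cosetMk H 1} : Set (CosetSpace H))} (hα : DescendsToCoset α β) :
    DescendsToCoset (bCotangentLift H E h α) β := by
  -- The base points are freed so that the transport along `hpq` in `bPullback` can be eliminated;
  -- likewise `hcast` transports a covector along an equality of cosets.
  have key : ∀ (p q : G) (hpq : (h : G)⁻¹ * p = q) (a : BCotangentSpace E (H : Set G) q),
      DescendsToCoset ⟨q, a⟩ β → DescendsToCoset ⟨p, bPullback E E (H : Set G) (H : Set G)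
        (fun g : G => (h : G)⁻¹ * g) hpq a⟩ β := by
    rintro p _ rfl a ⟨b, rfl, hb⟩
    have hcast : ∀ (x y : CosetSpace H) (hxy : x = y)
        (b : BCotangentSpace ℝ ({cosetMk H 1} : Set (CosetSpace H)) x),
        ∃ b' : BCotangentSpace ℝ ({cosetMk H 1} : Set (CosetSpace H)) y,
          (⟨x, b⟩ : BCotangentBundle ℝ ({cosetMk H 1} : Set (CosetSpace H))) = ⟨y, b'⟩ ∧
          ∀ v v', (⟨x, v⟩ : BTangentBundle ℝ ({cosetMk H 1} : Set (CosetSpace H))) = ⟨y, v'⟩ →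
            (b' v' : ℝ) = b v := by
      rintro x _ rfl b
      refine ⟨b, rfl, fun v v' hv => ?_⟩
      rw [eq_of_heq (TotalSpace.mk.inj hv).2]
    obtain ⟨b', hbb, hb'⟩ := hcast _ _ (cosetMk_mul h⁻¹ p) b
    exact ⟨b', hbb, fun v => (hb' _ _ (bProj_mul_left hπ h⁻¹ p v)).trans (hb _)⟩
  exact key _ _ _ _ hα

end action

end coset
-- Charts of a quotient from level sets of a linear form
/-- The inverse function theorem: the local inverse is smooth on its whole domain. -/
theorem exists_openPartialHomeomorph_of_hasFDerivAt {F F' : Type*} [NormedAddCommGroup F]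
    [NormedSpace ℝ F] [CompleteSpace F] [NormedAddCommGroup F'] [NormedSpace ℝ F'] {f : F → F'}
    {S : Set F} (hS : IsOpen S) (hf : ContDiffOn ℝ ∞ f S) {a : F} (ha : a ∈ S) {f' : F ≃L[ℝ] F'}
    (hf' : HasFDerivAt f (f' : F →L[ℝ] F') a) :
    ∃ Φ : OpenPartialHomeomorph F F', a ∈ Φ.source ∧ Φ.source ⊆ S ∧ (Φ : F → F') = f ∧
      ContDiffOn ℝ ∞ Φ.symm Φ.target := by
  have hfa : ContDiffAt ℝ ∞ f a := hf.contDiffAt (hS.mem_nhds ha)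
  let Φ₀ := hfa.toOpenPartialHomeomorph f hf' (by simp)
  have hΦ₀ : (Φ₀ : F → F') = f := hfa.toOpenPartialHomeomorph_coe hf' (by simp)
  -- The domain is shrunk to the open set where the derivative stays invertible; the local inverse
  -- is smooth at every image point of this set, not only at the image of `a`.
  let S' : Set F := S ∩ fderiv ℝ f ⁻¹' range ((↑) : (F ≃L[ℝ] F') → F →L[ℝ] F')
  have hS' : IsOpen S' :=
    (hf.continuousOn_fderiv_of_isOpen hS (by simp)).isOpen_inter_preimage hS
      (ContinuousLinearEquiv.isOpen (𝕜 := ℝ))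
  have hs := Φ₀.restr_source' S' hS'
  refine ⟨Φ₀.restr S', ?_, ?_, hΦ₀, ?_⟩
  · rw [hs]
    exact ⟨hfa.mem_toOpenPartialHomeomorph_source hf' (by simp), ha, f', hf'.fderiv.symm⟩
  · rw [hs]
    exact fun x hx => hx.2.1
  · intro y hy
    have hx := (Φ₀.restr S').map_target hy
    rw [hs] at hx
    obtain ⟨g, hg⟩ := hx.2.2
    have h1 : ContDiffAt ℝ ∞ f ((Φ₀.restr S').symm y) := hf.contDiffAt (hS.mem_nhds hx.2.1)
    have h2 : HasFDerivAt f (g : F →L[ℝ] F') ((Φ₀.restr S').symm y) := by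
      rw [hg]
      exact (h1.differentiableAt (by simp)).hasFDerivAt
    rw [← hΦ₀] at h1 h2
    exact ((Φ₀.restr S').contDiffAt_symm hy h2 h1).contDiffWithinAt

section quotient
variable {E : Type*} [NormedAddCommGroup E] [NormedSpace ℝ E]
  {M : Type*} [TopologicalSpace M] [ChartedSpace E M]
  {N : Type*} [TopologicalSpace N] {f : M → N} {l : E →L[ℝ] ℝ} {w : E}

theorem nhds_eq_map_of_apply_eq_one (hlw : l w = 1) (x : E) : 𝓝 (l x) = Filter.map l (𝓝 x) := by
  have ho : IsOpenMap l := l.isOpenMap_of_ne_zero (by rintro rfl; simp at hlw)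
  exact (le_antisymm (l.continuous.tendsto x) (ho.nhds_le x)).symm

/-- The chart of a quotient given by a chart in which the fibres of the quotient map are the level
sets of a linear form. -/
theorem exists_quotientChart [Nonempty M] (hf : IsOpenMap f) (hfc : Continuous f) (hlw : l w = 1)
    (φ : OpenPartialHomeomorph M E)
    (hφ : ∀ g ∈ φ.source, ∀ g' ∈ φ.source, f g = f g' ↔ l (φ g) = l (φ g')) :
    ∃ ψ : OpenPartialHomeomorph N ℝ, ψ.source = f '' φ.source ∧ ψ.target = l '' φ.target ∧
      (∀ g ∈ φ.source, ψ (f g) = l (φ g)) ∧ ∀ x ∈ φ.target, ψ.symm (l x) = f (φ.symm x) := by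
  -- `c` picks a preimage under `f` in the chart domain, `d` a preimage under `l` in the chart
  -- target; `h1` and `h2` show that the choices are immaterial.
  choose! c hc hfc' using fun y (hy : y ∈ f '' φ.source) => hy
  choose! d hd hld using fun t (ht : t ∈ l '' φ.target) => ht
  have h1 : ∀ g ∈ φ.source, l (φ (c (f g))) = l (φ g) := fun g hg =>
    (hφ _ (hc _ ⟨g, hg, rfl⟩) _ hg).1 (hfc' _ ⟨g, hg, rfl⟩)
  have h2 : ∀ x ∈ φ.target, f (φ.symm (d (l x))) = f (φ.symm x) := fun x hx => by
    refine (hφ _ (φ.map_target (hd _ ⟨x, hx, rfl⟩)) _ (φ.map_target hx)).2 ?_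
    rw [φ.right_inv (hd _ ⟨x, hx, rfl⟩), φ.right_inv hx]
    exact hld _ ⟨x, hx, rfl⟩
  refine ⟨
    { toFun := fun y => l (φ (c y))
      invFun := fun t => f (φ.symm (d t))
      source := f '' φ.source
      target := l '' φ.target
      map_source' := fun y hy => ⟨_, φ.map_source (hc y hy), rfl⟩
      map_target' := fun t ht => ⟨_, φ.map_target (hd t ht), rfl⟩
      left_inv' := ?_
      right_inv' := ?_
      open_source := hf _ φ.open_source
      open_target := l.isOpenMap_of_ne_zero (by rintro rfl; simp at hlw) _ φ.open_target
      continuousOn_toFun := ?_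
      continuousOn_invFun := ?_ }, rfl, rfl, h1, h2⟩
  · rintro _ ⟨g, hg, rfl⟩
    rw [h1 g hg, h2 _ (φ.map_source hg), φ.left_inv hg]
  · rintro _ ⟨x, hx, rfl⟩
    rw [h2 x hx, h1 _ (φ.map_target hx), φ.right_inv hx]
  · rintro _ ⟨g, hg, rfl⟩
    refine ContinuousAt.continuousWithinAt ?_
    rw [ContinuousAt, h1 g hg]
    refine Filter.Tendsto.mono_left ?_ (hf.nhds_le g)
    rw [Filter.tendsto_map'_iff]
    refine (l.continuous.continuousAt.comp (φ.continuousAt hg)).tendsto.congr' ?_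
    filter_upwards [φ.open_source.mem_nhds hg] with q hq using (h1 q hq).symm
  · rintro _ ⟨x, hx, rfl⟩
    refine ContinuousAt.continuousWithinAt ?_
    rw [ContinuousAt, h2 x hx, nhds_eq_map_of_apply_eq_one hlw, Filter.tendsto_map'_iff]
    refine (hfc.continuousAt.comp (φ.symm.continuousAt hx)).tendsto.congr' ?_
    filter_upwards [φ.open_target.mem_nhds hx] with q hq using (h2 q hq).symm

/-- A quotient of a manifold, whose fibres are in suitable charts the level sets of a linear form,
is a one-dimensional manifold. -/
theorem exists_chartedSpace_of_isOpenQuotientMap [IsManifold 𝓘(ℝ, E) ∞ M]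
    (hf : IsOpenQuotientMap f) (hlw : l w = 1)
    (hφ : ∀ p : M, ∃ φ ∈ IsManifold.maximalAtlas 𝓘(ℝ, E) ∞ M, p ∈ φ.source ∧
      ∀ g ∈ φ.source, ∀ g' ∈ φ.source, f g = f g' ↔ l (φ g) = l (φ g'))
    (hτ : ∀ g g', f g = f g' → ∃ τ : M → M, ContMDiff 𝓘(ℝ, E) 𝓘(ℝ, E) ∞ τ ∧
      (∀ x, f (τ x) = f x) ∧ τ g = g') :
    ∃ _ : ChartedSpace ℝ N, IsManifold 𝓘(ℝ, ℝ) ∞ N ∧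
      Manifold.IsSubmersion 𝓘(ℝ, E) 𝓘(ℝ, ℝ) ∞ f := by
  choose φ hφm hpφ hφ using hφ
  have hψ : ∀ p, ∃ ψ : OpenPartialHomeomorph N ℝ, ψ.source = f '' (φ p).source ∧
      ψ.target = l '' (φ p).target ∧ (∀ g ∈ (φ p).source, ψ (f g) = l (φ p g)) ∧
      ∀ x ∈ (φ p).target, ψ.symm (l x) = f ((φ p).symm x) := fun p =>
    have : Nonempty M := ⟨p⟩
    exists_quotientChart hf.isOpenMap hf.continuous hlw (φ p) (hφ p)
  choose ψ hψs hψt hψ hψ' using hψ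
  choose c hc using hf.surjective
  let cs : ChartedSpace ℝ N :=
    { atlas := range ψ
      chartAt := fun y => ψ (c y)
      mem_chart_source := fun y => by
        rw [hψs]
        exact ⟨c y, hpφ _, hc y⟩
      chart_mem_atlas := fun y => ⟨c y, rfl⟩ }
  have hman : IsManifold 𝓘(ℝ, ℝ) ∞ N := by
    refine isManifold_of_contDiffOn 𝓘(ℝ, ℝ) ∞ N ?_
    rintro _ _ ⟨p, rfl⟩ ⟨p', rfl⟩
    intro t ht
    simp only [mfld_simps] at ht ⊢
    obtain ⟨ht, ht'⟩ := ht
    rw [hψt] at ht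
    obtain ⟨x, hx, rfl⟩ := ht
    rw [hψ' p x hx, hψs] at ht'
    obtain ⟨g', hg', hgg⟩ := ht'
    -- Two quotient charts may overlap although the charts upstairs do not meet. A diagonal move `τ`
    -- along the fibres carries a lift in the first domain into the second, so the transition map is
    -- locally the composition of a transversal line, `φ p`⁻¹, `τ`, `φ p'` and `l`.
    obtain ⟨τ, hτ, hτf, hτg⟩ := hτ _ _ hgg.symm
    have hsmul : ContDiff ℝ ∞ (fun s : ℝ => x + (s - l x) • w) := by fun_prop
    have hx0 : x + (l x - l x) • w = x := by simp
    have h1 : ContMDiffAt 𝓘(ℝ, ℝ) 𝓘(ℝ, E) ∞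
        (fun s : ℝ => τ ((φ p).symm (x + (s - l x) • w))) (l x) := by
      refine hτ.contMDiffAt.comp (l x) (ContMDiffAt.comp (l x) ?_ hsmul.contMDiff.contMDiffAt)
      rw [hx0]
      exact contMDiffAt_symm_of_mem_maximalAtlas (hφm p) hx
    have h0 : τ ((φ p).symm (x + (l x - l x) • w)) = g' := by rw [hx0, hτg]
    have h2 : ContMDiffAt 𝓘(ℝ, ℝ) 𝓘(ℝ, ℝ) ∞
        (fun s : ℝ => l (φ p' (τ ((φ p).symm (x + (s - l x) • w))))) (l x) := by
      refine l.contDiff.contMDiff.contMDiffAt.comp (l x) (ContMDiffAt.comp (l x) ?_ h1)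
      rw [h0]
      exact contMDiffAt_of_mem_maximalAtlas (hφm p') hg'
    refine (contMDiffAt_iff_contDiffAt.1 (h2.congr_of_eventuallyEq ?_)).contDiffWithinAt
    have h3 : ∀ᶠ s in 𝓝 (l x), x + (s - l x) • w ∈ (φ p).target :=
      hsmul.continuous.continuousAt.eventually_mem
        (by rw [hx0]; exact (φ p).open_target.mem_nhds hx)
    have h4 : ∀ᶠ s in 𝓝 (l x), τ ((φ p).symm (x + (s - l x) • w)) ∈ (φ p').source :=
      h1.continuousAt.eventually_mem (by rw [h0]; exact (φ p').open_source.mem_nhds hg')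
    filter_upwards [h3, h4] with s hs hs'
    have h5 : s = l (x + (s - l x) • w) := by simp [hlw]
    simp only [Function.comp]
    rw [← hψ p' _ hs', hτf, ← hψ' p _ hs, ← h5]
  refine ⟨cs, hman, Manifold.IsSubmersionOfComplement.isSubmersion
    (F := LinearMap.ker l.toLinearMap) fun p => ?_⟩
  refine Manifold.IsSubmersionAtOfComplement.mk_of_charts
    (ContinuousLinearEquiv.equivOfRightInverse l (ContinuousLinearMap.smulRight (1 : ℝ →L[ℝ] ℝ) w)
      fun t => by simp [hlw]) (φ p) (ψ p) (hpφ p) ?_ (hφm p) ?_ (fun q hq => ?_) fun x hx => ?_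
  · rw [hψs]
    exact ⟨p, hpφ p, rfl⟩
  · exact IsManifold.subset_maximalAtlas ⟨p, rfl⟩
  · rw [mem_preimage, hψs]
    exact ⟨q, hq, rfl⟩
  · simp only [OpenPartialHomeomorph.extend, mfld_simps] at hx
    have h1 := hψ p _ ((φ p).map_target hx)
    rw [(φ p).right_inv hx] at h1
    simpa using! h1

end quotient

/-! ### Multiplication in a chart and the smooth structure of `G/H` -/

section
variable {E : Type*} [NormedAddCommGroup E] [NormedSpace ℝ E]
  {G : Type*} [Group G] [TopologicalSpace G] [ChartedSpace E G] [LieGroup 𝓘(ℝ, E) ∞ G]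

/-- The multiplication of a Lie group in a chart. -/
noncomputable def chartMul (e : OpenPartialHomeomorph G E) (x : E × E) : E :=
  e (e.symm x.1 * e.symm x.2)

/-- The domain of the multiplication of a Lie group in a chart. -/
def chartMulDomain (e : OpenPartialHomeomorph G E) : Set (E × E) :=
  e.target ×ˢ e.target ∩ (fun x => e.symm x.1 * e.symm x.2) ⁻¹' e.source

variable {e : OpenPartialHomeomorph G E}

theorem contMDiffOn_symm_mul_symm (he : e ∈ IsManifold.maximalAtlas 𝓘(ℝ, E) ∞ G) :
    ContMDiffOn 𝓘(ℝ, E × E) 𝓘(ℝ, E) ∞ (fun x : E × E => e.symm x.1 * e.symm x.2)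
      (e.target ×ˢ e.target) := by
  have h := contMDiffOn_symm_of_mem_maximalAtlas he
  exact (h.comp contDiff_fst.contMDiff.contMDiffOn fun x hx => hx.1).mul
    (h.comp contDiff_snd.contMDiff.contMDiffOn fun x hx => hx.2)

theorem isOpen_chartMulDomain (he : e ∈ IsManifold.maximalAtlas 𝓘(ℝ, E) ∞ G) :
    IsOpen (chartMulDomain e) :=
  (contMDiffOn_symm_mul_symm he).continuousOn.isOpen_inter_preimage
    (e.open_target.prod e.open_target) e.open_source

theorem contDiffOn_chartMul (he : e ∈ IsManifold.maximalAtlas 𝓘(ℝ, E) ∞ G) :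
    ContDiffOn ℝ ∞ (chartMul e) (chartMulDomain e) := by
  rw [← contMDiffOn_iff_contDiffOn]
  exact (contMDiffOn_of_mem_maximalAtlas he).comp
    ((contMDiffOn_symm_mul_symm he).mono inter_subset_left) fun x hx => hx.2

/-- As `1` has coordinate `0`, the multiplication is the identity on each of the two axes, and these
restrictions determine the derivative at the origin. -/
theorem hasFDerivAt_chartMul (he : e ∈ IsManifold.maximalAtlas 𝓘(ℝ, E) ∞ G) (h1 : 1 ∈ e.source)
    (h0 : e 1 = 0) : HasFDerivAt (chartMul e)
      (ContinuousLinearMap.fst ℝ E E + ContinuousLinearMap.snd ℝ E E) 0 := by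
  have ht : (0 : E) ∈ e.target := h0 ▸ e.map_source h1
  have hs : e.symm 0 = 1 := by rw [← h0, e.left_inv h1]
  have hD : (0 : E × E) ∈ chartMulDomain e := ⟨⟨ht, ht⟩, by simpa [hs] using h1⟩
  have hf : HasFDerivAt (chartMul e) (fderiv ℝ (chartMul e) 0) 0 :=
    (((contDiffOn_chartMul he).contDiffAt ((isOpen_chartMulDomain he).mem_nhds hD)).differentiableAt
      (by simp)).hasFDerivAt
  have hL : (fderiv ℝ (chartMul e) 0).comp (ContinuousLinearMap.inl ℝ E E) =
      ContinuousLinearMap.id ℝ E := by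
    have h2 : HasFDerivAt (chartMul e ∘ ContinuousLinearMap.inl ℝ E E) _ 0 :=
      HasFDerivAt.comp (0 : E) (by rw [map_zero]; exact hf) (ContinuousLinearMap.inl ℝ E E).hasFDerivAt
    refine h2.unique ((hasFDerivAt_id 0).congr_of_eventuallyEq ?_)
    filter_upwards [e.open_target.mem_nhds ht] with x hx
    simp [chartMul, hs, e.right_inv hx]
  have hR : (fderiv ℝ (chartMul e) 0).comp (ContinuousLinearMap.inr ℝ E E) =
      ContinuousLinearMap.id ℝ E := by
    have h2 : HasFDerivAt (chartMul e ∘ ContinuousLinearMap.inr ℝ E E) _ 0 :=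
      HasFDerivAt.comp (0 : E) (by rw [map_zero]; exact hf) (ContinuousLinearMap.inr ℝ E E).hasFDerivAt
    refine h2.unique ((hasFDerivAt_id 0).congr_of_eventuallyEq ?_)
    filter_upwards [e.open_target.mem_nhds ht] with x hx
    simp [chartMul, hs, e.right_inv hx]
  convert! hf
  refine ContinuousLinearMap.ext fun x => ?_
  have h2 := congrArg (fun L => L x.1) hL
  have h3 := congrArg (fun L => L x.2) hR
  simp only [ContinuousLinearMap.comp_apply, ContinuousLinearMap.inl_apply,
    ContinuousLinearMap.inr_apply, ContinuousLinearMap.id_apply] at h2 h3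
  have h4 : x = (x.1, 0) + (0, x.2) := by simp
  conv_rhs => rw [h4, map_add, h2, h3]
  rfl

variable [IsTopologicalGroup G] {H : Subgroup G}

/-- Near `1` write an element as `h * σ t` with `h ∈ H` of coordinate `x - l x • w` and `σ t` on the
transversal curve of coordinate `t • w`, `t = l x`. This has derivative the identity at `0`, hence
gives coordinates, and the coset depends only on `t`. That nearby values of `t` give distinct cosets
uses the slice property of `H`. -/
theorem exists_coset_chart_at_one [CompleteSpace E]
    (he : e ∈ IsManifold.maximalAtlas 𝓘(ℝ, E) ∞ G) (h1 : 1 ∈ e.source) (h0 : e 1 = 0)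
    {l : E →L[ℝ] ℝ} {w : E} (hlw : l w = 1) (hl : ∀ q ∈ e.source, q ∈ H ↔ l (e q) = 0) :
    ∃ φ ∈ IsManifold.maximalAtlas 𝓘(ℝ, E) ∞ G, 1 ∈ φ.source ∧
      ∀ g ∈ φ.source, ∀ g' ∈ φ.source, cosetMk H g = cosetMk H g' ↔ l (φ g) = l (φ g') := by
  have ht : (0 : E) ∈ e.target := h0 ▸ e.map_source h1
  have hs : e.symm 0 = 1 := by rw [← h0, e.left_inv h1]
  let A : E →L[ℝ] E × E := (ContinuousLinearMap.id ℝ E - l.smulRight w).prod (l.smulRight w)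
  have hA : ∀ x, A x = (x - l x • w, l x • w) := fun x => rfl
  have hD : A 0 ∈ chartMulDomain e := by
    rw [map_zero]
    exact ⟨⟨ht, ht⟩, by simpa [hs] using h1⟩
  have hΨ : HasFDerivAt (chartMul e ∘ A) (ContinuousLinearEquiv.refl ℝ E : E →L[ℝ] E) 0 := by
    have h2 := HasFDerivAt.comp (0 : E) (g := chartMul e) (f := A)
      (by rw [map_zero]; exact hasFDerivAt_chartMul he h1 h0) A.hasFDerivAt
    convert! h2
    ext x
    simp [hA]
  obtain ⟨Φ, h0Φ, hΦD, hΦ, hΦs⟩ := exists_openPartialHomeomorph_of_hasFDerivAt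
    ((isOpen_chartMulDomain he).preimage A.continuous)
    ((contDiffOn_chartMul he).comp A.contDiff.contDiffOn fun x hx => hx) hD hΨ
  have hΦe : ∀ x ∈ Φ.source, e.symm (Φ x) = e.symm (x - l x • w) * e.symm (l x • w) := by
    intro x hx
    rw [hΦ]
    exact e.left_inv (hΦD hx).2
  have hΦ0 : Φ 0 = 0 := by
    rw [hΦ, Function.comp, hA]
    simp [chartMul, hs, h0]
  have hmem : ∀ x ∈ Φ.source, e.symm (x - l x • w) ∈ H := by
    intro x hx
    have h2 : x - l x • w ∈ e.target := (hΦD hx).1.1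
    rw [hl _ (e.map_target h2), e.right_inv h2]
    simp [hlw]
  let σ : ℝ → G := fun t => e.symm (t • w)
  have hcos : ∀ x ∈ Φ.source, cosetMk H (e.symm (Φ x)) = cosetMk H (σ (l x)) := fun x hx => by
    rw [hΦe x hx]
    exact cosetMk_mul ⟨_, hmem x hx⟩ _
  -- If `σ t` and `σ t'` lie in one coset, then `κ = σ t' * (σ t)⁻¹` is an element of `H` close to
  -- `1`, so its coordinate lies in `ker l`. The points `e κ + t • w` and `t' • w` then have the
  -- same image under `Φ`, both representing `σ t'`; injectivity of `Φ` and applying `l` yield `t =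
  -- t'`.
  obtain ⟨N, hN, h0N, hNσ⟩ : ∃ N : Set ℝ, IsOpen N ∧ 0 ∈ N ∧ ∀ t ∈ N, ∀ t' ∈ N,
      cosetMk H (σ t) = cosetMk H (σ t') → t = t' := by
    have hσ0 : σ 0 = 1 := by simp [σ, hs]
    have hσ : ContinuousAt σ 0 := by
      refine ContinuousAt.comp (g := e.symm) ?_ (by fun_prop)
      rw [zero_smul]
      exact e.symm.continuousAt ht
    have hσ1 : ContinuousAt (fun p : ℝ × ℝ => σ p.1) (0, 0) :=
      ContinuousAt.comp (g := σ) hσ continuousAt_fst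
    have hσ2 : ContinuousAt (fun p : ℝ × ℝ => σ p.2) (0, 0) :=
      ContinuousAt.comp (g := σ) hσ continuousAt_snd
    have hB : ContinuousAt (fun p : ℝ × ℝ => σ p.2 * (σ p.1)⁻¹) (0, 0) := hσ2.mul hσ1.inv
    have hB1 : σ ((0, 0) : ℝ × ℝ).2 * (σ ((0, 0) : ℝ × ℝ).1)⁻¹ = 1 := by simp [hσ0]
    have hC1 : ∀ᶠ p : ℝ × ℝ in 𝓝 (0, 0), σ p.2 * (σ p.1)⁻¹ ∈ e.source :=
      hB.eventually_mem (by rw [hB1]; exact e.open_source.mem_nhds h1)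
    have hB2 : ContinuousAt (fun p : ℝ × ℝ => e (σ p.2 * (σ p.1)⁻¹) + p.1 • w) (0, 0) := by
      refine ContinuousAt.add (ContinuousAt.comp (g := e) ?_ hB) (by fun_prop)
      rw [hB1]
      exact e.continuousAt h1
    have hC2 : ∀ᶠ p : ℝ × ℝ in 𝓝 (0, 0), e (σ p.2 * (σ p.1)⁻¹) + p.1 • w ∈ Φ.source :=
      hB2.eventually_mem (by simpa [hσ0, h0] using Φ.open_source.mem_nhds h0Φ)
    have hC3 : ∀ᶠ p : ℝ × ℝ in 𝓝 (0, 0), p.2 • w ∈ Φ.source :=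
      ContinuousAt.eventually_mem (by fun_prop) (by simpa using Φ.open_source.mem_nhds h0Φ)
    have hC := hC1.and (hC2.and hC3)
    rw [nhds_prod_eq, Filter.eventually_prod_self_iff'] at hC
    obtain ⟨N', hN', hNC⟩ := hC
    obtain ⟨N, hNN', hN, h0N⟩ := mem_nhds_iff.1 hN'
    refine ⟨N, hN, h0N, fun t htN t' htN' h => ?_⟩
    obtain ⟨hc1, hc2, hc3⟩ := hNC t (hNN' htN) t' (hNN' htN')
    dsimp only at hc1 hc2 hc3
    have hκ : l (e (σ t' * (σ t)⁻¹)) = 0 := (hl _ hc1).1 (cosetMk_eq_iff.1 h.symm)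
    have h2 : l (e (σ t' * (σ t)⁻¹) + t • w) = t := by simp [hκ, hlw]
    have h3 : Φ (e (σ t' * (σ t)⁻¹) + t • w) = Φ (t' • w) := by
      have h4 : l (t' • w) = t' := by simp [hlw]
      rw [hΦ, Function.comp, Function.comp, hA, hA, h2, h4, add_sub_cancel_right, sub_self, chartMul,
        chartMul]
      dsimp only
      rw [e.left_inv hc1, hs, one_mul]
      exact congrArg e (inv_mul_cancel_right _ _)
    rw [← h2, Φ.injOn hc2 hc3 h3]
    simp [hlw]
  let Φ' := Φ.restr (l ⁻¹' N)
  have hΦ's : Φ'.source = Φ.source ∩ l ⁻¹' N := Φ.restr_source' _ (hN.preimage l.continuous)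
  have h0' : (0 : E) ∈ Φ'.source := by
    rw [hΦ's]
    exact ⟨h0Φ, by simpa using h0N⟩
  have hΦ't : Φ'.target ⊆ Φ.target := fun y hy => by
    have := Φ'.map_target hy
    rw [hΦ's] at this
    rw [← Φ'.right_inv hy]
    exact Φ.map_source this.1
  refine ⟨e.trans Φ'.symm, ?_, ?_, ?_⟩
  · rw [IsManifold.mem_maximalAtlas_iff_contMDiffOn]
    have h2 := contMDiffOn_iff_contDiffOn.2 hΦs
    have h3 : ContMDiffOn 𝓘(ℝ, E) 𝓘(ℝ, E) ∞ Φ Φ.source := by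
      rw [contMDiffOn_iff_contDiffOn, hΦ]
      exact (contDiffOn_chartMul he).comp A.contDiff.contDiffOn hΦD
    refine ⟨h2.comp ((contMDiffOn_of_mem_maximalAtlas he).mono inter_subset_left)
      fun g hg => hΦ't hg.2, (contMDiffOn_symm_of_mem_maximalAtlas he).comp
      (h3.mono fun x hx => ?_) fun x hx => hx.2⟩
    have := hx.1
    change x ∈ Φ'.source at this
    rw [hΦ's] at this
    exact this.1
  · refine ⟨h1, ?_⟩
    have := Φ'.map_source h0'
    change Φ 0 ∈ Φ'.target at this
    rw [hΦ0] at this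
    change e 1 ∈ Φ'.target
    rwa [h0]
  · have h3 : ∀ g ∈ (e.trans Φ'.symm).source, l (Φ.symm (e g)) ∈ N ∧
        cosetMk H g = cosetMk H (σ (l (Φ.symm (e g)))) := fun g hg => by
      have h4 : e g ∈ Φ'.target := hg.2
      have h5 := Φ'.map_target h4
      rw [hΦ's] at h5
      refine ⟨h5.2, ?_⟩
      have h6 : cosetMk H (e.symm (Φ (Φ.symm (e g)))) = cosetMk H (σ (l (Φ.symm (e g)))) :=
        hcos _ h5.1
      rwa [Φ.right_inv (hΦ't h4), e.left_inv hg.1] at h6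
    intro g hg g' hg'
    rw [(h3 g hg).2, (h3 g' hg').2]
    exact ⟨fun h => hNσ _ (h3 g hg).1 _ (h3 g' hg').1 h, fun h => congrArg (fun t => cosetMk H (σ t)) h⟩

end

section
variable (E : Type*) [NormedAddCommGroup E] [NormedSpace ℝ E] [FiniteDimensional ℝ E]
  {G : Type*} [Group G] [TopologicalSpace G] [IsTopologicalGroup G] [ChartedSpace E G]
  [LieGroup 𝓘(ℝ, E) ∞ G] (H : Subgroup G)

/-- Right translation by `p⁻¹` permutes the orbits `Hg`, so the chart at `1` can be moved to every
point with `l` unchanged. -/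
theorem exists_coset_chart [IsHypersurface E (H : Set G)] :
    ∃ (l : E →L[ℝ] ℝ) (w : E), l w = 1 ∧ ∀ p : G, ∃ φ ∈ IsManifold.maximalAtlas 𝓘(ℝ, E) ∞ G,
      p ∈ φ.source ∧ ∀ g ∈ φ.source, ∀ g' ∈ φ.source,
        cosetMk H g = cosetMk H g' ↔ l (φ g) = l (φ g') := by
  obtain ⟨e, he, h1, l, hl0, hl⟩ := IsHypersurface.exists_slice (E := E) (1 : G) H.one_mem
  obtain ⟨v, hv⟩ : ∃ v, l v ≠ 0 := by
    by_contra! h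
    exact hl0 (ContinuousLinearMap.ext h)
  have hlw : l ((l v)⁻¹ • v) = 1 := by simp [hv]
  have := FiniteDimensional.complete ℝ E
  obtain ⟨φ, hφ, h1φ, hφl⟩ := exists_coset_chart_at_one (H := H)
    (transHomeomorph_mem_maximalAtlas he (Homeomorph.addRight (-(e 1)))
      (by change ContDiff ℝ ∞ (fun y : E => y + -(e 1)); fun_prop)
      (by change ContDiff ℝ ∞ (fun y : E => y + -(-(e 1))); fun_prop))
    h1 (add_neg_cancel (e 1)) hlw (fun q hq => by
      rw [← SetLike.mem_coe, hl q hq]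
      change l (e q) = 0 ↔ l (e q + -(e 1)) = 0
      rw [map_add, map_neg, (hl 1 h1).1 H.one_mem, neg_zero, add_zero])
  refine ⟨l, _, hlw, fun p => ⟨(Homeomorph.mulRight p⁻¹).transOpenPartialHomeomorph φ, ?_, ?_,
    fun g hg g' hg' => ?_⟩⟩
  · rw [IsManifold.mem_maximalAtlas_iff_contMDiffOn]
    refine ⟨(contMDiffOn_of_mem_maximalAtlas hφ).comp
      (contMDiff_mul_right (I := 𝓘(ℝ, E)) (a := p⁻¹)).contMDiffOn fun g hg => hg,
      (contMDiff_mul_right (I := 𝓘(ℝ, E)) (a := p⁻¹⁻¹)).comp_contMDiffOn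
        (contMDiffOn_symm_of_mem_maximalAtlas hφ)⟩
  · change p * p⁻¹ ∈ φ.source
    rwa [mul_inv_cancel]
  · refine Iff.trans ?_ (hφl _ hg _ hg')
    rw [cosetMk_eq_iff, cosetMk_eq_iff]
    simp

/-- The space of cosets of a closed subgroup of codimension one is a manifold. -/
theorem exists_chartedSpace_cosetSpace [IsHypersurface E (H : Set G)] :
    ∃ _ : ChartedSpace ℝ (CosetSpace H), IsManifold 𝓘(ℝ, ℝ) ∞ (CosetSpace H) ∧
      Manifold.IsSubmersion 𝓘(ℝ, E) 𝓘(ℝ, ℝ) ∞ (cosetMk H) := by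
  obtain ⟨l, w, hlw, h⟩ := exists_coset_chart E H
  refine exists_chartedSpace_of_isOpenQuotientMap MulAction.isOpenQuotientMap_quotientMk hlw h
    -- Two points of one orbit differ by left translation with an element of `H`, which preserves
    -- all orbits.
    fun g g' hg => ⟨fun x => g' * g⁻¹ * x, contMDiff_mul_left, fun x => ?_, ?_⟩
  · exact cosetMk_mul ⟨_, cosetMk_eq_iff.1 hg.symm⟩ x
  · exact inv_mul_cancel_right _ _

end
end BGeometry

/-! ### The main theorem -/

theorem mainTheorem4
    {E : Type*} [NormedAddCommGroup E] [NormedSpace ℝ E] [FiniteDimensional ℝ E]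
    {EH : Type*} [NormedAddCommGroup EH] [NormedSpace ℝ EH]
    {G : Type*} [Group G] [TopologicalSpace G] [IsTopologicalGroup G] [T2Space G]
    [ChartedSpace E G] [LieGroup 𝓘(ℝ, E) ∞ G]
    -- `(G, H)` is a `b`-Lie group
    (H : Subgroup G) [IsClosed (H : Set G)] [BGeometry.IsHypersurface E (H : Set G)]
    -- `H` carries its structure of an embedded Lie subgroup
    [ChartedSpace EH H] [LieGroup 𝓘(ℝ, EH) ∞ H]
    (hH : Manifold.IsSmoothEmbedding 𝓘(ℝ, EH) 𝓘(ℝ, E) ∞ (Subtype.val : H → G)) :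
    -- `G/H` has a smooth structure for which the projection is a submersion
    (∃ _ : ChartedSpace ℝ (BGeometry.CosetSpace H),
      IsManifold 𝓘(ℝ, ℝ) ∞ (BGeometry.CosetSpace H) ∧
      Manifold.IsSubmersion 𝓘(ℝ, E) 𝓘(ℝ, ℝ) ∞ (BGeometry.cosetMk H)) ∧
    -- and for this structure:
    ∀ [ChartedSpace ℝ (BGeometry.CosetSpace H)] [IsManifold 𝓘(ℝ, ℝ) ∞ (BGeometry.CosetSpace H)],
      Manifold.IsSubmersion 𝓘(ℝ, E) 𝓘(ℝ, ℝ) ∞ (BGeometry.cosetMk H) →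
      -- the left translations by elements of `H` and the projection act on `b`-tangent vectors
      (∀ h : H, ∃! Φ, BGeometry.IsBDifferential E E (H : Set G) (H : Set G)
        (fun g : G => (h : G) * g) Φ) ∧
      (∃! Φ, BGeometry.IsBDifferential E ℝ (H : Set G) {BGeometry.cosetMk H 1}
        (BGeometry.cosetMk H) Φ) ∧
      -- `G → G/H` is a principal `H`-bundle
      BGeometry.IsPrincipalBundle 𝓘(ℝ, EH) 𝓘(ℝ, E) 𝓘(ℝ, ℝ) (fun (h : H) (g : G) => (h : G) * g)
        (BGeometry.cosetMk H) ∧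
      ∃ (_ : ChartedSpace (E × ℝ) (BGeometry.verticalAnnihilator H E EH))
        (act : H → BGeometry.verticalAnnihilator H E EH → BGeometry.verticalAnnihilator H E EH)
        (barπ : BGeometry.verticalAnnihilator H E EH →
          BGeometry.BCotangentBundle ℝ ({BGeometry.cosetMk H 1} : Set (BGeometry.CosetSpace H))),
        -- the annihilator of the vertical bundle is a submanifold
        IsManifold 𝓘(ℝ, E × ℝ) ∞ (BGeometry.verticalAnnihilator H E EH) ∧
        Manifold.IsSmoothEmbedding 𝓘(ℝ, E × ℝ) (𝓘(ℝ, E).prod 𝓘(ℝ, E →L[ℝ] ℝ)) ∞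
          (Subtype.val : BGeometry.verticalAnnihilator H E EH →
            BGeometry.BCotangentBundle E (H : Set G)) ∧
        -- the action is the restriction of the `b`-cotangent lift
        (∀ h α, (act h α : BGeometry.BCotangentBundle E (H : Set G)) =
          BGeometry.bCotangentLift H E h α) ∧
        -- the bundle map is well defined by its formula
        (∀ α β, BGeometry.DescendsTo E ℝ (H : Set G) {BGeometry.cosetMk H 1} (BGeometry.cosetMk H)
          α.1 β ↔ β = barπ α) ∧
        -- principal bundle over, and quotient onto, the `b`-cotangent bundle of `G/H`
        BGeometry.IsPrincipalBundle 𝓘(ℝ, EH) 𝓘(ℝ, E × ℝ) (𝓘(ℝ, ℝ).prod 𝓘(ℝ, ℝ →L[ℝ] ℝ)) act barπ ∧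
        IsOpenQuotientMap barπ ∧ (∀ α β, barπ α = barπ β ↔ ∃ h, act h α = β) ∧
        -- pull-back square, which is a map of principal bundles
        BGeometry.IsSmoothPullback.{w} 𝓘(ℝ, E × ℝ) 𝓘(ℝ, E) (𝓘(ℝ, ℝ).prod 𝓘(ℝ, ℝ →L[ℝ] ℝ))
          (fun α => α.1.proj) barπ (BGeometry.cosetMk H) (fun β => β.proj) ∧
        (∀ h α, (act h α).1.proj = (h : G) * α.1.proj) := by
  refine ⟨BGeometry.exists_chartedSpace_cosetSpace E H, fun {_ _} hπ =>
    ⟨BGeometry.existsUnique_isBDifferential_mul_left,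
      BGeometry.existsUnique_isBDifferential_cosetMk hπ, BGeometry.isPrincipalBundle_cosetMk hH hπ, ?_⟩⟩
  obtain ⟨cs, hman, hemb⟩ := BGeometry.exists_isSmoothEmbedding_verticalAnnihilator hH hπ
  choose barπ hbar using fun α : BGeometry.verticalAnnihilator H E EH =>
    BGeometry.exists_descendsToCoset_right hH hπ α.2
  have hiff : ∀ (α : BGeometry.verticalAnnihilator H E EH) β,
      BGeometry.DescendsToCoset α.1 β ↔ β = barπ α := fun α β =>
    ⟨fun h => h.right_unique hπ (hbar α), fun h => h ▸ hbar α⟩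
  -- Invariance of the annihilator: a lifted covector descends to the same covector of `G/H`, and
  -- whatever descends annihilates the vertical bundle.
  let act : H → BGeometry.verticalAnnihilator H E EH → BGeometry.verticalAnnihilator H E EH :=
    fun h α => ⟨BGeometry.bCotangentLift H E h α,
      ((hbar α).bCotangentLift hπ h).mem_verticalAnnihilator hH hπ⟩
  have hact : ∀ h α, barπ (act h α) = barπ α := fun h α =>
    ((hiff (act h α) _).1 ((hbar α).bCotangentLift hπ h)).symm
  have hext : ∀ α α' : BGeometry.verticalAnnihilator H E EH, α.1.1 = α'.1.1 → barπ α = barπ α' →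
      α = α' := fun α α' h1 h2 => Subtype.ext ((hbar α).left_unique (h2 ▸ hbar α') h1)
  have hproj : ∀ α, (barπ α).1 = BGeometry.cosetMk H α.1.1 := fun α => (hbar α).proj_eq
  -- The compatibility condition is put inside the existential so that `lift` can be chosen as a
  -- total function; for incompatible pairs the zero covector at `g` is a dummy value.
  have hlift : ∀ (g : G) (β : BGeometry.BCotangentBundle ℝ
      ({BGeometry.cosetMk H 1} : Set (BGeometry.CosetSpace H))),
      ∃ α : BGeometry.verticalAnnihilator H E EH, BGeometry.cosetMk H g = β.1 →
        α.1.1 = g ∧ barπ α = β := by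
    intro g β
    by_cases h : BGeometry.cosetMk H g = β.1
    · obtain ⟨α, hα, hd⟩ := BGeometry.exists_descendsToCoset_left (E := E) h
      exact ⟨⟨α, hd.mem_verticalAnnihilator hH hπ⟩, fun _ => ⟨hα, ((hiff ⟨α, _⟩ _).1 hd).symm⟩⟩
    · exact ⟨⟨⟨g, 0⟩, fun _ _ => rfl⟩, fun h' => absurd h' h⟩
  choose lift hlift using hlift
  have hπc := Manifold.IsSubmersion.contMDiff hπ
  have hbarc : ContMDiff 𝓘(ℝ, E × ℝ) (𝓘(ℝ, ℝ).prod 𝓘(ℝ, ℝ →L[ℝ] ℝ)) ∞ barπ := fun α =>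
    BGeometry.contMDiffAt_of_descendsToCoset_left hπ hbar hemb.contMDiff.contMDiffAt
  have hprojc : ContMDiff 𝓘(ℝ, E × ℝ) 𝓘(ℝ, E) ∞
      (fun α : BGeometry.verticalAnnihilator H E EH => α.1.1) :=
    (Bundle.contMDiff_proj _).comp hemb.contMDiff
  have hprin : BGeometry.IsPrincipalBundle 𝓘(ℝ, EH) 𝓘(ℝ, E × ℝ) (𝓘(ℝ, ℝ).prod 𝓘(ℝ, ℝ →L[ℝ] ℝ))
      act barπ := by
    refine .of_pullback (actA := fun (h : H) (g : G) => (h : G) * g) (fun g => one_mul g)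
      (fun k k' g => mul_assoc (k : G) k' g) hprojc hbarc (Bundle.contMDiff_proj _)
      (fun α => (hproj α).symm) (fun _ _ => rfl) hact hext hlift
      (fun x => ?_) (fun s V hV hs hsec y hy => ?_) (BGeometry.exists_section_cosetMk hH hπ)
    · refine BGeometry.contMDiffAt_verticalAnnihilator hemb hπ (fun x => hbar (act x.1 x.2)) ?_ ?_
      · exact ((hH.contMDiff.comp contMDiff_fst).mul (hprojc.comp contMDiff_snd)).contMDiffAt
      · simp only [hact]
        exact (hbarc.comp contMDiff_snd).contMDiffAt
    · refine (BGeometry.contMDiffAt_verticalAnnihilator hemb hπ (fun x => hbar (s x))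
        (hs.contMDiffAt (hV.mem_nhds hy)) ?_).contMDiffWithinAt
      refine contMDiffAt_id.congr_of_eventuallyEq ?_
      filter_upwards [hV.mem_nhds hy] with x hx using hsec x hx
  refine ⟨cs, act, barπ, hman, hemb, fun _ _ => rfl, hiff, ?_, ?_, ?_, ?_, fun _ _ => rfl⟩
  · exact hprin
  · exact ⟨fun β => ⟨lift (Quotient.out β.1) β, (hlift _ β (Quotient.out_eq β.1)).2⟩,
      hbarc.continuous, hprin.isOpenMap⟩
  · refine fun α β => ⟨fun h => ?_, ?_⟩
    · have h1 : BGeometry.cosetMk H α.1.1 = BGeometry.cosetMk H β.1.1 := by rw [← hproj, h, hproj]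
      -- The element of `H` is forced by the base points; since the action preserves `barπ`,
      -- injectivity of (base point, `barπ`) gives the equality of covectors.
      refine ⟨⟨β.1.1 * (α.1.1)⁻¹, BGeometry.cosetMk_eq_iff.1 h1.symm⟩, hext _ _ ?_ ?_⟩
      · exact inv_mul_cancel_right _ _
      · rw [hact, h]
    · rintro ⟨h, rfl⟩
      exact (hact h α).symm
  · refine ⟨hprojc, hbarc, fun α => (hproj α).symm, fun {EN N _ _ _ _ _ _} u v hu hv huv => ?_⟩
    have h1 : ∀ y, (lift (u y) (v y)).1.1 = u y ∧ barπ (lift (u y) (v y)) = v y :=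
      fun y => hlift _ _ (huv y)
    refine ⟨fun y => lift (u y) (v y), ⟨fun y => ?_, fun y => (h1 y).1, fun y => (h1 y).2⟩, ?_⟩
    · refine BGeometry.contMDiffAt_verticalAnnihilator hemb hπ
        (fun x => hbar (lift (u x) (v x))) ?_ ?_
      · simp only [h1]
        exact hu y
      · simp only [h1]
        exact hv y
    · rintro c ⟨-, hc1, hc2⟩
      exact funext fun y => hext _ _ ((hc1 y).trans (h1 y).1.symm) ((hc2 y).trans (h1 y).2.symm)
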